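/- Let $N$ be a finite von Neumann algebra with a faithful normal tracial state $\tau$, and write $\|x\|_2=\tau(x^*x)^{1/2}$. All von Neumann subalgebras contain the unit, and $(B)_1$ denotes the operator-norm unit ball of $B$. *$L^2$-deformations.* Let $M\supset N$ be a von Neumann algebra with a faithful normal tracial state $\tau'$ such that $\tau'|_N=\tau$, let $\mathcal H=(L^2(M,\tau')\,\overline\otimes\,L^2(M,\tau'))^{\oplus\infty}$ be the countable direct sum of copies of the coarse $M$-$M$ bimodule (with $x(\xi\otimes\xi')y=x\xi\otimes\xi'y$), and let $\delta:D(\delta)\to\mathcal H$ be a linear map, where $D(\delta)\subset M$ is a weakly dense $*$-subalgebra, such that $\delta(xy)=x\delta(y)+\delta(x)y$ and $\langle\delta(x),y\delta(z)\rangle=\langle\delta(z^*)y^*,\delta(x^*)\rangle$ for all $x,y,z\in D(\delta)$, and such that $\delta$ is closable as an unbounded operator from $L^2(M,\tau')$ to $\mathcal H$. Then the family $\eta_\alpha=\alpha(\alpha+\delta^*\overline\delta)^{-1}$, $\alpha>0$, is called an $L^2$-deformation for $N$. For a free ultrafilter $\omega$ on $\mathbb N$ let $N^\omega$ be the tracial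 ultrapower $\ell^\infty(\mathbb N,N)/\{(x_n)_n:\lim_{n\to\omega}\|x_n\|_2=0\}$, which contains $N$ as the constant sequences; $\eta_\alpha$ acts on it by $\eta_\alpha((x_n)_n)=(\eta_\alpha(x_n))_n$, so that $\|x-\eta_\alpha(x)\|_2=\lim_{n\to\omega}\|x_n-\eta_\alpha(x_n)\|_2$ for $x=(x_n)_n$. The deformation converges uniformly on $(B)_1$, where $B\subset N$ or $B\subset N^\omega$, if for every $\varepsilon>0$ there is $\alpha_0>0$ such that $\|b-\eta_\alpha(b)\|_2<\varepsilon$ for all $\alpha>\alpha_0$ and all $b\in(B)_1$. For a von Neumann subalgebra $B\subset N$, the inclusion $(B\subset N)$ is $L^2$-rigid if every $L^2$-deformation for $N$ converges uniformly on $(B)_1$. For $B\subset P$ let $\mathcal N_P(B)=\{u\in\mathcal U(P): uBu^*=B\}$, and let $W^*(S)$ be the von Neumann algebra generated by $S$. A von Neumann algebra is diffuse if it has no minimal projections. **Theorem.** 1. Let $\omega$ be a free ultrafilter on $\mathbb N$, let $\{\eta_\alpha\}_\alpha$ be an $L^2$-deformation for $N$, and let $B\subset N^\omega$ be a diffuse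 von Neumann subalgebra such that $\{\eta_\alpha\}_\alpha$ converges uniformly on $(B)_1$. Then $\{\eta_\alpha\}_\alpha$ converges uniformly on $(W^*(N\cap\mathcal N_{N^\omega}(B)))_1$. 2. In particular, if $B\subset N$ is a diffuse von Neumann subalgebra and $(B\subset N)$ is $L^2$-rigid, then $(W^*(\mathcal N_N(B))\subset N)$ is $L^2$-rigid. -/

import Mathlib

open scoped ComplexOrder InnerProductSpace TensorProduct ENNReal Topology
open Filter

universe u

noncomputable section

namespace L2Rigidity

section Functionals

attribute [local instance] CStarAlgebra.spectralOrder CStarAlgebra.spectralOrderedRing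

/-- A linear functional `φ` on a C⋆-algebra with `φ (a⋆a) ≥ 0`, as a positive linear map for the
usual order of the C⋆-algebra. -/
def posFunctional {A : Type*} [NonUnitalCStarAlgebra A] (φ : A →ₗ[ℂ] ℂ)
    (h : ∀ a, 0 ≤ φ (star a * a)) : A →ₚ[ℂ] ℂ :=
  PositiveLinearMap.mk₀ φ (by
    intro x hx
    rw [StarOrderedRing.nonneg_iff] at hx
    induction hx using AddSubmonoid.closure_induction with
    | mem x hx => obtain ⟨s, rfl⟩ := hx; exact h s
    | zero => simp
    | add x y _ _ hx hy => rw [map_add]; exact add_nonneg hx hy)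

/-- The Hilbert space `L²(A, φ)`: the completion of `A` for the inner product
`⟪a, b⟫ = φ (a⋆ b)`. -/
def GNSSpace {A : Type*} [NonUnitalCStarAlgebra A] (φ : A →ₗ[ℂ] ℂ)
    (h : ∀ a, 0 ≤ φ (star a * a)) : Type _ :=
  (posFunctional φ h).GNS

instance {A : Type*} [NonUnitalCStarAlgebra A] (φ : A →ₗ[ℂ] ℂ)
    (h : ∀ a, 0 ≤ φ (star a * a)) : NormedAddCommGroup (GNSSpace φ h) :=
  inferInstanceAs (NormedAddCommGroup (posFunctional φ h).GNS)

instance {A : Type*} [NonUnitalCStarAlgebra A] (φ : A →ₗ[ℂ] ℂ)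
    (h : ∀ a, 0 ≤ φ (star a * a)) : InnerProductSpace ℂ (GNSSpace φ h) :=
  inferInstanceAs (InnerProductSpace ℂ (posFunctional φ h).GNS)

instance {A : Type*} [NonUnitalCStarAlgebra A] (φ : A →ₗ[ℂ] ℂ)
    (h : ∀ a, 0 ≤ φ (star a * a)) : CompleteSpace (GNSSpace φ h) :=
  inferInstanceAs (CompleteSpace (posFunctional φ h).GNS)

/-- The canonical map `A → L²(A, φ)`, `a ↦ â`. -/
def gnsHat {A : Type*} [NonUnitalCStarAlgebra A] (φ : A →ₗ[ℂ] ℂ)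
    (h : ∀ a, 0 ≤ φ (star a * a)) : A →ₗ[ℂ] GNSSpace φ h :=
  (UniformSpace.Completion.toComplL (𝕜 := ℂ)
    (E := (posFunctional φ h).PreGNS)).toLinearMap ∘ₗ
      (posFunctional φ h).toPreGNS.toLinearMap

lemma norm_gnsHat_sq {A : Type*} [NonUnitalCStarAlgebra A] (φ : A →ₗ[ℂ] ℂ)
    (h : ∀ a, 0 ≤ φ (star a * a)) (a : A) : ((‖gnsHat φ h a‖ ^ 2 : ℝ) : ℂ) = φ (star a * a) := by
  have h1 : ‖gnsHat φ h a‖ = ‖(posFunctional φ h).toPreGNS a‖ :=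
    UniformSpace.Completion.norm_coe _
  rw [h1, Complex.ofReal_pow, PositiveLinearMap.preGNS_norm_sq]
  rfl

/-- The representation of `A` on `L²(A, φ)` by left multiplication, `a • b̂ = (a b)^`. -/
def gnsLeft {A : Type*} [NonUnitalCStarAlgebra A] (φ : A →ₗ[ℂ] ℂ)
    (h : ∀ a, 0 ≤ φ (star a * a)) : A →⋆ₙₐ[ℂ] (GNSSpace φ h →L[ℂ] GNSSpace φ h) :=
  (posFunctional φ h).gnsNonUnitalStarAlgHom

lemma norm_mulRight_le {A : Type*} [NonUnitalCStarAlgebra A] (f : A →ₚ[ℂ] ℂ)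
    (hτ : ∀ a b, f (a * b) = f (b * a)) (a : A) (x : f.PreGNS) :
    ‖f.toPreGNS (f.ofPreGNS x * a)‖ ≤ ‖a‖ * ‖x‖ := by
  rw [← sq_le_sq₀ (by positivity) (mul_nonneg (norm_nonneg _) (norm_nonneg _)), mul_pow,
    ← RCLike.ofReal_le_ofReal (K := ℂ), RCLike.ofReal_pow,
    RCLike.ofReal_eq_complex_ofReal, PositiveLinearMap.preGNS_norm_sq]
  obtain ⟨b, hb⟩ : ∃ b, b = f.ofPreGNS x := ⟨f.ofPreGNS x, rfl⟩
  have key : b * (a * star a) * star b ≤ ‖a‖ ^ 2 • (b * star b) := by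
    have := CStarAlgebra.star_left_conjugate_le_norm_smul (a := star b) (b := a * star a)
    rw [star_star, CStarRing.norm_self_mul_star, ← sq] at this
    simpa [smul_mul_assoc] using this
  rw [PositiveLinearMap.ofPreGNS_toPreGNS, ← hb]
  calc f (star (b * a) * (b * a)) = f (b * (a * star a) * star b) := by
        rw [hτ (star (b * a)) (b * a), star_mul]; simp only [mul_assoc]
    _ ≤ f (‖a‖ ^ 2 • (b * star b)) := OrderHomClass.mono f key
    _ = _ := by
        rw [← Complex.coe_smul, map_smul, hτ b (star b)]
        change _ = (((‖a‖ ^ 2 * ‖x‖ ^ 2 : ℝ) : ℂ))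
        rw [Complex.ofReal_mul, Complex.ofReal_pow ‖x‖, PositiveLinearMap.preGNS_norm_sq, hb,
          smul_eq_mul]

/-- For a tracial functional: right multiplication on `L²(A, φ)`, `b̂ • a = (b a)^`. -/
def gnsRight {A : Type*} [NonUnitalCStarAlgebra A] (φ : A →ₗ[ℂ] ℂ)
    (h : ∀ a, 0 ≤ φ (star a * a)) (hτ : ∀ a b, φ (a * b) = φ (b * a)) (a : A) :
    GNSSpace φ h →L[ℂ] GNSSpace φ h :=
  ContinuousLinearMap.completion <|
    LinearMap.mkContinuous
      ((posFunctional φ h).toPreGNS.toLinearMap ∘ₗ (LinearMap.mulRight ℂ a) ∘ₗ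
        (posFunctional φ h).ofPreGNS.toLinearMap) ‖a‖ (norm_mulRight_le (posFunctional φ h) hτ a)

lemma gnsLeft_gnsHat {A : Type*} [NonUnitalCStarAlgebra A] (φ : A →ₗ[ℂ] ℂ)
    (h : ∀ a, 0 ≤ φ (star a * a)) (a b : A) :
    gnsLeft φ h a (gnsHat φ h b) = gnsHat φ h (a * b) :=
  PositiveLinearMap.gnsNonUnitalStarAlgHom_apply_coe _

lemma gnsRight_gnsHat {A : Type*} [NonUnitalCStarAlgebra A] (φ : A →ₗ[ℂ] ℂ)
    (h : ∀ a, 0 ≤ φ (star a * a)) (hτ : ∀ a b, φ (a * b) = φ (b * a)) (a b : A) :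
    gnsRight φ h hτ a (gnsHat φ h b) = gnsHat φ h (b * a) :=
  ContinuousLinearMap.completion_apply_coe _ _

lemma norm_apply_le_of_pos {A : Type*} [NonUnitalCStarAlgebra A] (φ : A →ₗ[ℂ] ℂ)
    (h : ∀ a, 0 ≤ φ (star a * a)) : ∃ C : ℝ, ∀ a, ‖φ a‖ ≤ C * ‖a‖ := by
  obtain ⟨C, hC⟩ := (posFunctional φ h).exists_norm_apply_le
  exact ⟨C, hC⟩

end Functionals

/-- A componentwise bounded operator on the countable Hilbert sum `E ⊕ E ⊕ ⋯`. -/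
def ampliate {E : Type*} [NormedAddCommGroup E] [InnerProductSpace ℂ E] (T : E →L[ℂ] E) :
    lp (fun _ : ℕ => E) 2 →ₗ[ℂ] lp (fun _ : ℕ => E) 2 where
  toFun ξ := ⟨fun n => T (ξ n), by
    have h := (lp.memℓp ξ).const_smul ‖T‖
    refine memℓp_gen ?_
    have h2 := h.summable (by norm_num)
    refine Summable.of_nonneg_of_le (fun n => by positivity) (fun n => ?_) h2
    gcongr
    simpa [norm_smul] using T.le_opNorm (ξ n)⟩
  map_add' ξ ξ' := by ext n; exact map_add T _ _
  map_smul' c ξ := by ext n; exact map_smul T _ _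

/-- The Hilbert space tensor product `E ⊗̄ F`. -/
def HilbertTensor (E F : Type*) [NormedAddCommGroup E] [InnerProductSpace ℂ E]
    [NormedAddCommGroup F] [InnerProductSpace ℂ F] : Type _ :=
  UniformSpace.Completion (E ⊗[ℂ] F)

section HilbertTensor

variable (E F : Type*) [NormedAddCommGroup E] [InnerProductSpace ℂ E]
  [NormedAddCommGroup F] [InnerProductSpace ℂ F]

instance : NormedAddCommGroup (HilbertTensor E F) :=
  inferInstanceAs (NormedAddCommGroup (UniformSpace.Completion (E ⊗[ℂ] F)))

instance : InnerProductSpace ℂ (HilbertTensor E F) :=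
  inferInstanceAs (InnerProductSpace ℂ (UniformSpace.Completion (E ⊗[ℂ] F)))

instance : CompleteSpace (HilbertTensor E F) :=
  inferInstanceAs (CompleteSpace (UniformSpace.Completion (E ⊗[ℂ] F)))

variable {E F}

/-- The operator `T ⊗ 1` on `E ⊗̄ F`. -/
def tensorLeft (T : E →L[ℂ] E) : HilbertTensor E F →L[ℂ] HilbertTensor E F :=
  (T.rTensor F).completion

/-- The operator `1 ⊗ T` on `E ⊗̄ F`. -/
def tensorRight (T : F →L[ℂ] F) : HilbertTensor E F →L[ℂ] HilbertTensor E F :=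
  (T.lTensor E).completion

end HilbertTensor

section VN

variable {K : Type u} [NormedAddCommGroup K] [InnerProductSpace ℂ K] [CompleteSpace K]

instance isClosed_vonNeumannAlgebra (N : VonNeumannAlgebra K) :
    IsClosed (N.toStarSubalgebra : Set (K →L[ℂ] K)) := by
  have h : (N.toStarSubalgebra : Set (K →L[ℂ] K)) =
      Set.centralizer (Set.centralizer (N : Set (K →L[ℂ] K))) := by simp
  rw [h]
  exact Set.isClosed_centralizer _

instance (N : VonNeumannAlgebra K) : CStarAlgebra N.toStarSubalgebra :=
  StarSubalgebra.cstarAlgebra N.toStarSubalgebra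

/-- A faithful normal tracial state `τ` on a von Neumann algebra `N ⊆ B(K)`. Normality of the
positive functional `τ` is expressed as `τ = ∑ₙ ⟪ξₙ, · ξₙ⟫` for some vectors `ξₙ` in `K`
(with `∑ₙ ‖ξₙ‖² = τ 1 < ∞`). -/
structure FaithfulNormalTrace (N : VonNeumannAlgebra K) where
  toLinearMap : N.toStarSubalgebra →ₗ[ℂ] ℂ
  nonneg : ∀ x, 0 ≤ toLinearMap (star x * x)
  map_one : toLinearMap 1 = 1
  map_mul_comm : ∀ x y, toLinearMap (x * y) = toLinearMap (y * x)
  faithful : ∀ x, toLinearMap (star x * x) = 0 → x = 0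
  normal : ∃ ξ : ℕ → K, ∀ x : N.toStarSubalgebra,
    HasSum (fun n => ⟪ξ n, (x : K →L[ℂ] K) (ξ n)⟫_ℂ) (toLinearMap x)

variable {N : VonNeumannAlgebra K} (τ : FaithfulNormalTrace N)

/-- The Hilbert space `L²(N, τ)`. -/
abbrev L2 : Type u := GNSSpace τ.toLinearMap τ.nonneg

/-- The canonical inclusion `N → L²(N, τ)`, `x ↦ x̂`; thus `‖hat τ x‖ = ‖x‖₂`. -/
def hat : N.toStarSubalgebra →ₗ[ℂ] L2 τ := gnsHat τ.toLinearMap τ.nonneg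

/-- The Hilbert tensor product `L²(N, τ) ⊗̄ L²(N, τ)`. -/
abbrev L2L2 : Type u := HilbertTensor (L2 τ) (L2 τ)

/-- The Hilbert space `(L²(N, τ) ⊗̄ L²(N, τ))^{⊕ ∞}`. -/
abbrev Coarse : Type u := lp (fun _ : ℕ => L2L2 τ) 2

/-- Left action of `N` on `(L²(N, τ) ⊗̄ L²(N, τ))^{⊕ ∞}`: `x (ξ ⊗ η) = (x ξ) ⊗ η` in each
summand. -/
def coarseLeft (x : N.toStarSubalgebra) : Coarse τ →ₗ[ℂ] Coarse τ :=
  ampliate (tensorLeft (gnsLeft τ.toLinearMap τ.nonneg x))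

/-- Right action of `N` on `(L²(N, τ) ⊗̄ L²(N, τ))^{⊕ ∞}`: `(ξ ⊗ η) x = ξ ⊗ (η x)` in each
summand. -/
def coarseRight (x : N.toStarSubalgebra) : Coarse τ →ₗ[ℂ] Coarse τ :=
  ampliate (tensorRight (gnsRight τ.toLinearMap τ.nonneg τ.map_mul_comm x))

lemma hat_injective : Function.Injective (hat τ) := by
  rw [← LinearMap.ker_eq_bot, LinearMap.ker_eq_bot']
  intro x hx
  apply τ.faithful
  rw [← norm_gnsHat_sq τ.toLinearMap τ.nonneg x]
  change ((‖hat τ x‖ ^ 2 : ℝ) : ℂ) = 0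
  simp [hx]

/-- A derivation `δ : D → (L²(N, τ) ⊗̄ L²(N, τ))^{⊕ ∞}`, densely defined: `D` is a `*`-subalgebra
of `N`, dense in `N` for the weak operator topology. -/
structure CoarseDerivation where
  dom : NonUnitalStarSubalgebra ℂ N.toStarSubalgebra
  dense : ∀ x : N.toStarSubalgebra,
    ContinuousLinearMapWOT.ofCLM (x : K →L[ℂ] K) ∈
      closure ((fun y : N.toStarSubalgebra => ContinuousLinearMapWOT.ofCLM (y : K →L[ℂ] K)) ''
        (dom : Set N.toStarSubalgebra))
  toFun : dom →ₗ[ℂ] Coarse τ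
  leibniz : ∀ x y : dom,
    toFun (x * y) = coarseLeft τ x (toFun y) + coarseRight τ y (toFun x)

/-- The derivation `δ` as an unbounded operator from `L²(N, τ)`, with domain `{x̂ | x ∈ D}`. -/
def CoarseDerivation.toPMap {τ : FaithfulNormalTrace N} (δ : CoarseDerivation τ) :
    L2 τ →ₗ.[ℂ] Coarse τ where
  domain := δ.dom.toNonUnitalSubalgebra.toSubmodule.map (hat τ)
  toFun := δ.toFun ∘ₗ
    (Submodule.equivMapOfInjective (hat τ) (hat_injective τ)
      δ.dom.toNonUnitalSubalgebra.toSubmodule).symm.toLinearMap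

/-- A densely defined real closable derivation into `(L²(N, τ) ⊗̄ L²(N, τ))^{⊕ ∞}`. Here
`⟪·,·⟫_ℂ` is linear in the second variable. -/
structure RealClosableDerivation extends CoarseDerivation τ where
  real : ∀ x y z : dom,
    ⟪coarseLeft τ y (toFun z), toFun x⟫_ℂ =
      ⟪toFun (star x), coarseRight τ (star (y : N.toStarSubalgebra)) (toFun (star z))⟫_ℂ
  closable : toCoarseDerivation.toPMap.IsClosable

/-- The von Neumann algebra `W*(S) ⊆ B(K)` generated by a set `S` of operators: the double
commutant of `S ∪ S⋆`. -/
def generatedVN (S : Set (K →L[ℂ] K)) : VonNeumannAlgebra K where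
  toStarSubalgebra :=
    StarSubalgebra.centralizer ℂ (StarSubalgebra.centralizer ℂ S : Set (K →L[ℂ] K))
  centralizer_centralizer' := by
    change Set.centralizer (Set.centralizer (StarSubalgebra.centralizer ℂ
      (StarSubalgebra.centralizer ℂ S : Set (K →L[ℂ] K)) : Set (K →L[ℂ] K))) = _
    rw [StarSubalgebra.coe_centralizer_centralizer]
    simp only [Set.centralizer_centralizer_centralizer]
    exact (StarSubalgebra.coe_centralizer_centralizer ℂ S).symm

/-- A von Neumann algebra is diffuse if it has no minimal projections. -/
def IsDiffuse (B : VonNeumannAlgebra K) : Prop :=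
  ∀ p ∈ B, IsStarProjection p → p ≠ 0 →
    ∃ q ∈ B, IsStarProjection q ∧ p * q = q ∧ q ≠ 0 ∧ q ≠ p

/-- The normalizer `𝒩_N(B)`: unitaries `u` of `N` with `u B u⋆ = B`. -/
def normalizer (N B : VonNeumannAlgebra K) : Set (K →L[ℂ] K) :=
  {u | u ∈ N ∧ u ∈ unitary (K →L[ℂ] K) ∧
    (fun x => u * x * star u) '' (B : Set (K →L[ℂ] K)) = B}

end VN

section BoundedSeq

/-- The C⋆-algebra `ℓ^∞(ℕ, A)` of bounded sequences in `A`. -/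
def BoundedSeq (A : Type*) [CStarAlgebra A] : Type _ := lp (fun _ : ℕ => A) ∞

variable {A : Type*} [CStarAlgebra A]

instance : NonUnitalCStarAlgebra (BoundedSeq A) :=
  inferInstanceAs (NonUnitalCStarAlgebra (lp (fun _ : ℕ => A) ∞))

instance : CoeFun (BoundedSeq A) (fun _ => ℕ → A) :=
  ⟨fun a n => (show lp (fun _ : ℕ => A) ∞ from a).1 n⟩

/-- The constant sequence. -/
def BoundedSeq.const (x : A) : BoundedSeq A :=
  (⟨fun _ => x, memℓp_infty ⟨‖x‖, by rintro _ ⟨n, rfl⟩; exact le_rfl⟩⟩ : lp (fun _ : ℕ => A) ∞)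

lemma tendsto_ultraFunctional (φ : A →ₗ[ℂ] ℂ) (h : ∀ a, 0 ≤ φ (star a * a))
    (ω : Ultrafilter ℕ) (a : BoundedSeq A) :
    Tendsto (fun n => φ (a n)) ω (𝓝 (limUnder (ω : Filter ℕ) (fun n => φ (a n)))) := by
  apply tendsto_nhds_limUnder
  obtain ⟨C, hC⟩ := norm_apply_le_of_pos φ h
  have hb : ∀ n, φ (a n) ∈ Metric.closedBall (0 : ℂ) (|C| * ‖a‖) := by
    intro n
    rw [mem_closedBall_zero_iff]
    calc _ ≤ C * ‖a n‖ := hC _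
      _ ≤ |C| * ‖a n‖ := by gcongr; exact le_abs_self C
      _ ≤ _ := by gcongr; exact lp.norm_apply_le_norm (E := fun _ : ℕ => A) (by simp) a n
  obtain ⟨x, -, hx⟩ := (isCompact_closedBall (0 : ℂ) (|C| * ‖a‖)).ultrafilter_le_nhds
    (ω.map (fun n => φ (a n))) (by
      rw [le_principal_iff, Ultrafilter.mem_coe, Ultrafilter.mem_map]
      exact Filter.univ_mem' hb)
  exact ⟨x, hx⟩

/-- The functional `(aₙ)ₙ ↦ lim_{n → ω} φ(aₙ)` on `ℓ^∞(ℕ, A)`. -/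
def ultraFunctional (φ : A →ₗ[ℂ] ℂ) (h : ∀ a, 0 ≤ φ (star a * a)) (ω : Ultrafilter ℕ) :
    BoundedSeq A →ₗ[ℂ] ℂ where
  toFun a := limUnder (ω : Filter ℕ) (fun n => φ (a n))
  map_add' a b := by
    refine tendsto_nhds_unique (tendsto_ultraFunctional φ h ω (a + b)) ?_
    refine ((tendsto_ultraFunctional φ h ω a).add (tendsto_ultraFunctional φ h ω b)).congr ?_
    exact fun n => (map_add φ _ _).symm
  map_smul' c a := by
    refine tendsto_nhds_unique (tendsto_ultraFunctional φ h ω (c • a)) ?_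
    refine ((tendsto_ultraFunctional φ h ω a).const_mul c).congr ?_
    exact fun n => (map_smul φ _ _).symm

lemma ultraFunctional_nonneg (φ : A →ₗ[ℂ] ℂ) (h : ∀ a, 0 ≤ φ (star a * a))
    (ω : Ultrafilter ℕ) (a : BoundedSeq A) :
    0 ≤ ultraFunctional φ h ω (star a * a) :=
  ge_of_tendsto' (tendsto_ultraFunctional φ h ω (star a * a)) fun n => h (a n)

end BoundedSeq

section Ultrapower

variable {K : Type u} [NormedAddCommGroup K] [InnerProductSpace ℂ K] [CompleteSpace K]
variable {N : VonNeumannAlgebra K} (τ : FaithfulNormalTrace N) (ω : Ultrafilter ℕ)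

/-- The Hilbert space `L²(N^ω, τ_ω)`: the completion of `ℓ^∞(ℕ, N)` for
`⟪a, b⟫ = lim_{n → ω} τ(aₙ⋆ bₙ)`. -/
abbrev UltraL2 : Type u :=
  GNSSpace (ultraFunctional τ.toLinearMap τ.nonneg ω)
    (ultraFunctional_nonneg τ.toLinearMap τ.nonneg ω)

/-- The map sending a bounded sequence `a` to its class `(aₙ)ₙ` in `N^ω`. As `τ_ω` is a trace, the
kernel of this representation is `{a | lim_{n → ω} ‖aₙ‖₂ = 0}`. -/
def toUltra : BoundedSeq N.toStarSubalgebra →⋆ₙₐ[ℂ] (UltraL2 τ ω →L[ℂ] UltraL2 τ ω) :=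
  gnsLeft (ultraFunctional τ.toLinearMap τ.nonneg ω)
    (ultraFunctional_nonneg τ.toLinearMap τ.nonneg ω)

/-- The tracial ultrapower `N^ω = ℓ^∞(ℕ, N) / {a | lim_{n → ω} ‖aₙ‖₂ = 0}`, acting on
`L²(N^ω, τ_ω)`. -/
def ultrapower : Set (UltraL2 τ ω →L[ℂ] UltraL2 τ ω) := Set.range (toUltra τ ω)

/-- The inclusion `N ⊆ N^ω` by constant sequences. -/
def ultraConst (x : N.toStarSubalgebra) : UltraL2 τ ω →L[ℂ] UltraL2 τ ω :=
  toUltra τ ω (BoundedSeq.const x)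

/-- `N ∩ 𝒩_{N^ω}(B)`: the unitaries `v` of `N` with `v B v⋆ = B` in `N^ω`. -/
def ultraNormalizer (B : VonNeumannAlgebra (UltraL2 τ ω)) : Set (K →L[ℂ] K) :=
  {v | ∃ hv : v ∈ N.toStarSubalgebra, v ∈ unitary (K →L[ℂ] K) ∧
    (fun x => ultraConst τ ω ⟨v, hv⟩ * x * star (ultraConst τ ω ⟨v, hv⟩)) ''
      (B : Set (UltraL2 τ ω →L[ℂ] UltraL2 τ ω)) = B}

end Ultrapower

section Resolvent

variable {E F : Type*} [NormedAddCommGroup E] [InnerProductSpace ℂ E] [CompleteSpace E]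
  [NormedAddCommGroup F] [InnerProductSpace ℂ F]

/-- The graph of the operator `Δ = T⋆ T̄`, where `T̄` is the closure of `T`. -/
def laplacianGraph (T : E →ₗ.[ℂ] F) : Set (E × E) :=
  {p | ∃ ψ : F, (p.1, ψ) ∈ T.closure.graph ∧ (ψ, p.2) ∈ T.adjoint.graph}

lemma inner_eq_of_mem_graph (T : E →ₗ.[ℂ] F) (hd : Dense (T.domain : Set E))
    (hT : T.IsClosable) {ψ : F} {χ : E} (h : (ψ, χ) ∈ T.adjoint.graph) {ζ : E} {ρ : F}
    (h' : (ζ, ρ) ∈ T.closure.graph) : ⟪χ, ζ⟫_ℂ = ⟪ψ, ρ⟫_ℂ := by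
  rw [← hT.graph_closure_eq_closure_graph] at h'
  have h'' : (ζ, ρ) ∈ closure (T.graph : Set (E × F)) := h'
  have hc : IsClosed {p : E × F | ⟪χ, p.1⟫_ℂ = ⟪ψ, p.2⟫_ℂ} :=
    isClosed_eq (by fun_prop) (by fun_prop)
  refine closure_minimal (t := {p : E × F | ⟪χ, p.1⟫_ℂ = ⟪ψ, p.2⟫_ℂ}) ?_ hc h''
  rintro ⟨a, b⟩ hab
  rw [SetLike.mem_coe, LinearPMap.mem_graph_iff] at hab
  obtain ⟨y, rfl, rfl⟩ := hab
  rw [LinearPMap.mem_graph_iff] at h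
  obtain ⟨z, rfl, rfl⟩ := h
  exact T.adjoint_isFormalAdjoint hd z y

lemma mem_adjoint_graph (T : E →ₗ.[ℂ] F) (hd : Dense (T.domain : Set E)) {ψ : F} {χ : E}
    (h : ∀ x : T.domain, ⟪χ, (x : E)⟫_ℂ = ⟪ψ, T x⟫_ℂ) : (ψ, χ) ∈ T.adjoint.graph := by
  have hm : ψ ∈ T.adjoint.domain := T.mem_adjoint_domain_of_exists ψ ⟨χ, h⟩
  rw [LinearPMap.mem_graph_iff]
  exact ⟨⟨ψ, hm⟩, rfl, T.adjoint_apply_eq hd ⟨ψ, hm⟩ h⟩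

/-- For a densely defined closable `T`, `Δ = T⋆ T̄` and `α > 0`, the equation `(α + Δ) ζ = α ξ` has
exactly one solution `ζ` in the domain of `Δ`. -/
theorem existsUnique_resolvent [CompleteSpace F] (T : E →ₗ.[ℂ] F) (hd : Dense (T.domain : Set E))
    (hT : T.IsClosable) {α : ℝ} (hα : 0 < α) (ξ : E) :
    ∃! ζ : E, ∃ χ : E, (ζ, χ) ∈ laplacianGraph T ∧ (α : ℂ) • ζ + χ = (α : ℂ) • ξ := by
  have hα0 : (α : ℂ) ≠ 0 := by exact_mod_cast hα.ne'
  obtain ⟨s, hs, hs2⟩ : ∃ s : ℝ, 0 < s ∧ s * s = α :=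
    ⟨√α, Real.sqrt_pos.2 hα, Real.mul_self_sqrt hα.le⟩
  have hs0 : (s : ℂ) ≠ 0 := by exact_mod_cast hs.ne'
  have hs2' : (s : ℂ) * s = α := by exact_mod_cast hs2
  let L : WithLp 2 (E × F) →L[ℂ] E × F :=
    (((s : ℂ)⁻¹ • WithLp.fstL 2 ℂ E F)).prod (WithLp.sndL 2 ℂ E F)
  let G : Submodule ℂ (WithLp 2 (E × F)) := T.closure.graph.comap L.toLinearMap
  have hGc : IsClosed (G : Set (WithLp 2 (E × F))) :=
    (hT.closure_isClosed).preimage L.continuous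
  have : CompleteSpace G := hGc.completeSpace_coe
  let v : WithLp 2 (E × F) := WithLp.toLp 2 ((s : ℂ) • ξ, 0)
  let p : WithLp 2 (E × F) := G.starProjection v
  have hp : p ∈ G := G.starProjection_apply_mem v
  have horth : ∀ w ∈ G, ⟪v - p, w⟫_ℂ = 0 := fun w hw => G.starProjection_inner_eq_zero v w hw
  let ζ : E := (s : ℂ)⁻¹ • p.fst
  let ψ : F := p.snd
  have hζ : (ζ, ψ) ∈ T.closure.graph := hp
  have key : ∀ a b, (a, b) ∈ T.closure.graph → ⟪(α : ℂ) • (ξ - ζ), a⟫_ℂ = ⟪ψ, b⟫_ℂ := by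
    intro a b hab
    have hw : (WithLp.toLp 2 ((s : ℂ) • a, b) : WithLp 2 (E × F)) ∈ G := by
      change ((s : ℂ)⁻¹ • ((s : ℂ) • a), b) ∈ T.closure.graph
      rwa [smul_smul, inv_mul_cancel₀ hs0, one_smul]
    have := horth _ hw
    rw [WithLp.prod_inner_apply] at this
    change ⟪(s : ℂ) • ξ - p.fst, (s : ℂ) • a⟫_ℂ + ⟪(0 : F) - ψ, b⟫_ℂ = 0 at this
    have hpf : p.fst = (s : ℂ) • ζ := by
      simp only [ζ]; rw [smul_smul, mul_inv_cancel₀ hs0, one_smul]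
    rw [hpf, ← smul_sub, inner_smul_left, inner_smul_right, zero_sub, inner_neg_left,
      Complex.conj_ofReal, ← mul_assoc, hs2'] at this
    rw [inner_smul_left, Complex.conj_ofReal]
    exact sub_eq_zero.1 (by rw [sub_eq_add_neg]; exact this)
  refine ⟨ζ, ⟨(α : ℂ) • (ξ - ζ), ⟨ψ, hζ, mem_adjoint_graph T hd fun x => ?_⟩, by rw [smul_sub]; abel⟩, ?_⟩
  · exact key _ _ (LinearPMap.le_graph_of_le T.le_closure (T.mem_graph x))
  · rintro ζ' ⟨χ, ⟨ψ', h1, h2⟩, h3⟩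
    have hd1 : (ζ' - ζ, ψ' - ψ) ∈ T.closure.graph := sub_mem h1 hζ
    have e1 := inner_eq_of_mem_graph T hd hT h2 hd1
    have e2 := key _ _ hd1
    have hχ : χ = (α : ℂ) • (ξ - ζ') := by rw [smul_sub, ← h3]; abel
    rw [hχ] at e1
    have e3 : ⟪(α : ℂ) • (ζ' - ζ), ζ' - ζ⟫_ℂ + ⟪ψ' - ψ, ψ' - ψ⟫_ℂ = 0 := by
      rw [inner_sub_left ψ', ← e1, ← e2, ← inner_sub_left, ← inner_add_left, ← smul_sub, ← smul_add]
      simp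
    rw [inner_smul_left, Complex.conj_ofReal, inner_self_eq_norm_sq_to_K,
      inner_self_eq_norm_sq_to_K] at e3
    change (α : ℂ) * ((‖ζ' - ζ‖ : ℝ) : ℂ) ^ 2 + ((‖ψ' - ψ‖ : ℝ) : ℂ) ^ 2 = 0 at e3
    have e4 : α * ‖ζ' - ζ‖ ^ 2 + ‖ψ' - ψ‖ ^ 2 = 0 := by exact_mod_cast e3
    have e5 : ‖ζ' - ζ‖ ^ 2 = 0 := by 
      nlinarith [sq_nonneg ‖ζ' - ζ‖, sq_nonneg ‖ψ' - ψ‖, mul_nonneg hα.le (sq_nonneg ‖ζ' - ζ‖)]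
    exact sub_eq_zero.1 (norm_eq_zero.1 (by simpa using e5))

/-- The resolvent map `η_α = α (α + Δ)⁻¹`, `Δ = T⋆ T̄`. -/
def resolventMap (T : E →ₗ.[ℂ] F) (α : ℝ) (ξ : E) : E :=
  Classical.epsilon fun ζ : E =>
    ∃ χ : E, (ζ, χ) ∈ laplacianGraph T ∧ (α : ℂ) • ζ + χ = (α : ℂ) • ξ

end Resolvent

section Deformation

variable {K : Type u} [NormedAddCommGroup K] [InnerProductSpace ℂ K] [CompleteSpace K]

/-- The data defining an `L²`-deformation for `(N, τ)`: a von Neumann algebra `M` with a faithful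
normal trace, a trace preserving inclusion `N ⊆ M`, and a densely defined real closable derivation
on `M` into `(L²(M) ⊗̄ L²(M))^{⊕ ∞}`. -/
structure L2Deformation (N : VonNeumannAlgebra K) (τ : FaithfulNormalTrace N) where
  space : Type u
  [normedAddCommGroup : NormedAddCommGroup space]
  [innerProductSpace : InnerProductSpace ℂ space]
  [completeSpace : CompleteSpace space]
  M : VonNeumannAlgebra space
  tr : FaithfulNormalTrace M
  incl : N.toStarSubalgebra →⋆ₐ[ℂ] M.toStarSubalgebra
  tr_incl : ∀ x, tr.toLinearMap (incl x) = τ.toLinearMap x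
  δ : RealClosableDerivation tr

attribute [instance] L2Deformation.normedAddCommGroup L2Deformation.innerProductSpace
  L2Deformation.completeSpace

variable {N : VonNeumannAlgebra K} {τ : FaithfulNormalTrace N}

/-- The deformation `η_α = α (α + δ⋆ δ̄)⁻¹`, on `L²(M)`. -/
def L2Deformation.eta (d : L2Deformation N τ) (α : ℝ) : L2 d.tr → L2 d.tr :=
  resolventMap d.δ.toPMap α

/-- For `x ∈ N`, the distance `‖x - η_α(x)‖₂` in `L²(M)`. -/
def L2Deformation.displacement (d : L2Deformation N τ) (α : ℝ) (x : N.toStarSubalgebra) : ℝ :=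
  ‖hat d.tr (d.incl x) - d.eta α (hat d.tr (d.incl x))‖

/-- `η_α → id` uniformly in `‖·‖₂` on the unit ball `(B)₁`, for `B ⊆ N`. -/
def L2Deformation.ConvergesUniformlyOnBall (d : L2Deformation N τ) (B : VonNeumannAlgebra K) :
    Prop :=
  ∀ ε : ℝ, 0 < ε → ∃ α₀ : ℝ, 0 < α₀ ∧ ∀ α : ℝ, α₀ < α →
    ∀ x : N.toStarSubalgebra, (x : K →L[ℂ] K) ∈ B → ‖x‖ ≤ 1 → d.displacement α x < ε

/-- `η_α → id` uniformly in `‖·‖₂` on the unit ball `(B)₁`, for `B ⊆ N^ω`, where `η_α` is extended to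
the ultrapower by `η_α((aₙ)ₙ) = (η_α(aₙ))ₙ`, so that
`‖a - η_α(a)‖₂ = lim_{n → ω} ‖aₙ - η_α(aₙ)‖₂`. -/
def L2Deformation.ConvergesUniformlyOnUltraBall (d : L2Deformation N τ) (ω : Ultrafilter ℕ)
    (B : VonNeumannAlgebra (UltraL2 τ ω)) : Prop :=
  ∀ ε : ℝ, 0 < ε → ∃ α₀ : ℝ, 0 < α₀ ∧ ∀ α : ℝ, α₀ < α →
    ∀ a : BoundedSeq N.toStarSubalgebra, toUltra τ ω a ∈ B → ‖toUltra τ ω a‖ ≤ 1 →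
      limUnder (ω : Filter ℕ) (fun n => d.displacement α (a n)) < ε

/-- The inclusion `B ⊆ N` is `L²`-rigid: every `L²`-deformation for `N` converges uniformly on the
unit ball of `B`. -/
def IsL2Rigid (N : VonNeumannAlgebra K) (τ : FaithfulNormalTrace N) (B : VonNeumannAlgebra K) :
    Prop :=
  ∀ d : L2Deformation N τ, d.ConvergesUniformlyOnBall B

end Deformation

end L2Rigidity

end

open L2Rigidity

noncomputable section

namespace L2Rigidity

section DividedDifference

open Polynomial

/-- The divided difference `(p(a) - p(b)) / (a - b)` of a real polynomial, at commuting elements of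
an algebra. -/
def divDiff {A : Type*} [Ring A] [Algebra ℝ A] (p : ℝ[X]) (a b : A) : A :=
  p.sum fun k c => c • ∑ i ∈ Finset.range k, a ^ i * b ^ (k - 1 - i)

lemma map_divDiff {A B : Type*} [Ring A] [Algebra ℝ A] [Ring B] [Algebra ℝ B] (f : A →ₐ[ℝ] B)
    (p : ℝ[X]) (a b : A) : f (divDiff p a b) = divDiff p (f a) (f b) := by
  simp [divDiff, Polynomial.sum, map_sum, map_smul, map_mul, map_pow]

lemma divDiff_mul_sub (p : ℝ[X]) (s t : ℝ) :
    divDiff p s t * (s - t) = p.eval s - p.eval t := by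
  rw [divDiff, Polynomial.eval_eq_sum, Polynomial.eval_eq_sum, Polynomial.sum, Polynomial.sum,
    Polynomial.sum, ← Finset.sum_sub_distrib, Finset.sum_mul]
  refine Finset.sum_congr rfl fun k _ => ?_
  rw [smul_eq_mul, mul_assoc, geom_sum₂_mul, mul_sub]

lemma divDiff_self (p : ℝ[X]) (s : ℝ) : divDiff p s s = p.derivative.eval s := by
  rw [divDiff, Polynomial.derivative_eval, Polynomial.sum, Polynomial.sum]
  refine Finset.sum_congr rfl fun k _ => ?_
  rw [smul_eq_mul, mul_assoc]
  congr 1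
  rw [Finset.sum_congr rfl (g := fun _ => s ^ (k - 1)), Finset.sum_const, Finset.card_range,
    nsmul_eq_mul]
  intro i hi
  rw [← pow_add]
  congr 1
  have := Finset.mem_range.1 hi
  omega

lemma abs_divDiff_le {p : ℝ[X]} {R C : ℝ} (h : ∀ t ∈ Set.Icc (-R) R, |p.derivative.eval t| ≤ C)
    {s t : ℝ} (hs : s ∈ Set.Icc (-R) R) (ht : t ∈ Set.Icc (-R) R) : |divDiff p s t| ≤ C := by
  rcases eq_or_ne s t with rfl | hst
  · rw [divDiff_self]
    exact h s hs
  · have h1 := (convex_Icc (-R) R).norm_image_sub_le_of_norm_hasDerivWithin_le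
      (f := fun x => p.eval x) (f' := fun x => p.derivative.eval x) (C := C)
      (fun x _ => (p.hasDerivAt x).hasDerivWithinAt) h ht hs
    have h2 : 0 < |s - t| := abs_pos.2 (sub_ne_zero.2 hst)
    rw [← divDiff_mul_sub, Real.norm_eq_abs, abs_mul, Real.norm_eq_abs] at h1
    exact le_of_mul_le_mul_right h1 h2

/-- A divided difference of commuting self-adjoint elements is bounded by the Lipschitz constant of
the polynomial. -/
lemma norm_divDiff_le {A : Type*} [CStarAlgebra A] {a b : A} (ha : IsSelfAdjoint a)
    (hb : IsSelfAdjoint b) (hab : Commute a b) {p : ℝ[X]} {R C : ℝ} (hC : 0 ≤ C)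
    (haR : ‖a‖ + ‖b‖ ≤ R)
    (h : ∀ t ∈ Set.Icc (-R) R, |p.derivative.eval t| ≤ C) : ‖divDiff p a b‖ ≤ C := by
  set z : A := a + Complex.I • b with hz
  have hzs : star z = a - Complex.I • b := by
    rw [hz, star_add, star_smul, ha.star_eq, hb.star_eq]
    simp [sub_eq_add_neg]
  have hzn : IsStarNormal z := by
    refine ⟨?_⟩
    rw [hzs, hz]
    have h1 : Commute a (Complex.I • b) := hab.smul_right _
    exact ((Commute.refl a).add_right h1).sub_left
      ((h1.symm).add_right (Commute.refl _))
  let id' : C(spectrum ℂ z, ℂ) := (ContinuousMap.id ℂ).restrict (spectrum ℂ z)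
  let Φ : C(spectrum ℂ z, ℂ) →⋆ₐ[ℂ] A := cfcHom hzn
  have hid : Φ id' = z := cfcHom_id hzn
  let fr : C(spectrum ℂ z, ℂ) := (2⁻¹ : ℂ) • (id' + star id')
  let fi : C(spectrum ℂ z, ℂ) := (-(Complex.I) * 2⁻¹ : ℂ) • (id' - star id')
  have hfr : Φ fr = a := by
    simp only [fr, map_smul, map_add, map_star, hid]
    rw [hzs, hz, add_add_sub_cancel, ← two_smul ℂ a, smul_smul]
    norm_num
  have hfi : Φ fi = b := by
    simp only [fi, map_smul, map_sub, map_star, hid]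
    rw [hzs, hz, add_sub_sub_cancel, ← two_smul ℂ, smul_smul, smul_smul,
      show -Complex.I * 2⁻¹ * 2 * Complex.I = 1 by
        rw [show -Complex.I * 2⁻¹ * 2 * Complex.I = -(Complex.I * Complex.I) by ring]
        simp, one_smul]
  have hS : divDiff p a b = Φ (divDiff p fr fi) := by
    rw [← hfr, ← hfi]
    exact (map_divDiff (Φ.toAlgHom.restrictScalars ℝ) p fr fi).symm
  have hnorm : ‖Φ (divDiff p fr fi)‖ = ‖divDiff p fr fi‖ :=
    (isometry_cfcHom (R := ℂ) z hzn).norm_map_of_map_zero (map_zero _) _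
  rw [hS, hnorm, ContinuousMap.norm_le _ hC]
  intro x
  have e1 : (divDiff p fr fi) x = divDiff p (fr x) (fi x) :=
    map_divDiff ((ContinuousMap.evalAlgHom ℂ ℂ x).restrictScalars ℝ) p fr fi
  have e2 : fr x = ((x : ℂ).re : ℂ) := by
    simp only [fr, id', ContinuousMap.smul_apply, ContinuousMap.add_apply, ContinuousMap.star_apply,
      ContinuousMap.restrict_apply, ContinuousMap.id_apply, smul_eq_mul]
    rw [Complex.re_eq_add_conj]
    simp only [RCLike.star_def]
    ring
  have e3 : fi x = ((x : ℂ).im : ℂ) := by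
    simp only [fi, id', ContinuousMap.smul_apply, ContinuousMap.sub_apply, ContinuousMap.star_apply,
      ContinuousMap.restrict_apply, ContinuousMap.id_apply, smul_eq_mul]
    rw [Complex.im_eq_sub_conj]
    simp only [RCLike.star_def]
    field_simp
    rw [Complex.I_sq]
    ring
  have e4 : divDiff p ((x : ℂ).re : ℂ) ((x : ℂ).im : ℂ) =
      ((divDiff p (x : ℂ).re (x : ℂ).im : ℝ) : ℂ) :=
    (map_divDiff Complex.ofRealAm p _ _).symm
  have hx : ‖(x : ℂ)‖ ≤ R := by
    have : Nontrivial A := by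
      by_contra hn
      rw [not_nontrivial_iff_subsingleton] at hn
      exact (Set.ext_iff.1 (spectrum.of_subsingleton (R := ℂ) z) x).1 x.2
    refine (spectrum.norm_le_norm_of_mem x.2).trans ?_
    refine (norm_add_le _ _).trans ?_
    rw [norm_smul, Complex.norm_I, one_mul]
    exact haR
  rw [e1, e2, e3, e4, Complex.norm_real, Real.norm_eq_abs]
  exact abs_divDiff_le h (abs_le.1 ((Complex.abs_re_le_norm _).trans hx))
    (abs_le.1 ((Complex.abs_im_le_norm _).trans hx))

lemma exists_derivative_eq (q : ℝ[X]) : ∃ p : ℝ[X], p.derivative = q ∧ p.eval 0 = 0 := by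
  induction q using Polynomial.induction_on' with
  | add p q hp hq =>
    obtain ⟨p', h1, h2⟩ := hp
    obtain ⟨q', h3, h4⟩ := hq
    exact ⟨p' + q', by simp [h1, h3], by simp [h2, h4]⟩
  | monomial n a =>
    refine ⟨monomial (n + 1) (a / (n + 1)), ?_, by simp⟩
    rw [derivative_monomial]
    have : (n : ℝ) + 1 ≠ 0 := by positivity
    simp
    field_simp

/-- Polynomials with derivative at most one approximating the truncation of the identity of
`[-R, R]` to the interval `[c, d]`. -/
lemma exists_polynomial_truncation {c d R κ : ℝ} (hc : c ≤ 0) (hd : 0 ≤ d) (hR : 0 ≤ R)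
    (hκ : 0 < κ) :
    ∃ p : ℝ[X], p.eval 0 = 0 ∧ (∀ t ∈ Set.Icc (-R) R, |p.derivative.eval t| ≤ 1) ∧
      (∀ t ∈ Set.Icc (-R) R, t ∈ Set.Icc c d → |p.eval t - t| ≤ κ) ∧
      (∀ t ∈ Set.Icc (-R) R, p.eval t ∈ Set.Icc (c - κ) (d + κ)) := by
  have hκ2 : 0 < κ / 2 := by positivity
  let g : ℝ → ℝ := fun t => max 0 (1 - (max 0 (t - d) + max 0 (c - t)) / (κ / 2))
  have hg : Continuous g := by fun_prop
  have hg0 : ∀ t, 0 ≤ g t := fun t => le_max_left _ _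
  have hg1 : ∀ t, g t ≤ 1 := fun t => max_le zero_le_one (by
    have : 0 ≤ (max 0 (t - d) + max 0 (c - t)) / (κ / 2) := by positivity
    linarith)
  have hgid : ∀ t ∈ Set.Icc c d, g t = 1 := by
    intro t ht
    simp only [g]
    have h1 : max 0 (t - d) = 0 := max_eq_left (by linarith [ht.2])
    have h2 : max 0 (c - t) = 0 := max_eq_left (by linarith [ht.1])
    rw [h1, h2]
    norm_num
  have hgz : ∀ t, d + κ / 2 ≤ t ∨ t ≤ c - κ / 2 → g t = 0 := by
    intro t ht
    refine max_eq_left ?_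
    rw [sub_nonpos, one_le_div hκ2]
    rcases ht with h | h
    · linarith [le_max_right 0 (t - d), le_max_left 0 (c - t)]
    · linarith [le_max_left 0 (t - d), le_max_right 0 (c - t)]
  let f : ℝ → ℝ := fun t => ∫ x in (0 : ℝ)..t, g x
  have hf : ∀ t, HasDerivAt f (g t) t := fun t => hg.integral_hasStrictDerivAt 0 t |>.hasDerivAt
  have hf0 : f 0 = 0 := intervalIntegral.integral_same
  have hmono : Monotone f := monotone_of_hasDerivAt_nonneg hf hg0
  have hlip : ∀ s t, |f t - f s| ≤ 1 * |t - s| := fun s t =>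
    convex_univ.norm_image_sub_le_of_norm_hasDerivWithin_le (f := f) (f' := g)
      (fun x _ => (hf x).hasDerivWithinAt)
      (fun x _ => by rw [Real.norm_eq_abs, abs_of_nonneg (hg0 x)]; exact hg1 x)
      (Set.mem_univ s) (Set.mem_univ t)
  have hfid : ∀ t ∈ Set.Icc c d, f t = t := by
    intro t ht
    have := (convex_Icc c d).norm_image_sub_le_of_norm_hasDerivWithin_le (f := fun x => f x - x)
      (f' := fun x => g x - 1) (C := 0) (fun x _ => ((hf x).sub (hasDerivAt_id x)).hasDerivWithinAt)
      (fun x hx => by rw [hgid x hx]; simp) (x := 0) ⟨hc, hd⟩ ht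
    rw [zero_mul, norm_le_zero_iff, hf0] at this
    linarith
  have hup : ∀ t, f t ≤ d + κ / 2 := by
    intro t
    have h1 : f (d + κ / 2) ≤ d + κ / 2 := by
      have := hlip d (d + κ / 2)
      rw [hfid d ⟨hc.trans hd, le_rfl⟩, add_sub_cancel_left, abs_of_pos hκ2] at this
      linarith [(abs_le.1 this).2]
    rcases le_total t (d + κ / 2) with h | h
    · exact (hmono h).trans h1
    · have := (convex_Ici (d + κ / 2)).norm_image_sub_le_of_norm_hasDerivWithin_le (f := f)
        (f' := g) (C := 0) (fun x _ => (hf x).hasDerivWithinAt)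
        (fun x hx => by rw [hgz x (Or.inl hx)]; simp) (x := d + κ / 2) Set.self_mem_Ici h
      rw [zero_mul, norm_le_zero_iff] at this
      linarith
  have hlow : ∀ t, c - κ / 2 ≤ f t := by
    intro t
    have h1 : c - κ / 2 ≤ f (c - κ / 2) := by
      have := hlip c (c - κ / 2)
      rw [hfid c ⟨le_rfl, hc.trans hd⟩, show c - κ / 2 - c = -(κ / 2) by ring, abs_neg,
        abs_of_pos hκ2] at this
      linarith [(abs_le.1 this).1]
    rcases le_total (c - κ / 2) t with h | h
    · exact h1.trans (hmono h)
    · have := (convex_Iic (c - κ / 2)).norm_image_sub_le_of_norm_hasDerivWithin_le (f := f)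
        (f' := g) (C := 0) (fun x _ => (hf x).hasDerivWithinAt)
        (fun x hx => by rw [hgz x (Or.inr hx)]; simp) (x := c - κ / 2) Set.self_mem_Iic h
      rw [zero_mul, norm_le_zero_iff] at this
      linarith
  obtain ⟨e, he, heR⟩ : ∃ e : ℝ, 0 < e ∧ 2 * e * R ≤ κ / 2 := by
    refine ⟨κ / (4 * (1 + R)), by positivity, ?_⟩
    rw [show 2 * (κ / (4 * (1 + R))) * R = κ / 2 * (R / (1 + R)) by field_simp; ring]
    exact mul_le_of_le_one_right hκ2.le ((div_le_one (by positivity)).2 (by linarith))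
  obtain ⟨q₀, hq₀⟩ := exists_polynomial_near_of_continuousOn (-R) R g hg.continuousOn e he
  obtain ⟨p, hp, hp0⟩ := exists_derivative_eq (C (1 + e)⁻¹ * q₀)
  have hpe : ∀ t, p.derivative.eval t = (1 + e)⁻¹ * q₀.eval t := fun t => by
    rw [hp, eval_mul, eval_C]
  have hinv : 0 < (1 + e)⁻¹ := by positivity
  have hbd : ∀ t ∈ Set.Icc (-R) R, |p.derivative.eval t| ≤ 1 := by
    intro t ht
    have h1 := abs_lt.1 (hq₀ t ht)
    rw [hpe, abs_mul, abs_of_pos hinv, inv_mul_le_iff₀ (by positivity), mul_one, abs_le]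
    constructor <;> linarith [hg0 t, hg1 t]
  have hclose : ∀ t ∈ Set.Icc (-R) R, |p.derivative.eval t - g t| ≤ 2 * e := by
    intro t ht
    have h1 := abs_lt.1 (hq₀ t ht)
    rw [hpe, show (1 + e)⁻¹ * q₀.eval t - g t = (1 + e)⁻¹ * (q₀.eval t - g t - e * g t) by
      field_simp; ring, abs_mul, abs_of_pos hinv, inv_mul_le_iff₀ (by positivity), abs_le]
    constructor <;> nlinarith [hg0 t, hg1 t]
  have hpf : ∀ t ∈ Set.Icc (-R) R, |p.eval t - f t| ≤ κ / 2 := by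
    intro t ht
    have := (convex_Icc (-R) R).norm_image_sub_le_of_norm_hasDerivWithin_le
      (f := fun x => p.eval x - f x) (f' := fun x => p.derivative.eval x - g x) (C := 2 * e)
      (fun x _ => ((p.hasDerivAt x).sub (hf x)).hasDerivWithinAt) hclose
      (x := 0) ⟨by linarith, hR⟩ ht
    rw [hf0, hp0, sub_zero, sub_zero, sub_zero, Real.norm_eq_abs] at this
    refine this.trans (le_trans ?_ heR)
    gcongr
    exact abs_le.2 ht
  refine ⟨p, hp0, hbd, fun t ht htcd => ?_, fun t ht => ?_⟩
  · have := hpf t ht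
    rw [hfid t htcd] at this
    linarith
  · have := abs_le.1 (hpf t ht)
    exact ⟨by linarith [hlow t], by linarith [hup t]⟩

end DividedDifference

section Truncation

open Polynomial

/-- A Hilbert space with commuting left and right `*`-representations of a C⋆-algebra. -/
structure StarBimodule (A H : Type*) [CStarAlgebra A] [NormedAddCommGroup H]
    [InnerProductSpace ℂ H] [CompleteSpace H] where
  left : A →⋆ₐ[ℂ] (H →L[ℂ] H)
  right : A →ₗ[ℂ] (H →L[ℂ] H)
  right_one : right 1 = 1
  right_mul : ∀ a b, right (a * b) = right b * right a
  right_star : ∀ a, right (star a) = star (right a)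
  comm : ∀ a b, Commute (left a) (right b)

/-- The graph of a derivation, closed under the adjoint, from a subalgebra of a C⋆-algebra `A` into
a bimodule `F`, together with a bimodule `E` generated by the image of `A` under `hat`, as for
`E = L²(A)`. -/
structure DerivationGraph (A E F : Type*) [CStarAlgebra A] [NormedAddCommGroup E]
    [InnerProductSpace ℂ E] [CompleteSpace E] [NormedAddCommGroup F]
    [InnerProductSpace ℂ F] [CompleteSpace F] where
  std : StarBimodule A E
  hat : A →ₗ[ℂ] E
  left_hat : ∀ a b, std.left a (hat b) = hat (a * b)
  right_hat : ∀ a b, std.right a (hat b) = hat (b * a)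
  norm_hat_star : ∀ a, ‖hat (star a)‖ = ‖hat a‖
  bim : StarBimodule A F
  graph : Submodule ℂ (A × F)
  leibniz : ∀ {a b ξ η}, (a, ξ) ∈ graph → (b, η) ∈ graph →
    (a * b, bim.left a η + bim.right b ξ) ∈ graph
  star_mem : ∀ {a ξ}, (a, ξ) ∈ graph → ∃ ξ', (star a, ξ') ∈ graph ∧ ‖ξ'‖ ≤ ‖ξ‖

variable {A E F : Type*} [CStarAlgebra A] [NormedAddCommGroup E]
    [InnerProductSpace ℂ E] [CompleteSpace E] [NormedAddCommGroup F]
    [InnerProductSpace ℂ F] [CompleteSpace F]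

lemma StarBimodule.right_pow (B : StarBimodule A F) (a : A) (n : ℕ) :
    B.right (a ^ n) = B.right a ^ n := by
  induction n with
  | zero => simp [B.right_one]
  | succ n ih => rw [pow_succ', B.right_mul, ih, ← pow_succ]

lemma divDiff_apply {H : Type*} [NormedAddCommGroup H] [InnerProductSpace ℂ H] [CompleteSpace H]
    (p : ℝ[X]) (S T : H →L[ℂ] H) (ξ : H) :
    divDiff p S T ξ = p.sum fun k c =>
      (c : ℂ) • ∑ i ∈ Finset.range k, (S ^ i * T ^ (k - 1 - i)) ξ := by
  rw [divDiff, Polynomial.sum, Polynomial.sum, sum_apply]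
  refine Finset.sum_congr rfl fun k _ => ?_
  rw [← Complex.coe_smul, smul_apply, sum_apply]

lemma aeval_eq_sum_smul_pow {p : ℝ[X]} (a : A) :
    aeval a p = p.sum fun k c => (c : ℂ) • a ^ k := by
  rw [aeval_def, eval₂_eq_sum]
  simp only [← Algebra.smul_def, Complex.coe_smul]

namespace DerivationGraph

variable (S : DerivationGraph A E F)

lemma pow_mem {a : A} {ξ : F} (h : (a, ξ) ∈ S.graph) (k : ℕ) :
    (a ^ (k + 1), ∑ i ∈ Finset.range (k + 1),
      (S.bim.left a ^ i * S.bim.right a ^ (k + 1 - 1 - i)) ξ) ∈ S.graph := by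
  induction k with
  | zero => simpa using h
  | succ k ih =>
    have := S.leibniz h ih
    rw [← pow_succ'] at this
    convert this using 2
    rw [Finset.sum_range_succ', map_sum]
    congr 1
    · refine Finset.sum_congr rfl fun i _ => ?_
      rw [pow_succ', mul_assoc, mul_apply_eq_comp]
      congr 4
      omega
    · simp [S.bim.right_pow]

lemma aeval_mem {a : A} {ξ : F} (h : (a, ξ) ∈ S.graph) {p : ℝ[X]} (hp : p.eval 0 = 0) :
    (aeval a p, divDiff p (S.bim.left a) (S.bim.right a) ξ) ∈ S.graph := by
  rw [divDiff_apply, aeval_eq_sum_smul_pow, Polynomial.sum, Polynomial.sum, prod_mk_sum]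
  refine Submodule.sum_mem _ fun k hk => ?_
  obtain _ | k := k
  · rw [← coeff_zero_eq_eval_zero] at hp
    exact absurd hp (mem_support_iff.1 hk)
  · rw [← Prod.smul_mk]
    exact S.graph.smul_mem _ (S.pow_mem h k)

lemma hat_pow_sub (a b : A) (k : ℕ) : S.hat (a ^ k - b ^ k) = ∑ i ∈ Finset.range k,
      (S.std.left a ^ i * S.std.right b ^ (k - 1 - i)) (S.hat (a - b)) := by
  induction k with
  | zero => simp
  | succ k ih =>
    have : a ^ (k + 1) - b ^ (k + 1) = a * (a ^ k - b ^ k) + (a - b) * b ^ k := by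
      rw [pow_succ', pow_succ']; noncomm_ring
    rw [this, map_add, ← S.left_hat, ← S.right_hat, ih, Finset.sum_range_succ', map_sum]
    congr 1
    · refine Finset.sum_congr rfl fun i _ => ?_
      rw [pow_succ', mul_assoc, show k + 1 - 1 - (i + 1) = k - 1 - i by omega]
      rfl
    · simp [S.std.right_pow]

lemma hat_aeval_sub (a b : A) (p : ℝ[X]) : S.hat (aeval a p - aeval b p) =
    divDiff p (S.std.left a) (S.std.right b) (S.hat (a - b)) := by
  rw [divDiff_apply, aeval_eq_sum_smul_pow, aeval_eq_sum_smul_pow, Polynomial.sum, Polynomial.sum,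
    Polynomial.sum, ← Finset.sum_sub_distrib, map_sum]
  refine Finset.sum_congr rfl fun k _ => ?_
  rw [← smul_sub, map_smul, hat_pow_sub]

lemma norm_hat_le (a : A) : ‖S.hat a‖ ≤ ‖a‖ * ‖S.hat 1‖ := by
  have := (S.std.left a).le_opNorm (S.hat 1)
  rw [S.left_hat, mul_one] at this
  exact this.trans (mul_le_mul_of_nonneg_right (NonUnitalStarAlgHom.norm_apply_le _ _)
    (norm_nonneg _))

lemma right_isSelfAdjoint (B : StarBimodule A F) {a : A} (ha : IsSelfAdjoint a) :
    IsSelfAdjoint (B.right a) := by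
  rw [isSelfAdjoint_iff, ← B.right_star, ha.star_eq]

lemma left_isSelfAdjoint (B : StarBimodule A F) {a : A} (ha : IsSelfAdjoint a) :
    IsSelfAdjoint (B.left a) := by
  rw [isSelfAdjoint_iff, ← map_star, ha.star_eq]

/-- Truncation to an interval containing the spectrum of `x`: it brings `y` closer to `x` and does
not increase the norm of the derivation. -/
lemma exists_truncation {x : A} (hx : IsSelfAdjoint x) {c d : ℝ} (hc : c ≤ 0) (hd : 0 ≤ d)
    (hspec : spectrum ℝ x ⊆ Set.Icc c d) {y : A} {ξ : F} (hy : (y, ξ) ∈ S.graph) {κ : ℝ}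
    (hκ : 0 < κ) :
    ∃ y' ξ', (y', ξ') ∈ S.graph ∧ IsSelfAdjoint y' ∧
      spectrum ℝ y' ⊆ Set.Icc (c - κ) (d + κ) ∧
      ‖S.hat (x - y')‖ ≤ ‖S.hat (x - y)‖ + κ ∧ ‖ξ'‖ ≤ ‖ξ‖ := by
  obtain ⟨ξs, hξs, hξsn⟩ := S.star_mem hy
  obtain ⟨b, hb⟩ : ∃ b : A, b = (2⁻¹ : ℂ) • (y + star y) := ⟨_, rfl⟩
  obtain ⟨ζ, hζ⟩ : ∃ ζ : F, ζ = (2⁻¹ : ℂ) • (ξ + ξs) := ⟨_, rfl⟩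
  have hbmem : (b, ζ) ∈ S.graph := by
    rw [hb, hζ]
    exact S.graph.smul_mem _ (S.graph.add_mem hy hξs)
  have hbsa : IsSelfAdjoint b := by
    rw [hb, isSelfAdjoint_iff, star_smul, star_add, star_star, add_comm]
    simp
  have h2 : ‖(2⁻¹ : ℂ)‖ = 2⁻¹ := by simp
  have hζn : ‖ζ‖ ≤ ‖ξ‖ := by
    rw [hζ, norm_smul, h2]
    linarith [norm_add_le ξ ξs]
  have hxb : ‖S.hat (x - b)‖ ≤ ‖S.hat (x - y)‖ := by
    have e : x - b = (2⁻¹ : ℂ) • ((x - y) + star (x - y)) := by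
      rw [hb, star_sub, hx.star_eq]
      module
    rw [e, map_smul, map_add, norm_smul, h2]
    have := norm_add_le (S.hat (x - y)) (S.hat (star (x - y)))
    rw [S.norm_hat_star] at this
    linarith
  obtain ⟨κ', hκ', hκκ, hκh⟩ : ∃ κ' : ℝ, 0 < κ' ∧ κ' ≤ κ ∧ κ' * ‖S.hat 1‖ ≤ κ := by
    have h1 : 0 < 1 + ‖S.hat 1‖ := by positivity
    refine ⟨κ / (1 + ‖S.hat 1‖), by positivity, ?_, ?_⟩
    · exact div_le_self hκ.le (by linarith [norm_nonneg (S.hat 1)])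
    · rw [div_mul_eq_mul_div, div_le_iff₀ h1]
      nlinarith
  obtain ⟨R, hR, h1, h2, h3, h4⟩ : ∃ R : ℝ, 0 ≤ R ∧ ‖S.std.left x‖ + ‖S.std.right b‖ ≤ R ∧
      ‖S.bim.left b‖ + ‖S.bim.right b‖ ≤ R ∧ ‖x‖ ≤ R ∧ ‖b‖ ≤ R := by
    refine ⟨(‖S.std.left x‖ + ‖S.std.right b‖) + (‖S.bim.left b‖ + ‖S.bim.right b‖) + ‖x‖ + ‖b‖,
      by positivity, ?_, ?_, ?_, ?_⟩ <;>
    linarith [norm_nonneg (S.std.left x), norm_nonneg (S.std.right b), norm_nonneg (S.bim.left b),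
      norm_nonneg (S.bim.right b), norm_nonneg x, norm_nonneg b]
  have hspecR : ∀ z : A, ‖z‖ ≤ R → ∀ t ∈ spectrum ℝ z, t ∈ Set.Icc (-R) R := by
    intro z hz t ht
    have : Nontrivial A := by
      by_contra hn
      rw [not_nontrivial_iff_subsingleton] at hn
      exact (Set.ext_iff.1 (spectrum.of_subsingleton (R := ℝ) z) t).1 ht
    exact abs_le.1 ((spectrum.norm_le_norm_of_mem ht).trans hz)
  obtain ⟨p, hp0, hp1, hp2, hp3⟩ := exists_polynomial_truncation hc hd hR hκ'
  refine ⟨aeval b p, _, S.aeval_mem hbmem hp0, ?_, ?_, ?_, ?_⟩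
  · rw [← cfc_polynomial p b hbsa]
    exact cfc_predicate _ _
  · rw [← cfc_polynomial p b hbsa, cfc_map_spectrum (R := ℝ) (fun t => p.eval t) b hbsa
      p.continuous.continuousOn]
    rintro _ ⟨t, ht, rfl⟩
    have := hp3 t (hspecR b h4 t ht)
    exact ⟨by linarith [this.1], by linarith [this.2]⟩
  · have e1 : ‖S.hat (aeval x p - aeval b p)‖ ≤ ‖S.hat (x - y)‖ := by
      rw [hat_aeval_sub]
      refine (ContinuousLinearMap.le_opNorm _ _).trans ?_
      have := norm_divDiff_le (left_isSelfAdjoint S.std hx) (right_isSelfAdjoint S.std hbsa)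
        (S.std.comm x b) zero_le_one h1 hp1
      calc _ ≤ 1 * ‖S.hat (x - b)‖ := by gcongr
        _ ≤ _ := by rw [one_mul]; exact hxb
    have e2 : ‖x - aeval x p‖ ≤ κ' := by
      rw [← cfc_polynomial p x hx]
      nth_rewrite 1 [← cfc_id ℝ x hx]
      rw [← cfc_sub id _ x continuousOn_id p.continuous.continuousOn]
      refine norm_cfc_le hκ'.le fun t ht => ?_
      rw [Real.norm_eq_abs, abs_sub_comm]
      exact hp2 t (hspecR x h3 t ht) (hspec ht)
    have e3 : S.hat (x - aeval b p) = S.hat (x - aeval x p) + S.hat (aeval x p - aeval b p) := by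
      rw [← map_add]; congr 1; abel
    rw [e3]
    refine (norm_add_le _ _).trans ?_
    have := (S.norm_hat_le (x - aeval x p)).trans
      (mul_le_mul_of_nonneg_right e2 (norm_nonneg _))
    linarith
  · refine (ContinuousLinearMap.le_opNorm _ _).trans ?_
    have := norm_divDiff_le (left_isSelfAdjoint S.bim hbsa) (right_isSelfAdjoint S.bim hbsa)
        (S.bim.comm b b) zero_le_one h2 hp1
    calc _ ≤ 1 * ‖ζ‖ := by gcongr
      _ ≤ _ := by rw [one_mul]; exact hζn

end DerivationGraph

end Truncation

section Ampliation

lemma hasSum_norm_sq {E : Type*} [NormedAddCommGroup E] (ξ : lp (fun _ : ℕ => E) 2) : HasSum (fun n => ‖ξ n‖ ^ 2) (‖ξ‖ ^ 2) := by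
  have := lp.hasSum_norm (p := 2) (by norm_num) ξ
  simpa using this

lemma lp_dense_induction {E : Type*} [NormedAddCommGroup E]
    {P : lp (fun _ : ℕ => E) 2 → Prop} (hcl : IsClosed {ξ | P ξ})
    (h0 : P 0) (hadd : ∀ ξ ζ, P ξ → P ζ → P (ξ + ζ)) (hs : ∀ n x, P (lp.single 2 n x))
    (ξ : lp (fun _ : ℕ => E) 2) : P ξ := by
  refine hcl.mem_of_tendsto (lp.hasSum_single (by norm_num) ξ) (Eventually.of_forall fun s => ?_)
  refine Finset.sum_induction _ P hadd h0 fun n _ => hs n _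

variable {E : Type*} [NormedAddCommGroup E] [InnerProductSpace ℂ E]

lemma norm_ampliate_le (T : E →L[ℂ] E) (ξ : lp (fun _ : ℕ => E) 2) :
    ‖ampliate T ξ‖ ≤ ‖T‖ * ‖ξ‖ := by
  refine le_of_sq_le_sq ?_ (by positivity)
  rw [mul_pow]
  refine hasSum_le (fun n => ?_) (hasSum_norm_sq _) ((hasSum_norm_sq ξ).mul_left _)
  rw [← mul_pow]
  gcongr
  exact T.le_opNorm _

/-- The ampliation of bounded operators, as a `*`-homomorphism. -/
def ampliation (E : Type*) [NormedAddCommGroup E] [InnerProductSpace ℂ E] [CompleteSpace E] :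
    (E →L[ℂ] E) →⋆ₐ[ℂ] (lp (fun _ : ℕ => E) 2 →L[ℂ] lp (fun _ : ℕ => E) 2) where
  toFun T := (ampliate T).mkContinuous ‖T‖ (norm_ampliate_le T)
  map_one' := by ext ξ n; rfl
  map_mul' S T := by ext ξ n; rfl
  map_zero' := by ext ξ n; rfl
  map_add' S T := by ext ξ n; rfl
  commutes' c := by ext ξ n; rfl
  map_star' T := by
    rw [ContinuousLinearMap.star_eq_adjoint, ContinuousLinearMap.star_eq_adjoint,
      ContinuousLinearMap.eq_adjoint_iff]
    intro ξ ζ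
    rw [lp.inner_eq_tsum, lp.inner_eq_tsum]
    refine tsum_congr fun n => ?_
    exact ContinuousLinearMap.adjoint_inner_left T (ζ n) (ξ n)

@[simp] lemma ampliation_apply [CompleteSpace E] (T : E →L[ℂ] E) (ξ : lp (fun _ : ℕ => E) 2)
    (n : ℕ) : ampliation E T ξ n = T (ξ n) := rfl

lemma ampliation_single [CompleteSpace E] (T : E →L[ℂ] E) (n : ℕ) (x : E) :
    ampliation E T (lp.single 2 n x) = lp.single 2 n (T x) := by
  ext k
  rw [ampliation_apply, lp.single_apply, lp.single_apply]
  rcases eq_or_ne n k with rfl | h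
  · simp
  · simp [h.symm]

end Ampliation

section Tensor

variable {E F : Type*} [NormedAddCommGroup E] [InnerProductSpace ℂ E]
  [NormedAddCommGroup F] [InnerProductSpace ℂ F]

/-- Elementary tensors in the Hilbert space tensor product. -/
def htmul (x : E) (y : F) : HilbertTensor E F :=
  ((x ⊗ₜ[ℂ] y : E ⊗[ℂ] F) : UniformSpace.Completion (E ⊗[ℂ] F))

lemma inner_htmul (x x' : E) (y y' : F) :
    ⟪htmul x y, htmul x' y'⟫_ℂ = ⟪x, x'⟫_ℂ * ⟪y, y'⟫_ℂ :=
  (UniformSpace.Completion.inner_coe _ _).trans (TensorProduct.inner_tmul _ _ _ _ _)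

lemma htmul_dense_induction {P : HilbertTensor E F → Prop} (hcl : IsClosed {ξ | P ξ})
    (h0 : P 0) (hadd : ∀ ξ ζ, P ξ → P ζ → P (ξ + ζ)) (hs : ∀ x y, P (htmul x y))
    (ξ : HilbertTensor E F) : P ξ := by
  refine UniformSpace.Completion.induction_on (p := P) ξ hcl fun t => ?_
  induction t using TensorProduct.induction_on with
  | zero => exact h0
  | tmul x y => exact hs x y
  | add s t hs ht =>
    have : ((s + t : E ⊗[ℂ] F) : UniformSpace.Completion (E ⊗[ℂ] F)) =
      (s : UniformSpace.Completion (E ⊗[ℂ] F)) + t := UniformSpace.Completion.coe_add s t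
    rw [this]
    exact hadd _ _ hs ht

lemma htmul_clm_ext {G : Type*} [NormedAddCommGroup G] [NormedSpace ℂ G]
    {f g : HilbertTensor E F →L[ℂ] G} (h : ∀ x y, f (htmul x y) = g (htmul x y)) : f = g := by
  ext ξ
  refine htmul_dense_induction (P := fun ξ => f ξ = g ξ) (isClosed_eq f.continuous g.continuous)
    (by simp) (fun ξ ζ h1 h2 => ?_) h ξ
  rw [map_add, map_add, h1, h2]

lemma tensorLeft_htmul (T : E →L[ℂ] E) (x : E) (y : F) :
    tensorLeft T (htmul x y) = htmul (T x) y :=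
  ContinuousLinearMap.completion_apply_coe _ _

lemma tensorRight_htmul (T : F →L[ℂ] F) (x : E) (y : F) :
    tensorRight T (htmul x y) = htmul x (T y) :=
  ContinuousLinearMap.completion_apply_coe _ _

lemma htmul_add_left (x x' : E) (y : F) : htmul (x + x') y = htmul x y + htmul x' y := by
  rw [htmul, TensorProduct.add_tmul]
  exact UniformSpace.Completion.coe_add _ _

lemma htmul_add_right (x : E) (y y' : F) : htmul x (y + y') = htmul x y + htmul x y' := by
  rw [htmul, TensorProduct.tmul_add]
  exact UniformSpace.Completion.coe_add _ _

lemma htmul_smul_left (c : ℂ) (x : E) (y : F) : htmul (c • x) y = c • htmul x y := by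
  rw [htmul, ← TensorProduct.smul_tmul']
  exact UniformSpace.Completion.coe_smul _ _

lemma htmul_smul_right (c : ℂ) (x : E) (y : F) : htmul x (c • y) = c • htmul x y := by
  rw [htmul, TensorProduct.tmul_smul]
  exact UniformSpace.Completion.coe_smul _ _

/-- `T ↦ T ⊗ 1`, as a `*`-homomorphism. -/
def tensorLeftHom (E F : Type*) [NormedAddCommGroup E] [InnerProductSpace ℂ E]
    [NormedAddCommGroup F] [InnerProductSpace ℂ F] [CompleteSpace E] :
    (E →L[ℂ] E) →⋆ₐ[ℂ] (HilbertTensor E F →L[ℂ] HilbertTensor E F) where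
  toFun T := tensorLeft T
  map_one' := htmul_clm_ext fun x y => by simp [tensorLeft_htmul]
  map_mul' S T := htmul_clm_ext fun x y => by simp [tensorLeft_htmul]
  map_zero' := htmul_clm_ext fun x y => by
    rw [tensorLeft_htmul]
    simpa using htmul_smul_left 0 x y
  map_add' S T := htmul_clm_ext fun x y => by simp [tensorLeft_htmul, htmul_add_left]
  commutes' c := htmul_clm_ext fun x y => by
    simp [tensorLeft_htmul, Algebra.algebraMap_eq_smul_one, htmul_smul_left]
  map_star' T := by
    refine htmul_clm_ext fun x y => ext_inner_right ℂ fun v => ?_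
    rw [ContinuousLinearMap.star_eq_adjoint, ContinuousLinearMap.star_eq_adjoint,
      ContinuousLinearMap.adjoint_inner_left]
    change innerSL ℂ _ v = ((innerSL ℂ (htmul x y)).comp (tensorLeft T)) v
    congr 1
    refine htmul_clm_ext fun x' y' => ?_
    simp [tensorLeft_htmul, inner_htmul, ContinuousLinearMap.adjoint_inner_left]

/-- `T ↦ 1 ⊗ T`, as a `*`-homomorphism. -/
def tensorRightHom (E F : Type*) [NormedAddCommGroup E] [InnerProductSpace ℂ E]
    [NormedAddCommGroup F] [InnerProductSpace ℂ F] [CompleteSpace F] :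
    (F →L[ℂ] F) →⋆ₐ[ℂ] (HilbertTensor E F →L[ℂ] HilbertTensor E F) where
  toFun T := tensorRight T
  map_one' := htmul_clm_ext fun x y => by simp [tensorRight_htmul]
  map_mul' S T := htmul_clm_ext fun x y => by simp [tensorRight_htmul]
  map_zero' := htmul_clm_ext fun x y => by
    rw [tensorRight_htmul]
    simpa using htmul_smul_right 0 x y
  map_add' S T := htmul_clm_ext fun x y => by simp [tensorRight_htmul, htmul_add_right]
  commutes' c := htmul_clm_ext fun x y => by
    simp [tensorRight_htmul, Algebra.algebraMap_eq_smul_one, htmul_smul_right]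
  map_star' T := by
    refine htmul_clm_ext fun x y => ext_inner_right ℂ fun v => ?_
    rw [ContinuousLinearMap.star_eq_adjoint, ContinuousLinearMap.star_eq_adjoint,
      ContinuousLinearMap.adjoint_inner_left]
    change innerSL ℂ _ v = ((innerSL ℂ (htmul x y)).comp (tensorRight T)) v
    congr 1
    refine htmul_clm_ext fun x' y' => ?_
    simp [tensorRight_htmul, inner_htmul, ContinuousLinearMap.adjoint_inner_left]

lemma commute_tensorLeft_tensorRight (S : E →L[ℂ] E) (T : F →L[ℂ] F) :
    Commute (tensorLeft S) (tensorRight T) :=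
  htmul_clm_ext fun x y => by simp [tensorLeft_htmul, tensorRight_htmul]

end Tensor

section Bimodules

/-- The bimodule `E ⊗̄ E` with `a (ξ ⊗ η) b = a ξ ⊗ η b`. -/
def StarBimodule.tensor {A E : Type*} [CStarAlgebra A] [NormedAddCommGroup E]
    [InnerProductSpace ℂ E] [CompleteSpace E] (B : StarBimodule A E) :
    StarBimodule A (HilbertTensor E E) where
  left := (tensorLeftHom E E).comp B.left
  right := (tensorRightHom E E).toAlgHom.toLinearMap ∘ₗ B.right
  right_one := by
    change tensorRightHom E E (B.right 1) = 1
    rw [B.right_one, map_one]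
  right_mul a b := by
    change tensorRightHom E E (B.right (a * b)) =
      tensorRightHom E E (B.right b) * tensorRightHom E E (B.right a)
    rw [B.right_mul, map_mul]
  right_star a := by
    change tensorRightHom E E (B.right (star a)) = star (tensorRightHom E E (B.right a))
    rw [B.right_star, map_star]
  comm a b := commute_tensorLeft_tensorRight _ _

/-- The countable direct sum of copies of a bimodule. -/
def StarBimodule.ampliate {A E : Type*} [CStarAlgebra A] [NormedAddCommGroup E]
    [InnerProductSpace ℂ E] [CompleteSpace E] (B : StarBimodule A E) :
    StarBimodule A (lp (fun _ : ℕ => E) 2) where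
  left := (ampliation E).comp B.left
  right := (ampliation E).toAlgHom.toLinearMap ∘ₗ B.right
  right_one := by
    change ampliation E (B.right 1) = 1
    rw [B.right_one, map_one]
  right_mul a b := by
    change ampliation E (B.right (a * b)) = ampliation E (B.right b) * ampliation E (B.right a)
    rw [B.right_mul, map_mul]
  right_star a := by
    change ampliation E (B.right (star a)) = star (ampliation E (B.right a))
    rw [B.right_star, map_star]
  comm a b := (B.comm a b).map (ampliation E)

variable {K : Type u} [NormedAddCommGroup K] [InnerProductSpace ℂ K] [CompleteSpace K]
variable {N : VonNeumannAlgebra K} (τ : FaithfulNormalTrace N)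

section

attribute [local instance] CStarAlgebra.spectralOrder CStarAlgebra.spectralOrderedRing

lemma denseRange_gnsHat {A : Type*} [NonUnitalCStarAlgebra A] (φ : A →ₗ[ℂ] ℂ)
    (h : ∀ a, 0 ≤ φ (star a * a)) : DenseRange (gnsHat φ h) :=
  (UniformSpace.Completion.denseRange_coe (α := (posFunctional φ h).PreGNS)).comp
    (posFunctional φ h).toPreGNS.surjective.denseRange
    (UniformSpace.Completion.continuous_coe _)

lemma inner_gnsHat {A : Type*} [NonUnitalCStarAlgebra A] (φ : A →ₗ[ℂ] ℂ)
    (h : ∀ a, 0 ≤ φ (star a * a)) (a b : A) :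
    ⟪gnsHat φ h a, gnsHat φ h b⟫_ℂ = φ (star a * b) :=
  (UniformSpace.Completion.inner_coe _ _).trans rfl

end

lemma inner_hat (a b : N.toStarSubalgebra) :
    ⟪hat τ a, hat τ b⟫_ℂ = τ.toLinearMap (star a * b) := inner_gnsHat _ _ _ _

lemma denseRange_hat : DenseRange (hat τ) := denseRange_gnsHat _ _

lemma hat_clm_ext {G : Type*} [NormedAddCommGroup G] [NormedSpace ℂ G]
    {f g : L2 τ →L[ℂ] G} (h : ∀ x, f (hat τ x) = g (hat τ x)) : f = g :=
  DFunLike.coe_injective ((denseRange_hat τ).equalizer f.continuous g.continuous (funext h))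

lemma gnsLeft_hat (a b : N.toStarSubalgebra) :
    gnsLeft τ.toLinearMap τ.nonneg a (hat τ b) = hat τ (a * b) := gnsLeft_gnsHat _ _ _ _

lemma gnsRight_hat (a b : N.toStarSubalgebra) :
    gnsRight τ.toLinearMap τ.nonneg τ.map_mul_comm a (hat τ b) = hat τ (b * a) :=
  gnsRight_gnsHat _ _ _ _ _

lemma gnsRight_star (a : N.toStarSubalgebra) :
    gnsRight τ.toLinearMap τ.nonneg τ.map_mul_comm (star a) =
      star (gnsRight τ.toLinearMap τ.nonneg τ.map_mul_comm a) := by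
  rw [ContinuousLinearMap.star_eq_adjoint, ContinuousLinearMap.eq_adjoint_iff]
  intro ξ ζ
  refine (denseRange_hat τ).induction_on₂ (p := fun ξ ζ =>
    ⟪gnsRight τ.toLinearMap τ.nonneg τ.map_mul_comm (star a) ξ, ζ⟫_ℂ =
      ⟪ξ, gnsRight τ.toLinearMap τ.nonneg τ.map_mul_comm a ζ⟫_ℂ)
    (isClosed_eq (by fun_prop) (by fun_prop)) (fun x y => ?_) ξ ζ
  rw [gnsRight_hat, gnsRight_hat, inner_hat, inner_hat, star_mul, star_star, mul_assoc,
    τ.map_mul_comm, mul_assoc]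

/-- The standard bimodule `L²(N, τ)`. -/
def stdBimodule : StarBimodule N.toStarSubalgebra (L2 τ) where
  left := { gnsLeft τ.toLinearMap τ.nonneg with
    map_one' := hat_clm_ext τ fun x => by
      change gnsLeft τ.toLinearMap τ.nonneg 1 (hat τ x) = _
      rw [gnsLeft_hat, one_mul]; rfl
    commutes' := fun c => hat_clm_ext τ fun x => by
      change gnsLeft τ.toLinearMap τ.nonneg (algebraMap ℂ _ c) (hat τ x) = _
      rw [gnsLeft_hat, Algebra.algebraMap_eq_smul_one, smul_mul_assoc, one_mul, map_smul]
      rfl }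
  right :=
    { toFun := gnsRight τ.toLinearMap τ.nonneg τ.map_mul_comm
      map_add' := fun a b => hat_clm_ext τ fun x => by
        simp [gnsRight_hat, mul_add]
      map_smul' := fun c a => hat_clm_ext τ fun x => by
        simp [gnsRight_hat] }
  right_one := hat_clm_ext τ fun x => by simp [gnsRight_hat]
  right_mul a b := hat_clm_ext τ fun x => by simp [gnsRight_hat, mul_assoc]
  right_star a := by
    exact gnsRight_star τ a
  comm a b := hat_clm_ext τ fun x => by
    change gnsLeft τ.toLinearMap τ.nonneg a
      (gnsRight τ.toLinearMap τ.nonneg τ.map_mul_comm b (hat τ x)) =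
      gnsRight τ.toLinearMap τ.nonneg τ.map_mul_comm b (gnsLeft τ.toLinearMap τ.nonneg a (hat τ x))
    rw [gnsRight_hat, gnsLeft_hat, gnsLeft_hat, gnsRight_hat, mul_assoc]

lemma stdBimodule_left_hat (a b : N.toStarSubalgebra) :
    (stdBimodule τ).left a (hat τ b) = hat τ (a * b) := gnsLeft_hat τ a b

lemma stdBimodule_right_hat (a b : N.toStarSubalgebra) :
    (stdBimodule τ).right a (hat τ b) = hat τ (b * a) := gnsRight_hat τ a b

/-- The coarse bimodule `(L²(N, τ) ⊗̄ L²(N, τ))^{⊕ ∞}`. -/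
def coarseBimodule : StarBimodule N.toStarSubalgebra (Coarse τ) :=
  (stdBimodule τ).tensor.ampliate

end Bimodules

section Matrices

variable {A E F H : Type*} [CStarAlgebra A] [PartialOrder A] [StarOrderedRing A]
  [NormedAddCommGroup E] [InnerProductSpace ℂ E] [CompleteSpace E]
  [NormedAddCommGroup F] [InnerProductSpace ℂ F] [CompleteSpace F]
  [NormedAddCommGroup H] [InnerProductSpace ℂ H] [CompleteSpace H]
  (ι : Type*) [Fintype ι] [DecidableEq ι]

/-- The operator on `H^(ι × ι)` with components `∑ₖ T p k (ξ (k, p))`, where the summand is read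
off at the index `e p k`. -/
def entrywise {ι H : Type*} [Fintype ι] [NormedAddCommGroup H] [InnerProductSpace ℂ H]
    (T : ι × ι → ι → (H →L[ℂ] H)) (e : ι × ι → ι → ι × ι) :
    PiLp 2 (fun _ : ι × ι => H) →L[ℂ] PiLp 2 (fun _ : ι × ι => H) :=
  (PiLp.continuousLinearEquiv 2 ℂ (fun _ : ι × ι => H)).symm.toContinuousLinearMap ∘L
    ContinuousLinearMap.pi fun p => ∑ k, (T p k) ∘L (PiLp.proj 2 (fun _ : ι × ι => H) (e p k))

lemma entrywise_apply {ι H : Type*} [Fintype ι] [NormedAddCommGroup H] [InnerProductSpace ℂ H]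
    (T : ι × ι → ι → (H →L[ℂ] H)) (e : ι × ι → ι → ι × ι) (ξ : PiLp 2 (fun _ : ι × ι => H))
    (p : ι × ι) : entrywise T e ξ p = ∑ k, T p k (ξ (e p k)) := by
  simp [entrywise]

/-- Matrices over `A` act on matrices over an `A`-bimodule. -/
def StarBimodule.matrix (B : StarBimodule A H) :
    StarBimodule (CStarMatrix ι ι A) (PiLp 2 (fun _ : ι × ι => H)) where
  left :=
    { toFun := fun X => entrywise (fun p k => B.left (X p.1 k)) (fun p k => (k, p.2))
      map_one' := by
        ext ξ p
        rw [entrywise_apply, Finset.sum_eq_single p.1 (fun k _ hk => by simp [hk.symm]) (by simp)]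
        simp
      map_mul' := fun X Y => by
        ext ξ p
        simp [entrywise_apply, CStarMatrix.mul_apply, map_sum, sum_apply]
        rw [Finset.sum_comm]
      map_zero' := by
        ext ξ p
        simp [entrywise_apply]
      map_add' := fun X Y => by
        ext ξ p
        simp [entrywise_apply, Finset.sum_add_distrib]
      commutes' := fun c => by
        ext ξ p
        rw [entrywise_apply, Finset.sum_eq_single p.1
          (fun k _ hk => by simp [CStarMatrix.algebraMap_apply, hk.symm]) (by simp)]
        simp [CStarMatrix.algebraMap_apply, Algebra.algebraMap_eq_smul_one]
      map_star' := fun X => by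
        rw [ContinuousLinearMap.star_eq_adjoint, ContinuousLinearMap.eq_adjoint_iff]
        intro ξ ζ
        simp only [PiLp.inner_apply, entrywise_apply, sum_inner, inner_sum, CStarMatrix.star_apply,
          map_star, ContinuousLinearMap.star_eq_adjoint, ContinuousLinearMap.adjoint_inner_left,
          Fintype.sum_prod_type]
        rw [Finset.sum_comm_cycle]
        refine Finset.sum_congr rfl fun i _ => ?_
        rw [Finset.sum_comm] }
  right :=
    { toFun := fun X => entrywise (fun p k => B.right (X k p.2)) (fun p k => (p.1, k))
      map_add' := fun X Y => by
        ext ξ p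
        simp [entrywise_apply, Finset.sum_add_distrib]
      map_smul' := fun c X => by
        ext ξ p
        simp [entrywise_apply, Finset.smul_sum] }
  right_one := by
    ext ξ p
    change entrywise _ _ ξ p = _
    rw [entrywise_apply, Finset.sum_eq_single p.2 (fun k _ hk => by simp [hk]) (by simp)]
    simp [B.right_one]
  right_mul X Y := by
    ext ξ p
    simp [entrywise_apply, CStarMatrix.mul_apply, map_sum, sum_apply, B.right_mul]
    rw [Finset.sum_comm]
  right_star X := by
    rw [ContinuousLinearMap.star_eq_adjoint, ContinuousLinearMap.eq_adjoint_iff]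
    intro ξ ζ
    simp only [LinearMap.coe_mk, AddHom.coe_mk, PiLp.inner_apply, entrywise_apply, sum_inner,
      inner_sum, CStarMatrix.star_apply, B.right_star, ContinuousLinearMap.star_eq_adjoint,
      ContinuousLinearMap.adjoint_inner_left, Fintype.sum_prod_type]
    refine Finset.sum_congr rfl fun i _ => ?_
    rw [Finset.sum_comm]
  comm X Y := by
    ext ξ p
    simp [entrywise_apply, map_sum]
    rw [Finset.sum_comm]
    refine Finset.sum_congr rfl fun k _ => Finset.sum_congr rfl fun l _ => ?_
    exact DFunLike.congr_fun (B.comm _ _).eq _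

lemma StarBimodule.matrix_left_apply (B : StarBimodule A H) (X : CStarMatrix ι ι A)
    (ξ : PiLp 2 (fun _ : ι × ι => H)) (p : ι × ι) :
    (B.matrix ι).left X ξ p = ∑ k, B.left (X p.1 k) (ξ (k, p.2)) := entrywise_apply _ _ _ _

lemma StarBimodule.matrix_right_apply (B : StarBimodule A H) (X : CStarMatrix ι ι A)
    (ξ : PiLp 2 (fun _ : ι × ι => H)) (p : ι × ι) :
    (B.matrix ι).right X ξ p = ∑ k, B.right (X k p.2) (ξ (p.1, k)) := entrywise_apply _ _ _ _

/-- The entrywise extension of a derivation to matrices. -/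
def DerivationGraph.matrix (S : DerivationGraph A E F) :
    DerivationGraph (CStarMatrix ι ι A) (PiLp 2 (fun _ : ι × ι => E))
      (PiLp 2 (fun _ : ι × ι => F)) where
  std := S.std.matrix ι
  hat :=
    { toFun := fun X => WithLp.toLp 2 fun p => S.hat (X p.1 p.2)
      map_add' := fun X Y => by ext p; simp
      map_smul' := fun c X => by ext p; simp }
  left_hat X Y := by
    ext p
    rw [StarBimodule.matrix_left_apply]
    simp [S.left_hat, CStarMatrix.mul_apply]
  right_hat X Y := by
    ext p
    rw [StarBimodule.matrix_right_apply]
    simp [S.right_hat, CStarMatrix.mul_apply]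
  norm_hat_star X := by
    rw [PiLp.norm_eq_of_L2, PiLp.norm_eq_of_L2, Fintype.sum_prod_type, Fintype.sum_prod_type,
      Finset.sum_comm]
    simp [CStarMatrix.star_apply, S.norm_hat_star]
  bim := S.bim.matrix ι
  graph :=
    { carrier := {X | ∀ p : ι × ι, (X.1 p.1 p.2, X.2 p) ∈ S.graph}
      add_mem' := fun hX hY p => S.graph.add_mem (hX p) (hY p)
      zero_mem' := fun p => S.graph.zero_mem
      smul_mem' := fun c X hX p => S.graph.smul_mem c (hX p) }
  leibniz {a b ξ η} ha hb p := by
    have := S.graph.sum_mem (t := Finset.univ) (fun k _ => S.leibniz (ha (p.1, k)) (hb (k, p.2)))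
    rw [← prod_mk_sum, Finset.sum_add_distrib] at this
    have e : ((S.bim.matrix ι).left a η + (S.bim.matrix ι).right b ξ) p =
        ∑ k, S.bim.left (a p.1 k) (η (k, p.2)) + ∑ k, S.bim.right (b k p.2) (ξ (p.1, k)) :=
      congrArg₂ (· + ·) (StarBimodule.matrix_left_apply ι S.bim a η p)
        (StarBimodule.matrix_right_apply ι S.bim b ξ p)
    change ((a * b) p.1 p.2, ((S.bim.matrix ι).left a η + (S.bim.matrix ι).right b ξ) p) ∈ S.graph
    rw [e]
    exact this
  star_mem {a ξ} h := by
    choose ξ' h1 h2 using fun p : ι × ι => S.star_mem (h p)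
    refine ⟨WithLp.toLp 2 fun p => ξ' (p.2, p.1), fun p => h1 (p.2, p.1), ?_⟩
    rw [PiLp.norm_eq_of_L2, PiLp.norm_eq_of_L2]
    refine Real.sqrt_le_sqrt ?_
    rw [Fintype.sum_prod_type, Fintype.sum_prod_type, Finset.sum_comm]
    refine Finset.sum_le_sum fun i _ => Finset.sum_le_sum fun j _ => ?_
    gcongr
    exact h2 (i, j)

end Matrices

section ResolventOperators

lemma re_inner_le_norm_mul_norm {E : Type*} [NormedAddCommGroup E] [InnerProductSpace ℂ E]
    (ξ ζ : E) : (⟪ξ, ζ⟫_ℂ).re ≤ ‖ξ‖ * ‖ζ‖ :=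
  (Complex.re_le_norm _).trans (norm_inner_le_norm _ _)

/-- The resolvent `φ = α (α + T⋆ T)⁻¹` of an operator `T` with graph `Γ`, and `ψ = T φ`. -/
structure ResolventOp {E F : Type*} [NormedAddCommGroup E] [InnerProductSpace ℂ E]
    [NormedAddCommGroup F] [InnerProductSpace ℂ F] (Γ : Submodule ℂ (E × F)) (α : ℝ) where
  φ : E →ₗ[ℂ] E
  ψ : E → F
  mem : ∀ ξ, (φ ξ, ψ ξ) ∈ Γ
  inner_eq : ∀ ξ {a b}, (a, b) ∈ Γ → (α : ℂ) * ⟪ξ - φ ξ, a⟫_ℂ = ⟪ψ ξ, b⟫_ℂ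

namespace ResolventOp

variable {E F : Type*} [NormedAddCommGroup E] [InnerProductSpace ℂ E]
    [NormedAddCommGroup F] [InnerProductSpace ℂ F] {Γ : Submodule ℂ (E × F)} {α : ℝ}
    (ρ : ResolventOp Γ α)

lemma inner_symm (hα : 0 < α) (ξ ζ : E) : ⟪ρ.φ ξ, ζ⟫_ℂ = ⟪ξ, ρ.φ ζ⟫_ℂ := by
  have hα0 : (α : ℂ) ≠ 0 := by exact_mod_cast hα.ne'
  have h1 := ρ.inner_eq ξ (ρ.mem ζ)
  have h2 := congrArg (starRingEnd ℂ) (ρ.inner_eq ζ (ρ.mem ξ))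
  rw [map_mul, Complex.conj_ofReal, inner_conj_symm, inner_conj_symm, ← h1] at h2
  have h3 := mul_left_cancel₀ hα0 h2
  rw [inner_sub_left, inner_sub_right] at h3
  linear_combination h3

lemma energy_eq (ξ : E) : ‖ρ.ψ ξ‖ ^ 2 = α * (⟪ξ - ρ.φ ξ, ρ.φ ξ⟫_ℂ).re := by
  have h := congrArg Complex.re (ρ.inner_eq ξ (ρ.mem ξ))
  rw [Complex.re_ofReal_mul] at h
  rw [h]
  exact (inner_self_eq_norm_sq (𝕜 := ℂ) (ρ.ψ ξ)).symm

lemma re_inner_nonneg (hα : 0 < α) (ξ : E) : 0 ≤ (⟪ξ - ρ.φ ξ, ρ.φ ξ⟫_ℂ).re := by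
  have := ρ.energy_eq ξ
  by_contra h
  push Not at h
  nlinarith [sq_nonneg ‖ρ.ψ ξ‖, mul_pos_of_neg_of_neg h (neg_lt_zero.2 hα)]

/-- The displacement is dominated by the quadratic form of `1 - φ`. -/
lemma norm_sub_sq_le (hα : 0 < α) (ξ : E) : ‖ξ - ρ.φ ξ‖ ^ 2 ≤ (⟪ξ - ρ.φ ξ, ξ⟫_ℂ).re := by
  have h := ρ.re_inner_nonneg hα ξ
  have h2 : (⟪ξ - ρ.φ ξ, ξ - ρ.φ ξ⟫_ℂ).re = ‖ξ - ρ.φ ξ‖ ^ 2 := inner_self_eq_norm_sq (𝕜 := ℂ) _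
  rw [inner_sub_right, Complex.sub_re] at h2
  linarith

lemma norm_sub_le (hα : 0 < α) (ξ : E) : ‖ξ - ρ.φ ξ‖ ≤ ‖ξ‖ := by
  have h := (ρ.norm_sub_sq_le hα ξ).trans (re_inner_le_norm_mul_norm _ _)
  rw [sq] at h
  by_contra hlt
  push Not at hlt
  have : 0 < ‖ξ - ρ.φ ξ‖ := (norm_nonneg _).trans_lt hlt
  nlinarith

lemma norm_le (hα : 0 < α) (ξ : E) : ‖ρ.φ ξ‖ ≤ ‖ξ‖ := by
  have h := ρ.re_inner_nonneg hα ξ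
  rw [inner_sub_left, Complex.sub_re] at h
  have h2 : (⟪ρ.φ ξ, ρ.φ ξ⟫_ℂ).re = ‖ρ.φ ξ‖ ^ 2 := inner_self_eq_norm_sq (𝕜 := ℂ) _
  have h3 := re_inner_le_norm_mul_norm ξ (ρ.φ ξ)
  by_contra hlt
  push Not at hlt
  have : 0 < ‖ρ.φ ξ‖ := (norm_nonneg _).trans_lt hlt
  nlinarith

lemma energy_le (hα : 0 < α) (ξ : E) : ‖ρ.ψ ξ‖ ^ 2 ≤ α * (‖ξ - ρ.φ ξ‖ * ‖ξ‖) := by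
  rw [ρ.energy_eq]
  gcongr
  exact (re_inner_le_norm_mul_norm _ _).trans (by gcongr; exact ρ.norm_le hα ξ)

/-- `φ ξ` minimizes `a ↦ α ‖ξ - a‖² + ‖T a‖²`. -/
lemma minimizer_identity (ξ : E) {a : E} {b : F} (h : (a, b) ∈ Γ) :
    α * ‖ξ - a‖ ^ 2 + ‖b‖ ^ 2 = α * ‖ξ - ρ.φ ξ‖ ^ 2 + ‖ρ.ψ ξ‖ ^ 2 +
      (α * ‖a - ρ.φ ξ‖ ^ 2 + ‖b - ρ.ψ ξ‖ ^ 2) := by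
  have h1 := congrArg Complex.re (ρ.inner_eq ξ (Γ.sub_mem h (ρ.mem ξ)))
  rw [Complex.re_ofReal_mul] at h1
  have h2 : ‖ξ - a‖ ^ 2 = ‖ξ - ρ.φ ξ‖ ^ 2 - 2 * (⟪ξ - ρ.φ ξ, a - ρ.φ ξ⟫_ℂ).re +
      ‖a - ρ.φ ξ‖ ^ 2 := by
    rw [show ξ - a = (ξ - ρ.φ ξ) - (a - ρ.φ ξ) by abel]
    exact norm_sub_sq (𝕜 := ℂ) _ _
  have h3 : ‖b‖ ^ 2 = ‖ρ.ψ ξ‖ ^ 2 + 2 * (⟪ρ.ψ ξ, b - ρ.ψ ξ⟫_ℂ).re + ‖b - ρ.ψ ξ‖ ^ 2 := by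
    conv_lhs => rw [show b = ρ.ψ ξ + (b - ρ.ψ ξ) by abel]
    exact norm_add_sq (𝕜 := ℂ) _ _
  change α * (⟪ξ - ρ.φ ξ, a - ρ.φ ξ⟫_ℂ).re = (⟪ρ.ψ ξ, b - ρ.ψ ξ⟫_ℂ).re at h1
  rw [h2, h3, ← h1]
  ring

/-- The graph of the entrywise extension of an operator to a finite direct sum. -/
def piGraph (J : Type*) [Fintype J] (Γ : Submodule ℂ (E × F)) :
    Submodule ℂ (PiLp 2 (fun _ : J => E) × PiLp 2 (fun _ : J => F)) where
  carrier := {x | ∀ j, (x.1 j, x.2 j) ∈ Γ}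
  add_mem' := fun hX hY p => Γ.add_mem (hX p) (hY p)
  zero_mem' := fun _ => Γ.zero_mem
  smul_mem' := fun c _ hX p => Γ.smul_mem c (hX p)

/-- The entrywise extension of a resolvent. -/
def pi (J : Type*) [Fintype J] : ResolventOp (piGraph J Γ) α where
  φ := { toFun := fun ξ => WithLp.toLp 2 fun j => ρ.φ (ξ j)
         map_add' := fun ξ ζ => by ext j; simp
         map_smul' := fun c ξ => by ext j; simp }
  ψ ξ := WithLp.toLp 2 fun j => ρ.ψ (ξ j)
  mem ξ j := ρ.mem (ξ j)
  inner_eq ξ a b h := by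
    rw [PiLp.inner_apply, PiLp.inner_apply, Finset.mul_sum]
    exact Finset.sum_congr rfl fun j _ => ρ.inner_eq (ξ j) (h j)

end ResolventOp

/-- The resolvent of the closure of a densely defined closable operator. -/
def resolventOp {E F : Type*} [NormedAddCommGroup E] [InnerProductSpace ℂ E] [CompleteSpace E]
    [NormedAddCommGroup F] [InnerProductSpace ℂ F] [CompleteSpace F] (T : E →ₗ.[ℂ] F)
    (hd : Dense (T.domain : Set E)) (hT : T.IsClosable) {α : ℝ} (hα : 0 < α) :
    ResolventOp T.closure.graph α := by
  have key : ∀ ξ, ∃ ψ, (resolventMap T α ξ, ψ) ∈ T.closure.graph ∧ ∀ a b, (a, b) ∈ T.closure.graph →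
      (α : ℂ) * ⟪ξ - resolventMap T α ξ, a⟫_ℂ = ⟪ψ, b⟫_ℂ := by
    intro ξ
    obtain ⟨χ, ⟨ψ, h1, h2⟩, h3⟩ := Classical.epsilon_spec (existsUnique_resolvent T hd hT hα ξ).exists
    refine ⟨ψ, h1, fun a b hab => ?_⟩
    rw [← inner_eq_of_mem_graph T hd hT h2 hab, ← eq_sub_iff_add_eq'] at *
    have : χ = (α : ℂ) • (ξ - resolventMap T α ξ) := by rw [smul_sub]; exact h3
    rw [this, inner_smul_left, Complex.conj_ofReal]
  have uniq : ∀ ξ ζ ψ, (ζ, ψ) ∈ T.closure.graph → (∀ a b, (a, b) ∈ T.closure.graph →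
      (α : ℂ) * ⟪ξ - ζ, a⟫_ℂ = ⟪ψ, b⟫_ℂ) → ζ = resolventMap T α ξ := by
    intro ξ ζ ψ h1 h2
    obtain ⟨ψ', h3, h4⟩ := key ξ
    have h5 := T.closure.graph.sub_mem h1 h3
    have e1 := h2 _ _ h5
    have e2 := h4 _ _ h5
    have e3 : (α : ℂ) * ⟪ζ - resolventMap T α ξ, ζ - resolventMap T α ξ⟫_ℂ + ⟪ψ - ψ', ψ - ψ'⟫_ℂ = 0 := by
      rw [inner_sub_left ψ, ← e1, ← e2, ← mul_sub, ← inner_sub_left, ← mul_add, ← inner_add_left]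
      simp
    rw [inner_self_eq_norm_sq_to_K, inner_self_eq_norm_sq_to_K] at e3
    have e4 : α * ‖ζ - resolventMap T α ξ‖ ^ 2 + ‖ψ - ψ'‖ ^ 2 = 0 := by
      change (α : ℂ) * ((‖ζ - resolventMap T α ξ‖ : ℝ) : ℂ) ^ 2 + ((‖ψ - ψ'‖ : ℝ) : ℂ) ^ 2 = 0 at e3
      exact_mod_cast e3
    have e5 : ‖ζ - resolventMap T α ξ‖ ^ 2 = 0 := by
      have h6 := mul_nonneg hα.le (sq_nonneg ‖ζ - resolventMap T α ξ‖)
      have h7 : α * ‖ζ - resolventMap T α ξ‖ ^ 2 = 0 := by linarith [sq_nonneg ‖ψ - ψ'‖]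
      exact (mul_eq_zero.1 h7).resolve_left hα.ne'
    exact sub_eq_zero.1 (norm_eq_zero.1 (by simpa using e5))
  choose ψ h1 h2 using key
  exact
  { φ :=
      { toFun := resolventMap T α
        map_add' := fun ξ ζ => by
          refine (uniq _ _ _ (T.closure.graph.add_mem (h1 ξ) (h1 ζ)) fun a b hab => ?_).symm
          rw [inner_add_left, ← h2 _ a b hab, ← h2 _ a b hab, ← mul_add, ← inner_add_left]
          congr 2
          change ξ + ζ - (_ + _) = _
          abel
        map_smul' := fun c ξ => by
          refine (uniq _ _ _ (T.closure.graph.smul_mem c (h1 ξ)) fun a b hab => ?_).symm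
          change (α : ℂ) * ⟪c • ξ - c • _, a⟫_ℂ = ⟪c • ψ ξ, b⟫_ℂ
          rw [inner_smul_left, ← h2 _ a b hab, ← smul_sub, inner_smul_left]
          ring }
    ψ := ψ
    mem := h1
    inner_eq := fun ξ a b hab => h2 ξ a b hab }

end ResolventOperators

section NearMinimizers

variable {A E F : Type*} [CStarAlgebra A] [NormedAddCommGroup E]
    [InnerProductSpace ℂ E] [CompleteSpace E] [NormedAddCommGroup F]
    [InnerProductSpace ℂ F] [CompleteSpace F]

/-- `Γ` is the closure of the graph of the derivation, as an operator from `E`. -/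
structure DerivationGraph.IsCore (S : DerivationGraph A E F) (Γ : Submodule ℂ (E × F)) : Prop where
  mem : ∀ {x ξ}, (x, ξ) ∈ S.graph → (S.hat x, ξ) ∈ Γ
  approx : ∀ {a b}, (a, b) ∈ Γ → ∀ κ > 0, ∃ x ξ, (x, ξ) ∈ S.graph ∧ ‖S.hat x - a‖ ≤ κ ∧ ‖ξ - b‖ ≤ κ

/-- The resolvent of a self-adjoint `x` is approximated, in the graph norm, by self-adjoint elements
of the domain whose spectrum is close to an interval containing that of `x`. -/
lemma DerivationGraph.IsCore.exists_near_resolvent {S : DerivationGraph A E F}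
    {Γ : Submodule ℂ (E × F)} (hS : S.IsCore Γ) {α : ℝ} (hα : 0 < α) (ρ : ResolventOp Γ α)
    {x : A} (hx : IsSelfAdjoint x) {c d : ℝ} (hc : c ≤ 0) (hd : 0 ≤ d)
    (hspec : spectrum ℝ x ⊆ Set.Icc c d) {κ : ℝ} (hκ : 0 < κ) :
    ∃ y ξ, (y, ξ) ∈ S.graph ∧ IsSelfAdjoint y ∧ spectrum ℝ y ⊆ Set.Icc (c - κ) (d + κ) ∧
      ‖S.hat y - ρ.φ (S.hat x)‖ ≤ κ ∧ ‖ξ - ρ.ψ (S.hat x)‖ ≤ κ := by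
  obtain ⟨ξ₀, hξ₀⟩ : ∃ ξ₀, ξ₀ = S.hat x := ⟨_, rfl⟩
  rw [← hξ₀]
  obtain ⟨a, ha⟩ : ∃ a, a = ‖ξ₀ - ρ.φ ξ₀‖ := ⟨_, rfl⟩
  obtain ⟨b, hb⟩ : ∃ b, b = ‖ρ.ψ ξ₀‖ := ⟨_, rfl⟩
  have ha0 : 0 ≤ a := ha ▸ norm_nonneg _
  have hb0 : 0 ≤ b := hb ▸ norm_nonneg _
  obtain ⟨C, hC⟩ : ∃ C, C = α * (4 + 4 * a) + (1 + 2 * b) := ⟨_, rfl⟩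
  have hC0 : 0 < C := by rw [hC]; positivity
  obtain ⟨e, he, he1, heκ, heC⟩ : ∃ e : ℝ, 0 < e ∧ e ≤ 1 ∧ e ≤ κ ∧ e * C ≤ min 1 α * κ ^ 2 := by
    refine ⟨min (min 1 κ) (min 1 α * κ ^ 2 / C), ?_, ?_, ?_, ?_⟩
    · have : 0 < min 1 α := lt_min one_pos hα
      exact lt_min (lt_min one_pos hκ) (by positivity)
    · exact (min_le_left _ _).trans (min_le_left _ _)
    · exact (min_le_left _ _).trans (min_le_right _ _)
    · rw [← le_div_iff₀ hC0]; exact min_le_right _ _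
  obtain ⟨y₀, ξ, h1, h2, h3⟩ := hS.approx (ρ.mem ξ₀) e he
  obtain ⟨y, ζ, h4, h5, h6, h7, h8⟩ := S.exists_truncation hx hc hd hspec h1 he
  have hm := ρ.minimizer_identity ξ₀ (hS.mem h4)
  rw [← ha, ← hb] at hm
  have h9 : ‖ξ₀ - S.hat y‖ ≤ a + 2 * e := by
    rw [map_sub, map_sub, ← hξ₀] at h7
    have : ‖ξ₀ - S.hat y₀‖ ≤ a + e := by
      rw [ha, show ξ₀ - S.hat y₀ = (ξ₀ - ρ.φ ξ₀) - (S.hat y₀ - ρ.φ ξ₀) by abel]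
      exact (norm_sub_le _ _).trans (by gcongr)
    linarith
  have h10 : ‖ζ‖ ≤ b + e := by
    refine h8.trans ?_
    rw [hb, show ξ = ρ.ψ ξ₀ + (ξ - ρ.ψ ξ₀) by abel]
    exact (norm_add_le _ _).trans (by gcongr)
  have h11 : ‖ξ₀ - S.hat y‖ ^ 2 ≤ (a + 2 * e) ^ 2 := by gcongr
  have h12 : ‖ζ‖ ^ 2 ≤ (b + e) ^ 2 := by gcongr
  have h13 : α * ‖S.hat y - ρ.φ ξ₀‖ ^ 2 + ‖ζ - ρ.ψ ξ₀‖ ^ 2 ≤ e * C := by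
    have i1 : α * ‖ξ₀ - S.hat y‖ ^ 2 ≤ α * (a + 2 * e) ^ 2 := by gcongr
    have i2 : e ^ 2 ≤ e := by nlinarith
    have i3 : α * e ^ 2 ≤ α * e := by gcongr
    rw [hC]
    nlinarith
  have h14 : min 1 α * κ ^ 2 ≤ κ ^ 2 := mul_le_of_le_one_left (by positivity) (min_le_left _ _)
  have h15 : min 1 α * κ ^ 2 ≤ α * κ ^ 2 := by gcongr; exact min_le_right _ _
  refine ⟨y, ζ, h4, h5, h6.trans (Set.Icc_subset_Icc (by linarith) (by linarith)), ?_, ?_⟩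
  · refine le_of_sq_le_sq ?_ hκ.le
    refine le_of_mul_le_mul_left ?_ hα
    linarith [sq_nonneg ‖ζ - ρ.ψ ξ₀‖]
  · refine le_of_sq_le_sq ?_ hκ.le
    linarith [mul_nonneg hα.le (sq_nonneg ‖S.hat y - ρ.φ ξ₀‖)]

end NearMinimizers

section CompletePositivity

variable {A E F : Type*} [CStarAlgebra A] [NormedAddCommGroup E]
    [InnerProductSpace ℂ E] [CompleteSpace E] [NormedAddCommGroup F]
    [InnerProductSpace ℂ F] [CompleteSpace F]

lemma zero_le_inner_self {E : Type*} [NormedAddCommGroup E] [InnerProductSpace ℂ E]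
    (x : E) : 0 ≤ ⟪x, x⟫_ℂ := by
  rw [inner_self_eq_norm_sq_to_K]
  exact pow_nonneg (RCLike.ofReal_nonneg.2 (norm_nonneg x)) 2

lemma spectrum_subset_Icc_norm {y : A} : spectrum ℝ y ⊆ Set.Icc (-‖y‖) ‖y‖ := by
  intro t ht
  have : Nontrivial A := by
    by_contra hn
    rw [not_nontrivial_iff_subsingleton] at hn
    exact (Set.ext_iff.1 (spectrum.of_subsingleton (R := ℝ) y) t).1 ht
  exact abs_le.1 (spectrum.norm_le_norm_of_mem ht)

lemma spectrum_star_mul_self_subset_Icc (m : A) :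
    spectrum ℝ (star m * m) ⊆ Set.Icc 0 ‖star m * m‖ := fun t ht =>
  ⟨spectrum_star_mul_self_nonneg t ht, (spectrum_subset_Icc_norm ht).2⟩

lemma exists_star_mul_self_eq_add_smul_one {y : A} (hy : IsSelfAdjoint y) {κ : ℝ}
    (h : ∀ t ∈ spectrum ℝ y, 0 ≤ t + κ) : ∃ s : A, star s * s = y + (κ : ℂ) • (1 : A) := by
  refine ⟨cfc (fun t : ℝ => √(t + κ)) y, ?_⟩
  have hsa : IsSelfAdjoint (cfc (fun t : ℝ => √(t + κ)) y) := cfc_predicate _ _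
  rw [hsa.star_eq, ← cfc_mul (fun t : ℝ => √(t + κ)) (fun t : ℝ => √(t + κ)) y
    (by fun_prop) (by fun_prop)]
  have : Set.EqOn (fun t : ℝ => √(t + κ) * √(t + κ)) (fun t => t + κ) (spectrum ℝ y) :=
    fun t ht => Real.mul_self_sqrt (h t ht)
  rw [cfc_congr this, cfc_add_const κ (fun t => t) y (by fun_prop) hy, cfc_id' ℝ y hy,
    Algebra.algebraMap_eq_smul_one, Complex.coe_smul]

lemma piLp_norm_le {J E : Type*} [Fintype J] [NormedAddCommGroup E]
    (v : PiLp 2 (fun _ : J => E)) {κ : ℝ} (hκ : 0 ≤ κ)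
    (h : ∀ j, ‖v j‖ ≤ κ / (Fintype.card J + 1)) : ‖v‖ ≤ κ := by
  refine le_of_sq_le_sq ?_ hκ
  rw [PiLp.norm_sq_eq_of_L2]
  have hc : (0 : ℝ) ≤ Fintype.card J := Nat.cast_nonneg _
  calc ∑ j, ‖v j‖ ^ 2 ≤ ∑ _j : J, (κ / (Fintype.card J + 1)) ^ 2 :=
        Finset.sum_le_sum fun j _ => by gcongr; exact h j
    _ = κ ^ 2 * (Fintype.card J / (Fintype.card J + 1) ^ 2) := by
        rw [Finset.sum_const, Finset.card_univ, nsmul_eq_mul]; field_simp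
    _ ≤ κ ^ 2 * 1 := by
        gcongr
        rw [div_le_one (by positivity)]
        nlinarith
    _ = κ ^ 2 := mul_one _

lemma DerivationGraph.IsCore.matrix [PartialOrder A] [StarOrderedRing A]
    {S : DerivationGraph A E F} {Γ : Submodule ℂ (E × F)} (hS : S.IsCore Γ)
    (ι : Type*) [Fintype ι] [DecidableEq ι] :
    (S.matrix ι).IsCore (ResolventOp.piGraph (ι × ι) Γ) where
  mem h p := hS.mem (h p)
  approx {a b} h κ hκ := by
    have hκ' : 0 < κ / (Fintype.card (ι × ι) + 1) := by positivity
    choose x ξ h1 h2 h3 using fun p => hS.approx (h p) _ hκ'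
    refine ⟨CStarMatrix.ofMatrix fun i j => x (i, j), WithLp.toLp 2 ξ, fun p => h1 p, ?_, ?_⟩
    · exact piLp_norm_le _ hκ.le h2
    · exact piLp_norm_le _ hκ.le h3

lemma DerivationGraph.inner_hat_mul_star (S : DerivationGraph A E F) (b c y : A) :
    ⟪S.hat (b * star c), S.hat y⟫_ℂ = ⟪S.hat b, S.std.left y (S.hat c)⟫_ℂ := by
  rw [← S.right_hat, S.std.right_star, ContinuousLinearMap.star_eq_adjoint,
    ContinuousLinearMap.adjoint_inner_left, S.right_hat, S.left_hat]

lemma sum_inner_left_star_mul_nonneg [PartialOrder A] [StarOrderedRing A]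
    (B : StarBimodule A E) {ι : Type*} [Fintype ι]
    [DecidableEq ι] (s : CStarMatrix ι ι A) (v : ι → E) :
    0 ≤ ∑ i, ∑ j, ⟪v i, B.left ((star s * s) i j) (v j)⟫_ℂ := by
  have : ∑ i, ∑ j, ⟪v i, B.left ((star s * s) i j) (v j)⟫_ℂ =
      ∑ k, ⟪∑ i, B.left (s k i) (v i), ∑ j, B.left (s k j) (v j)⟫_ℂ := by
    simp only [CStarMatrix.mul_apply, map_sum, sum_apply, map_mul, CStarMatrix.star_apply, map_star,
      inner_sum, sum_inner, mul_apply_eq_comp, ContinuousLinearMap.star_eq_adjoint,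
      ContinuousLinearMap.adjoint_inner_right]
    rw [Finset.sum_comm_cycle]
    refine Finset.sum_congr rfl fun k _ => ?_
    rw [Finset.sum_comm]
  rw [this]
  refine Finset.sum_nonneg fun k _ => ?_
  exact zero_le_inner_self _

/-- The resolvent of a derivation is completely positive. -/
lemma DerivationGraph.IsCore.resolvent_completelyPositive {S : DerivationGraph A E F}
    {Γ : Submodule ℂ (E × F)} (hS : S.IsCore Γ) {α : ℝ} (hα : 0 < α) (ρ : ResolventOp Γ α)
    {ι : Type*} [Fintype ι] (a b : ι → A) :
    0 ≤ ∑ i, ∑ j, ⟪S.hat (b i * star (b j)), ρ.φ (S.hat (star (a i) * a j))⟫_ℂ := by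
  classical
  let := CStarAlgebra.spectralOrder A
  let := CStarAlgebra.spectralOrderedRing A
  rcases isEmpty_or_nonempty ι with hι | ⟨⟨i₀⟩⟩
  · simp
  obtain ⟨m, hm⟩ : ∃ m : CStarMatrix ι ι A, ∀ k j, m k j = if k = i₀ then a j else 0 :=
    ⟨CStarMatrix.ofMatrix (Matrix.of fun k j => if k = i₀ then a j else 0), fun _ _ => rfl⟩
  have hmm : ∀ i j, (star m * m) i j = star (a i) * a j := by
    intro i j
    rw [CStarMatrix.mul_apply, Finset.sum_eq_single i₀]
    · rw [CStarMatrix.star_apply, hm, hm, if_pos rfl, if_pos rfl]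
    · intro k _ hk
      have : m k j = 0 := by rw [hm, if_neg hk]
      rw [this, mul_zero]
    · simp
  obtain ⟨C, hC⟩ : ∃ C : ℝ, C = ∑ i, ∑ j, ‖S.hat (b i * star (b j))‖ + ∑ i, ‖S.hat (b i)‖ ^ 2 :=
    ⟨_, rfl⟩
  have hC0 : 0 ≤ C := by rw [hC]; positivity
  suffices h : ∀ κ > 0, ∃ w : ℂ, 0 ≤ w ∧
      ‖w - ∑ i, ∑ j, ⟪S.hat (b i * star (b j)), ρ.φ (S.hat (star (a i) * a j))⟫_ℂ‖ ≤ C * κ by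
    have hcl : IsClosed {w : ℂ | 0 ≤ w} := isClosed_Ici
    refine hcl.closure_subset (Metric.mem_closure_iff.2 fun ε hε => ?_)
    obtain ⟨w, hw, hw'⟩ := h (ε / (C + 1)) (by positivity)
    refine ⟨w, hw, ?_⟩
    rw [dist_comm, dist_eq_norm]
    refine hw'.trans_lt ?_
    rw [mul_div_assoc', div_lt_iff₀ (by positivity)]
    nlinarith
  intro κ hκ
  obtain ⟨y, ξ, -, hy, hyspec, hyφ, -⟩ := (hS.matrix ι).exists_near_resolvent hα
    (ρ.pi (ι × ι)) (IsSelfAdjoint.star_mul_self m) le_rfl (norm_nonneg _)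
    (spectrum_star_mul_self_subset_Icc m) hκ
  have hent : ∀ i j, ‖S.hat (y i j) - ρ.φ (S.hat (star (a i) * a j))‖ ≤ κ := by
    intro i j
    rw [← hmm]
    exact (PiLp.norm_apply_le ((S.matrix ι).hat y - (ρ.pi (ι × ι)).φ
      ((S.matrix ι).hat (star m * m))) (i, j)).trans hyφ
  obtain ⟨s, hs⟩ := exists_star_mul_self_eq_add_smul_one hy (κ := κ)
    fun t ht => by linarith [(hyspec ht).1]
  refine ⟨_, sum_inner_left_star_mul_nonneg S.std s (fun i => S.hat (b i)), ?_⟩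
  have hsum : ∑ i, ∑ j, ⟪S.hat (b i), S.std.left ((star s * s) i j) (S.hat (b j))⟫_ℂ =
      ∑ i, ∑ j, ⟪S.hat (b i * star (b j)), S.hat (y i j)⟫_ℂ + ∑ i, (κ : ℂ) * ‖S.hat (b i)‖ ^ 2 := by
    rw [← Finset.sum_add_distrib]
    refine Finset.sum_congr rfl fun i _ => ?_
    rw [hs]
    simp only [S.inner_hat_mul_star, CStarMatrix.add_apply, map_add, add_apply,
      inner_add_right, Finset.sum_add_distrib]
    congr 1
    rw [Finset.sum_eq_single i]
    · rw [CStarMatrix.smul_apply, CStarMatrix.one_apply_eq, map_smul, map_one, smul_apply,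
        inner_smul_right, one_apply_eq_self, inner_self_eq_norm_sq_to_K]
      rfl
    · intro j _ hj
      rw [CStarMatrix.smul_apply, CStarMatrix.one_apply_ne hj.symm]
      simp
    · simp
  rw [hsum, add_sub_right_comm, ← Finset.sum_sub_distrib]
  refine (norm_add_le _ _).trans ?_
  rw [hC, add_mul]
  gcongr
  · rw [Finset.sum_mul]
    refine (norm_sum_le _ _).trans (Finset.sum_le_sum fun i _ => ?_)
    rw [← Finset.sum_sub_distrib, Finset.sum_mul]
    refine (norm_sum_le _ _).trans (Finset.sum_le_sum fun j _ => ?_)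
    rw [← inner_sub_right]
    refine (norm_inner_le_norm _ _).trans ?_
    gcongr
    exact hent i j
  · rw [Finset.sum_mul]
    refine (norm_sum_le _ _).trans (Finset.sum_le_sum fun i _ => ?_)
    rw [norm_mul, norm_pow, Complex.norm_real, Complex.norm_real, norm_norm, Real.norm_eq_abs,
      abs_of_pos hκ, mul_comm]

end CompletePositivity

section Averaging

lemma norm_unitary_le_one {A : Type*} [CStarAlgebra A] (v : unitary A) : ‖(v : A)‖ ≤ 1 := by
  rcases subsingleton_or_nontrivial A with h | h
  · rw [Subsingleton.elim (v : A) 0, norm_zero]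
    exact zero_le_one
  · exact (CStarRing.norm_coe_unitary v).le

/-- A vector in a bimodule which is almost central for a group `G` of unitaries is almost central
for the unit ball of the algebra spanned by `G`. -/
lemma norm_commutator_le_of_unitary_group {A V : Type*} [CStarAlgebra A]
    [SeminormedAddCommGroup V] [InnerProductSpace ℂ V] (L R : A →ₗ[ℂ] V →ₗ[ℂ] V)
    (hLR : ∀ x y s, L x (R y s) = R y (L x s)) (hL : ∀ x y s, L (x * y) s = L x (L y s))
    (hR : ∀ x y s, R (x * y) s = R y (R x s)) (hL1 : ∀ s, L 1 s = s) (hR1 : ∀ s, R 1 s = s)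
    (hLn : ∀ x s, ‖L x s‖ ≤ ‖x‖ * ‖s‖) (hRn : ∀ x s, ‖R x s‖ ≤ ‖x‖ * ‖s‖)
    (G : Subgroup (unitary A)) (ξ : V) {r : ℝ}
    (hr : ∀ v ∈ G, ‖L v (R (star (v : A)) ξ) - ξ‖ ≤ r) {x : A}
    (hx : x ∈ Submodule.span ℂ ((fun v : unitary A => (v : A)) '' (G : Set (unitary A)))) :
    ‖L x ξ - R x ξ‖ ≤ 2 * ‖x‖ * r := by
  obtain ⟨C, hC⟩ : ∃ C : Set V, C = convexHull ℝ
    ((fun v : unitary A => L v (R (star (v : A)) ξ)) '' (G : Set (unitary A))) := ⟨_, rfl⟩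
  have hCc : Convex ℝ C := hC ▸ convex_convexHull ℝ _
  have hξC : ξ ∈ C := by
    rw [hC]
    refine subset_convexHull ℝ _ ⟨1, G.one_mem, ?_⟩
    simp [hL1, hR1]
  have hball : ∀ ζ ∈ C, ‖ζ - ξ‖ ≤ r := by
    intro ζ hζ
    rw [hC] at hζ
    have : ζ ∈ Metric.closedBall ξ r := by
      refine convexHull_min ?_ (convex_closedBall ξ r) hζ
      rintro _ ⟨v, hv, rfl⟩
      rw [mem_closedBall_iff_norm]
      exact hr v hv
    rwa [mem_closedBall_iff_norm] at this
  have hinv : ∀ v ∈ G, ∀ ζ ∈ C, L v (R (star (v : A)) ζ) ∈ C := by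
    intro v hv ζ hζ
    let P : V →ₗ[ℝ] V := (L v ∘ₗ R (star (v : A))).restrictScalars ℝ
    have h1 : P ζ ∈ P '' C := ⟨ζ, hζ, rfl⟩
    rw [hC, LinearMap.image_convexHull] at h1
    rw [hC]
    refine convexHull_mono ?_ h1
    rintro _ ⟨_, ⟨w, hw, rfl⟩, rfl⟩
    refine ⟨v * w, G.mul_mem hv hw, ?_⟩
    change L ((v : A) * w) (R (star ((v : A) * w)) ξ) = L v (R (star (v : A)) (L w (R (star (w : A)) ξ)))
    rw [star_mul, hR, hL, hLR w]
  obtain ⟨m, hm⟩ : ∃ m : ℝ, m = sInf (norm '' C) := ⟨_, rfl⟩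
  have hbdd : BddBelow (norm '' C) := ⟨0, by rintro _ ⟨ζ, -, rfl⟩; exact norm_nonneg ζ⟩
  have hmle : ∀ ζ ∈ C, m ≤ ‖ζ‖ := fun ζ hζ => hm ▸ csInf_le hbdd ⟨ζ, hζ, rfl⟩
  have hm0 : 0 ≤ m := hm ▸ Real.sInf_nonneg (by rintro _ ⟨ζ, -, rfl⟩; exact norm_nonneg ζ)
  have hspan : ∃ c : ℝ, 0 ≤ c ∧ ∀ (ζ : V) (κ : ℝ), 0 ≤ κ →
      (∀ v ∈ G, ‖L v (R (star (v : A)) ζ) - ζ‖ ≤ κ) → ‖L x ζ - R x ζ‖ ≤ c * κ := by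
    induction hx using Submodule.span_induction with
    | mem x hx =>
      obtain ⟨v, hv, rfl⟩ := hx
      refine ⟨1, zero_le_one, fun ζ κ _ h => ?_⟩
      have e : L v ζ - R v ζ = R v (L v (R (star (v : A)) ζ) - ζ) := by
        rw [map_sub, ← hLR, ← hR, Unitary.coe_star_mul_self, hR1]
      rw [e]
      refine (hRn _ _).trans ?_
      gcongr
      · exact norm_unitary_le_one v
      · exact h v hv
    | zero => exact ⟨0, le_rfl, fun ζ κ _ _ => by simp⟩
    | add x y _ _ hx hy =>
      obtain ⟨c, hc, h1⟩ := hx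
      obtain ⟨d, hd, h2⟩ := hy
      refine ⟨c + d, add_nonneg hc hd, fun ζ κ hκ h => ?_⟩
      rw [map_add, map_add, LinearMap.add_apply, LinearMap.add_apply, add_sub_add_comm, add_mul]
      exact (norm_add_le _ _).trans (add_le_add (h1 ζ κ hκ h) (h2 ζ κ hκ h))
    | smul a x _ hx =>
      obtain ⟨c, hc, h1⟩ := hx
      refine ⟨‖a‖ * c, by positivity, fun ζ κ hκ h => ?_⟩
      rw [map_smul, map_smul, LinearMap.smul_apply, LinearMap.smul_apply, ← smul_sub, norm_smul,
        mul_assoc]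
      gcongr
      exact h1 ζ κ hκ h
  obtain ⟨c, hc, hspan⟩ := hspan
  have hr0 : 0 ≤ r := (norm_nonneg _).trans (hball ξ hξC)
  refine le_of_forall_pos_le_add fun κ hκ => ?_
  obtain ⟨e, he, hee⟩ : ∃ e : ℝ, 0 < e ∧ (c + 1) ^ 2 * (8 * m * e + 4 * e ^ 2) ≤ κ ^ 2 := by
    have ht : Tendsto (fun e : ℝ => (c + 1) ^ 2 * (8 * m * e + 4 * e ^ 2)) (𝓝[>] 0) (𝓝 0) := by
      have : Continuous fun e : ℝ => (c + 1) ^ 2 * (8 * m * e + 4 * e ^ 2) := by fun_prop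
      exact tendsto_nhdsWithin_of_tendsto_nhds (by simpa using this.tendsto 0)
    have hκ2 : 0 < κ ^ 2 := by positivity
    obtain ⟨e, he1, he2⟩ := ((ht.eventually (gt_mem_nhds hκ2)).and self_mem_nhdsWithin).exists
    exact ⟨e, he2, he1.le⟩
  obtain ⟨_, ⟨ζ, hζ, rfl⟩, hζm⟩ := exists_lt_of_csInf_lt (s := norm '' C) ⟨_, ξ, hξC, rfl⟩
    (show sInf (norm '' C) < m + e by rw [← hm]; linarith)
  have hfix : ∀ v ∈ G, ‖L v (R (star (v : A)) ζ) - ζ‖ ≤ κ / (c + 1) := by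
    intro v hv
    obtain ⟨ζ', hζ'⟩ : ∃ ζ', ζ' = L v (R (star (v : A)) ζ) := ⟨_, rfl⟩
    rw [← hζ']
    have h1 : ζ' ∈ C := hζ' ▸ hinv v hv ζ hζ
    have h2 : ‖ζ'‖ ≤ ‖ζ‖ := by
      rw [hζ']
      refine (hLn _ _).trans ((mul_le_of_le_one_left (norm_nonneg _) (norm_unitary_le_one v)).trans ?_)
      refine (hRn _ _).trans (mul_le_of_le_one_left (norm_nonneg _) ?_)
      rw [norm_star]
      exact norm_unitary_le_one v
    have h3 : 2 * m ≤ ‖ζ' + ζ‖ := by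
      have := hmle _ (hCc h1 hζ (show (0 : ℝ) ≤ 1 / 2 by norm_num) (show (0 : ℝ) ≤ 1 / 2 by norm_num)
        (by norm_num))
      rw [← smul_add, norm_smul] at this
      norm_num at this
      linarith
    have h4 := parallelogram_law_with_norm ℂ ζ' ζ
    rw [le_div_iff₀ (by positivity)]
    refine le_of_sq_le_sq ?_ hκ.le
    have h5 : ‖ζ' - ζ‖ ^ 2 ≤ 8 * m * e + 4 * e ^ 2 := by
      nlinarith [norm_nonneg ζ', norm_nonneg ζ]
    rw [mul_pow, mul_comm]
    exact (mul_le_mul_of_nonneg_left h5 (by positivity)).trans hee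
  have h6 := hspan ζ (κ / (c + 1)) (by positivity) hfix
  have h7 : c * (κ / (c + 1)) ≤ κ := by
    rw [mul_div_assoc', div_le_iff₀ (by positivity)]
    nlinarith
  have e : L x ξ - R x ξ = (L x ζ - R x ζ) - L x (ζ - ξ) + R x (ζ - ξ) := by
    rw [map_sub, map_sub]; abel
  rw [e]
  refine (norm_add_le _ _).trans ?_
  have h8 := norm_sub_le (L x ζ - R x ζ) (L x (ζ - ξ))
  have h9 : ‖L x (ζ - ξ)‖ ≤ ‖x‖ * r := (hLn _ _).trans (by gcongr; exact hball ζ hζ)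
  have h10 : ‖R x (ζ - ξ)‖ ≤ ‖x‖ * r := (hRn _ _).trans (by gcongr; exact hball ζ hζ)
  linarith

end Averaging

section Stinespring

open scoped ComplexConjugate

variable {A E F : Type*} [CStarAlgebra A] [NormedAddCommGroup E]
    [InnerProductSpace ℂ E] [CompleteSpace E] [NormedAddCommGroup F]
    [InnerProductSpace ℂ F] [CompleteSpace F]

/-- The sesquilinear form `⟪a ⊗ b, a' ⊗ b'⟫ = ⟪b b'⋆, φ (a⋆ a')⟫` on `A ⊗ A`. -/
def cpForm (h : A →ₗ[ℂ] E) (φ : E →ₗ[ℂ] E) : A ⊗[ℂ] A →ₗ⋆[ℂ] A ⊗[ℂ] A →ₗ[ℂ] ℂ :=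
  TensorProduct.lift <| LinearMap.mk₂'ₛₗ (starRingEnd ℂ) (starRingEnd ℂ)
    (fun a b => TensorProduct.lift <| LinearMap.mk₂ ℂ
      (fun a' b' => ⟪h (b * star b'), φ (h (star a * a'))⟫_ℂ)
      (fun x y z => by simp only [mul_add, map_add, inner_add_right])
      (fun c x z => by simp only [mul_smul_comm, map_smul, inner_smul_right, smul_eq_mul])
      (fun x y z => by simp only [star_add, mul_add, map_add, inner_add_left])
      (fun c x z => by
        simp only [star_smul, mul_smul_comm, map_smul, inner_smul_left, RCLike.star_def,
          RCLike.conj_conj, smul_eq_mul]))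
    (fun x y z => TensorProduct.ext' fun s t => by
      simp only [star_add, add_mul, map_add, inner_add_right, TensorProduct.lift.tmul,
        LinearMap.mk₂_apply, LinearMap.add_apply])
    (fun c x z => TensorProduct.ext' fun s t => by
      simp only [star_smul, smul_mul_assoc, map_smul, inner_smul_right, TensorProduct.lift.tmul,
        LinearMap.mk₂_apply, LinearMap.smul_apply, smul_eq_mul]
      rfl)
    (fun x y z => TensorProduct.ext' fun s t => by
      simp only [add_mul, map_add, inner_add_left, TensorProduct.lift.tmul,
        LinearMap.mk₂_apply, LinearMap.add_apply])
    (fun c x z => TensorProduct.ext' fun s t => by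
      simp only [smul_mul_assoc, map_smul, inner_smul_left, TensorProduct.lift.tmul,
        LinearMap.mk₂_apply, LinearMap.smul_apply, smul_eq_mul])

lemma cpForm_tmul (h : A →ₗ[ℂ] E) (φ : E →ₗ[ℂ] E) (a b a' b' : A) :
    cpForm h φ (a ⊗ₜ b) (a' ⊗ₜ b') = ⟪h (b * star b'), φ (h (star a * a'))⟫_ℂ := rfl

/-- Left multiplication on the first leg of `A ⊗ A`. -/
def outerLeft (A : Type*) [CStarAlgebra A] : A →ₗ[ℂ] A ⊗[ℂ] A →ₗ[ℂ] A ⊗[ℂ] A :=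
  LinearMap.rTensorHom A ∘ₗ LinearMap.mul ℂ A

/-- Right multiplication on the second leg of `A ⊗ A`. -/
def outerRight (A : Type*) [CStarAlgebra A] : A →ₗ[ℂ] A ⊗[ℂ] A →ₗ[ℂ] A ⊗[ℂ] A :=
  LinearMap.lTensorHom A ∘ₗ (LinearMap.mul ℂ A).flip

lemma outerLeft_tmul (x a b : A) : outerLeft A x (a ⊗ₜ b) = (x * a) ⊗ₜ b := rfl

lemma outerRight_tmul (x a b : A) : outerRight A x (a ⊗ₜ b) = a ⊗ₜ (b * x) := rfl

lemma outerLeft_one (s : A ⊗[ℂ] A) : outerLeft A 1 s = s := by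
  induction s with
  | zero => simp
  | add s s' hs hs' => simp only [map_add, hs, hs']
  | tmul a b => rw [outerLeft_tmul, one_mul]

lemma outerRight_one (s : A ⊗[ℂ] A) : outerRight A 1 s = s := by
  induction s with
  | zero => simp
  | add s s' hs hs' => simp only [map_add, hs, hs']
  | tmul a b => rw [outerRight_tmul, mul_one]

lemma conj_eq_of_im_self_eq_zero {V : Type*} [AddCommGroup V] [Module ℂ V]
    (B : V →ₗ⋆[ℂ] V →ₗ[ℂ] ℂ) (h : ∀ s, (B s s).im = 0) (s t : V) : conj (B t s) = B s t := by
  have h1 := h (s + t)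
  have h2 := h (s + Complex.I • t)
  simp only [map_add, LinearMap.add_apply, map_smul, LinearMap.map_smulₛₗ, LinearMap.smul_apply, smul_eq_mul,
    Complex.add_im, h, Complex.conj_I, Complex.mul_im, Complex.I_re, Complex.I_im,
    Complex.neg_re, Complex.neg_im, Complex.mul_re, Complex.add_re] at h1 h2
  apply Complex.ext
  · simp only [Complex.conj_re]; linarith
  · simp only [Complex.conj_im]; linarith

lemma cpForm_outerLeft (h : A →ₗ[ℂ] E) (φ : E →ₗ[ℂ] E) (x : A) (s t : A ⊗[ℂ] A) :
    cpForm h φ (outerLeft A x s) (outerLeft A x t) =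
      cpForm h φ s (outerLeft A (star x * x) t) := by
  induction s with
  | zero => simp
  | add s s' hs hs' => simp only [map_add, LinearMap.add_apply, hs, hs']
  | tmul a b =>
    induction t with
    | zero => simp
    | add t t' ht ht' => simp only [map_add, ht, ht']
    | tmul a' b' => simp only [outerLeft_tmul, cpForm_tmul, star_mul, mul_assoc]

lemma cpForm_outerRight (h : A →ₗ[ℂ] E) (φ : E →ₗ[ℂ] E) (x : A) (s t : A ⊗[ℂ] A) :
    cpForm h φ (outerRight A x s) (outerRight A x t) =
      cpForm h φ s (outerRight A (x * star x) t) := by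
  induction s with
  | zero => simp
  | add s s' hs hs' => simp only [map_add, LinearMap.add_apply, hs, hs']
  | tmul a b =>
    induction t with
    | zero => simp
    | add t t' ht ht' => simp only [map_add, ht, ht']
    | tmul a' b' => simp only [outerRight_tmul, cpForm_tmul, star_mul, star_star, mul_assoc]

lemma exists_star_mul_self_eq_norm_sq_sub (x : A) :
    ∃ c : A, star c * c = ((‖x‖ ^ 2 : ℝ) : ℂ) • (1 : A) - star x * x := by
  obtain ⟨c, hc⟩ := exists_star_mul_self_eq_add_smul_one (y := -(star x * x)) (κ := ‖x‖ ^ 2)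
    (IsSelfAdjoint.star_mul_self x).neg (fun t ht => by
      have ht' := (spectrum_subset_Icc_norm ht).1
      rw [norm_neg, CStarRing.norm_star_mul_self, ← sq] at ht'
      linarith)
  exact ⟨c, by rw [hc]; abel⟩

variable {h : A →ₗ[ℂ] E} {φ : E →ₗ[ℂ] E}

lemma cpForm_self_nonneg
    (hcp : ∀ (n : Finset (A × A)), 0 ≤ ∑ i : n, ∑ j : n,
      ⟪h (i.1.2 * star j.1.2), φ (h (star i.1.1 * j.1.1))⟫_ℂ) (s : A ⊗[ℂ] A) :
    0 ≤ cpForm h φ s s := by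
  obtain ⟨n, rfl⟩ := TensorProduct.exists_finset s
  refine (hcp n).trans_eq ?_
  simp only [map_sum, LinearMap.sum_apply, cpForm_tmul]
  rw [Finset.sum_comm, ← Finset.sum_coe_sort n]
  refine Finset.sum_congr rfl fun i _ => ?_
  rw [← Finset.sum_coe_sort n]

lemma re_cpForm_outerLeft_le (hpos : ∀ s, 0 ≤ cpForm h φ s s) (x : A) (s : A ⊗[ℂ] A) :
    (cpForm h φ (outerLeft A x s) (outerLeft A x s)).re ≤ ‖x‖ ^ 2 * (cpForm h φ s s).re := by
  obtain ⟨c, hc⟩ := exists_star_mul_self_eq_norm_sq_sub x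
  have h1 := (Complex.nonneg_iff.1 (hpos (outerLeft A c s))).1
  rw [cpForm_outerLeft, hc, map_sub, LinearMap.sub_apply, map_smul, LinearMap.smul_apply, map_sub, map_smul,
    ← cpForm_outerLeft, Complex.sub_re, smul_eq_mul, Complex.re_ofReal_mul] at h1
  rw [outerLeft_one] at h1
  linarith

lemma re_cpForm_outerRight_le (hpos : ∀ s, 0 ≤ cpForm h φ s s) (x : A) (s : A ⊗[ℂ] A) :
    (cpForm h φ (outerRight A x s) (outerRight A x s)).re ≤ ‖x‖ ^ 2 * (cpForm h φ s s).re := by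
  obtain ⟨c, hc⟩ := exists_star_mul_self_eq_norm_sq_sub (star x)
  rw [star_star, norm_star] at hc
  have h1 := (Complex.nonneg_iff.1 (hpos (outerRight A (star c) s))).1
  rw [cpForm_outerRight, star_star, hc, map_sub, LinearMap.sub_apply, map_smul, LinearMap.smul_apply, map_sub,
    map_smul, ← cpForm_outerRight, Complex.sub_re, smul_eq_mul, Complex.re_ofReal_mul] at h1
  rw [outerRight_one] at h1
  linarith

/-- A tracial completely positive map which almost fixes a group of unitaries almost fixes, uniformly
on bounded sets, the algebra spanned by the group. -/
lemma DerivationGraph.IsCore.re_inner_sub_resolvent_le {S : DerivationGraph A E F}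
    {Γ : Submodule ℂ (E × F)} (hS : S.IsCore Γ) {α : ℝ} (hα : 0 < α) (ρ : ResolventOp Γ α)
    (h1 : ‖S.hat 1‖ ≤ 1) (G : Subgroup (unitary A)) {ε : ℝ}
    (hG : ∀ v ∈ G, ‖S.hat v - ρ.φ (S.hat v)‖ ≤ ε) {x : A}
    (hx : x ∈ Submodule.span ℂ ((fun v : unitary A => (v : A)) '' (G : Set (unitary A)))) :
    (⟪S.hat x - ρ.φ (S.hat x), S.hat x⟫_ℂ).re ≤ 5 * ‖x‖ ^ 2 * ε := by
  have hpos : ∀ s, 0 ≤ cpForm S.hat ρ.φ s s := cpForm_self_nonneg fun n =>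
    hS.resolvent_completelyPositive hα ρ (fun i : n => i.1.1) (fun i : n => i.1.2)
  let core : PreInnerProductSpace.Core ℂ (A ⊗[ℂ] A) :=
    { inner := fun s t => cpForm S.hat ρ.φ s t
      conj_inner_symm := conj_eq_of_im_self_eq_zero _
        fun s => (Complex.nonneg_iff.1 (hpos s)).2.symm
      re_inner_nonneg := fun s => (Complex.nonneg_iff.1 (hpos s)).1
      add_left := fun s t r => by rw [map_add]; rfl
      smul_left := fun s t c => by rw [LinearMap.map_smulₛₗ]; rfl }
  let : SeminormedAddCommGroup (A ⊗[ℂ] A) :=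
    InnerProductSpace.Core.toSeminormedAddCommGroup (𝕜 := ℂ)
  let : InnerProductSpace ℂ (A ⊗[ℂ] A) := InnerProductSpace.ofCore core
  have hnorm : ∀ s : A ⊗[ℂ] A, ‖s‖ ^ 2 = (cpForm S.hat ρ.φ s s).re := fun s =>
    InnerProductSpace.norm_sq_eq_re_inner (𝕜 := ℂ) s
  have hsub : ∀ s t : A ⊗[ℂ] A, ‖s - t‖ ^ 2 = (cpForm S.hat ρ.φ s s).re -
      2 * (cpForm S.hat ρ.φ t s).re + (cpForm S.hat ρ.φ t t).re := fun s t => by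
    have := norm_sub_sq (𝕜 := ℂ) t s
    rw [norm_sub_rev, this, hnorm, hnorm]
    change _ - 2 * (cpForm S.hat ρ.φ t s).re + _ = _
    ring
  have hε : 0 ≤ ε := (norm_nonneg _).trans (hG 1 G.one_mem)
  have hiso : ∀ v : unitary A, ‖S.hat v‖ = ‖S.hat 1‖ := fun v => by
    have e : ⟪S.hat v, S.hat v⟫_ℂ = ⟪S.hat 1, S.hat 1⟫_ℂ := by
      rw [← mul_one (v : A), ← S.left_hat, ← ContinuousLinearMap.adjoint_inner_right,
        ← ContinuousLinearMap.star_eq_adjoint, ← map_star, S.left_hat, S.left_hat, ← mul_assoc,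
        Unitary.coe_star_mul_self, one_mul]
    rw [inner_self_eq_norm_sq_to_K, inner_self_eq_norm_sq_to_K] at e
    have e' : ‖S.hat v‖ ^ 2 = ‖S.hat 1‖ ^ 2 := by exact_mod_cast e
    exact (sq_eq_sq₀ (norm_nonneg _) (norm_nonneg _)).1 e'
  have key := norm_commutator_le_of_unitary_group (outerLeft A) (outerRight A)
    (fun x y s => by
      induction s with
      | zero => simp
      | add s s' hs hs' => simp only [map_add, hs, hs']
      | tmul a b => rfl)
    (fun x y s => by
      induction s with
      | zero => simp
      | add s s' hs hs' => simp only [map_add, hs, hs']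
      | tmul a b => simp only [outerLeft_tmul, mul_assoc])
    (fun x y s => by
      induction s with
      | zero => simp
      | add s s' hs hs' => simp only [map_add, hs, hs']
      | tmul a b => simp only [outerRight_tmul, mul_assoc])
    outerLeft_one outerRight_one
    (fun x s => by
      refine le_of_sq_le_sq ?_ (by positivity)
      rw [mul_pow, hnorm, hnorm]
      exact re_cpForm_outerLeft_le hpos x s)
    (fun x s => by
      refine le_of_sq_le_sq ?_ (by positivity)
      rw [mul_pow, hnorm, hnorm]
      exact re_cpForm_outerRight_le hpos x s)
    G ((1 : A) ⊗ₜ (1 : A)) (r := √(2 * ε))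
    (fun v hv => by
      refine Real.le_sqrt_of_sq_le ?_
      rw [hsub, outerRight_tmul, outerLeft_tmul, cpForm_tmul, cpForm_tmul, cpForm_tmul]
      simp only [one_mul, mul_one, star_star, star_one, Unitary.coe_star_mul_self]
      have e1 : (⟪S.hat 1, ρ.φ (S.hat 1)⟫_ℂ).re ≤ ‖S.hat v‖ ^ 2 := by
        refine (re_inner_le_norm_mul_norm _ _).trans ?_
        rw [hiso, sq]
        gcongr
        exact ρ.norm_le hα _
      have e2 : (⟪S.hat v, S.hat v - ρ.φ (S.hat v)⟫_ℂ).re ≤ ε := by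
        refine (re_inner_le_norm_mul_norm _ _).trans ?_
        rw [hiso]
        exact (mul_le_of_le_one_left (norm_nonneg _) h1).trans (hG v hv)
      have e3 : (⟪S.hat v, S.hat v⟫_ℂ).re = ‖S.hat v‖ ^ 2 := inner_self_eq_norm_sq (𝕜 := ℂ) _
      rw [inner_sub_right, Complex.sub_re, e3] at e2
      linarith)
    hx
  have key2 := pow_le_pow_left₀ (norm_nonneg _) key 2
  rw [hsub, outerRight_tmul, outerLeft_tmul, cpForm_tmul, cpForm_tmul, cpForm_tmul, mul_pow,
    Real.sq_sqrt (by positivity)] at key2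
  simp only [one_mul, mul_one, star_one] at key2
  have hL : ∀ y : A, ‖S.hat y‖ ≤ ‖y‖ := fun y =>
    (S.norm_hat_le y).trans (mul_le_of_le_one_right (norm_nonneg _) h1)
  have h1ε := hG 1 G.one_mem
  rw [OneMemClass.coe_one] at h1ε
  have a1 : ⟪S.hat 1, S.hat (star x * x)⟫_ℂ = ⟪S.hat x, S.hat x⟫_ℂ := by
    rw [← S.left_hat, map_star, ContinuousLinearMap.star_eq_adjoint,
      ContinuousLinearMap.adjoint_inner_right, S.left_hat, mul_one]
  have a2 : ⟪S.hat (x * star x), S.hat 1⟫_ℂ = ⟪S.hat x, S.hat x⟫_ℂ := by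
    rw [S.inner_hat_mul_star, map_one, one_apply_eq_self]
  have b1 : (⟪S.hat 1 - ρ.φ (S.hat 1), S.hat (star x * x)⟫_ℂ).re ≤ ‖x‖ ^ 2 * ε := by
    refine (re_inner_le_norm_mul_norm _ _).trans ?_
    rw [mul_comm]
    gcongr
    refine (hL _).trans_eq ?_
    rw [CStarRing.norm_star_mul_self, sq]
  have b2 : (⟪S.hat (x * star x), S.hat 1 - ρ.φ (S.hat 1)⟫_ℂ).re ≤ ‖x‖ ^ 2 * ε := by
    refine (re_inner_le_norm_mul_norm _ _).trans ?_
    gcongr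
    refine (hL _).trans_eq ?_
    rw [CStarRing.norm_self_mul_star, sq]
  rw [inner_sub_left, ρ.inner_symm hα, a1, Complex.sub_re] at b1
  rw [inner_sub_right, a2, Complex.sub_re] at b2
  rw [inner_sub_left, ρ.inner_symm hα, Complex.sub_re]
  linarith

end Stinespring

section Density

variable {K : Type u} [NormedAddCommGroup K] [InnerProductSpace ℂ K] [CompleteSpace K]

/-- An operator on `K ⊕ K ⊕ ⋯` whose matrix coefficients commute with `x` commutes with the
ampliation of `x`. -/
lemma commute_ampliation (P : lp (fun _ : ℕ => K) 2 →L[ℂ] lp (fun _ : ℕ => K) 2) (x : K →L[ℂ] K)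
    (h : ∀ m n k, (P (lp.single 2 n (x k))) m = x ((P (lp.single 2 n k)) m))
    (ζ : lp (fun _ : ℕ => K) 2) : P (ampliation K x ζ) = ampliation K x (P ζ) := by
  refine lp_dense_induction (P := fun ζ => P (ampliation K x ζ) = ampliation K x (P ζ))
    (isClosed_eq (by fun_prop) (by fun_prop)) (by simp)
    (fun ξ ζ h1 h2 => by simp only [map_add, h1, h2]) (fun n k => ?_) ζ
  ext m
  rw [ampliation_single, h, ampliation_apply]

/-- The density theorem for the double commutant of a nondegenerate `*`-algebra of operators. -/
theorem exists_ampliation_sub_le (D : Submodule ℂ (K →L[ℂ] K))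
    (hmul : ∀ a ∈ D, ∀ b ∈ D, a * b ∈ D) (hstar : ∀ a ∈ D, star a ∈ D)
    (hnd : ∀ ζ : K, (∀ a ∈ D, a ζ = 0) → ζ = 0) {x : K →L[ℂ] K}
    (hx : ∀ t : K →L[ℂ] K, (∀ a ∈ D, a * t = t * a) → x * t = t * x)
    (ξ : lp (fun _ : ℕ => K) 2) {κ : ℝ} (hκ : 0 < κ) :
    ∃ a ∈ D, ‖ampliation K (a - x) ξ‖ ≤ κ := by
  let ev : (K →L[ℂ] K) →ₗ[ℂ] lp (fun _ : ℕ => K) 2 :=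
    { toFun := fun T => ampliation K T ξ
      map_add' := fun S T => by simp
      map_smul' := fun c T => by simp }
  let V : Submodule ℂ (lp (fun _ : ℕ => K) 2) := (D.map ev).topologicalClosure
  have hVc : CompleteSpace V := (D.map ev).isClosed_topologicalClosure.completeSpace_coe
  have hinv : ∀ a ∈ D, ∀ ζ ∈ V, ampliation K a ζ ∈ V := by
    intro a ha ζ hζ
    have hmaps : Set.MapsTo (ampliation K a) (D.map ev) (D.map ev) := by
      rintro _ ⟨b, hb, rfl⟩
      refine ⟨a * b, hmul a ha b hb, ?_⟩
      change ampliation K (a * b) ξ = ampliation K a (ampliation K b ξ)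
      rw [map_mul]; rfl
    exact hmaps.closure (ampliation K a).continuous hζ
  have hcomm : ∀ a ∈ D, ∀ ζ, V.starProjection (ampliation K a ζ) =
      ampliation K a (V.starProjection ζ) := by
    intro a ha ζ
    refine V.eq_starProjection_of_mem_orthogonal (hinv a ha _ (V.starProjection_apply_mem ζ)) ?_
    rw [← map_sub, Submodule.mem_orthogonal]
    intro w hw
    rw [← ContinuousLinearMap.adjoint_inner_left, ← ContinuousLinearMap.star_eq_adjoint, ← map_star]
    exact Submodule.inner_right_of_mem_orthogonal (hinv _ (hstar a ha) w hw)
      (V.sub_starProjection_mem_orthogonal ζ)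
  have hxc : ∀ ζ, V.starProjection (ampliation K x ζ) = ampliation K x (V.starProjection ζ) := by
    refine commute_ampliation _ x fun m n k => ?_
    let t : K →L[ℂ] K := (lp.evalCLM ℂ (fun _ : ℕ => K) 2 m).comp
      (V.starProjection.comp (lp.singleContinuousLinearMap ℂ (fun _ : ℕ => K) 2 n))
    have := hx t (fun a ha => by
      ext k
      change a ((V.starProjection (lp.single 2 n k)) m) = (V.starProjection (lp.single 2 n (a k))) m
      rw [← ampliation_single, hcomm a ha, ampliation_apply])
    exact (DFunLike.congr_fun this k).symm
  have hξ : V.starProjection ξ = ξ := by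
    have h0 : ∀ a ∈ D, ampliation K a (ξ - V.starProjection ξ) = 0 := by
      intro a ha
      rw [map_sub, ← hcomm a ha, sub_eq_zero]
      symm
      rw [Submodule.starProjection_eq_self_iff]
      exact subset_closure ⟨a, ha, rfl⟩
    have : ξ - V.starProjection ξ = 0 := by
      ext n
      refine hnd _ fun a ha => ?_
      rw [← ampliation_apply, h0 a ha]
      rfl
    exact (sub_eq_zero.1 this).symm
  have hmem : ampliation K x ξ ∈ V := by
    rw [← Submodule.starProjection_eq_self_iff, hxc, hξ]
  obtain ⟨_, ⟨a, ha, rfl⟩, hd⟩ := Metric.mem_closure_iff.1 hmem κ hκ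
  refine ⟨a, ha, ?_⟩
  rw [map_sub, sub_apply, ← dist_eq_norm, dist_comm]
  exact hd.le

variable {N : VonNeumannAlgebra K} (τ : FaithfulNormalTrace N)

lemma exists_vector_inner_hat :
    ∃ ξ : lp (fun _ : ℕ => K) 2, ∀ x y : N.toStarSubalgebra,
      ⟪hat τ x, hat τ y⟫_ℂ = ⟪ampliation K (x : K →L[ℂ] K) ξ, ampliation K (y : K →L[ℂ] K) ξ⟫_ℂ := by
  obtain ⟨ξ, hξ⟩ := τ.normal
  have hinner : ∀ x y : N.toStarSubalgebra,
      HasSum (fun n => ⟪(x : K →L[ℂ] K) (ξ n), (y : K →L[ℂ] K) (ξ n)⟫_ℂ)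
        ⟪hat τ x, hat τ y⟫_ℂ := by
    intro x y
    have := hξ (star x * y)
    rw [← inner_hat] at this
    refine Eq.mp (congrArg (HasSum · _) (funext fun n => ?_)) this
    change ⟪ξ n, (star (x : K →L[ℂ] K)) ((y : K →L[ℂ] K) (ξ n))⟫_ℂ = _
    rw [ContinuousLinearMap.star_eq_adjoint, ContinuousLinearMap.adjoint_inner_right]
  have hmem : Memℓp ξ 2 := by
    refine memℓp_gen ?_
    have := (Complex.hasSum_re (hinner 1 1)).summable
    refine this.congr fun n => ?_
    change (⟪ξ n, ξ n⟫_ℂ).re = _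
    rw [show (⟪ξ n, ξ n⟫_ℂ).re = ‖ξ n‖ ^ 2 from inner_self_eq_norm_sq (𝕜 := ℂ) _]
    simp
  exact ⟨⟨ξ, hmem⟩, fun x y => (hinner x y).unique (lp.hasSum_inner
    (ampliation K (x : K →L[ℂ] K) ⟨ξ, hmem⟩) (ampliation K (y : K →L[ℂ] K) ⟨ξ, hmem⟩))⟩

/-- `2`-norm density of a nondegenerate `*`-algebra in its double commutant. -/
lemma exists_norm_hat_sub_le (D : Submodule ℂ N.toStarSubalgebra)
    (hmul : ∀ a ∈ D, ∀ b ∈ D, a * b ∈ D) (hstar : ∀ a ∈ D, star a ∈ D)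
    (hnd : ∀ ζ : K, (∀ a ∈ D, (a : K →L[ℂ] K) ζ = 0) → ζ = 0) {x : N.toStarSubalgebra}
    (hx : ∀ t : K →L[ℂ] K, (∀ a ∈ D, (a : K →L[ℂ] K) * t = t * a) → (x : K →L[ℂ] K) * t = t * x)
    {κ : ℝ} (hκ : 0 < κ) : ∃ a ∈ D, ‖hat τ (a - x)‖ ≤ κ := by
  obtain ⟨ξ, hξ⟩ := exists_vector_inner_hat τ
  obtain ⟨_, ⟨a, ha, rfl⟩, h⟩ := exists_ampliation_sub_le
    (D.map (N.toStarSubalgebra.subtype.toAlgHom.toLinearMap))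
    (by rintro _ ⟨a, ha, rfl⟩ _ ⟨b, hb, rfl⟩; exact ⟨a * b, hmul a ha b hb, rfl⟩)
    (by rintro _ ⟨a, ha, rfl⟩; exact ⟨star a, hstar a ha, rfl⟩)
    (fun ζ h => hnd ζ fun a ha => h _ ⟨a, ha, rfl⟩) (x := x)
    (fun t ht => hx t fun a ha => ht _ ⟨a, ha, rfl⟩) ξ hκ
  refine ⟨a, ha, le_trans (le_of_eq ?_) h⟩
  refine (sq_eq_sq₀ (norm_nonneg _) (norm_nonneg _)).1 ?_
  have h2 := hξ (a - x) (a - x)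
  rw [inner_self_eq_norm_sq_to_K, inner_self_eq_norm_sq_to_K] at h2
  exact_mod_cast h2

lemma CoarseDerivation.dense_domain {τ : FaithfulNormalTrace N} (δ : CoarseDerivation τ) :
    Dense (δ.toPMap.domain : Set (L2 τ)) := by
  have key : ∀ x : N.toStarSubalgebra, hat τ x ∈ closure (δ.toPMap.domain : Set (L2 τ)) := by
    intro x
    refine Metric.mem_closure_iff.2 fun κ hκ => ?_
    have hnd : ∀ ζ : K, (∀ a ∈ δ.dom, (a : K →L[ℂ] K) ζ = 0) → ζ = 0 := by
      intro ζ h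
      have hcl : IsClosed {T : K →WOT[ℂ] K | ⟪ζ, T ζ⟫_ℂ = 0} :=
        isClosed_eq (ContinuousLinearMapWOT.continuous_inner_apply continuous_id _ _) continuous_const
      have : ContinuousLinearMapWOT.ofCLM ((1 : N.toStarSubalgebra) : K →L[ℂ] K) ∈
          {T : K →WOT[ℂ] K | ⟪ζ, T ζ⟫_ℂ = 0} := by
        refine closure_minimal ?_ hcl (δ.dense 1)
        rintro _ ⟨a, ha, rfl⟩
        change ⟪ζ, (a : K →L[ℂ] K) ζ⟫_ℂ = 0
        rw [h a ha, inner_zero_right]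
      exact (inner_self_eq_zero (𝕜 := ℂ)).1 this
    have hc : ∀ t : K →L[ℂ] K, (∀ a ∈ δ.dom, (a : K →L[ℂ] K) * t = t * a) →
        (x : K →L[ℂ] K) * t = t * x := by
      intro t ht
      ext k
      refine ext_inner_left ℂ fun w => ?_
      have hcl : IsClosed {T : K →WOT[ℂ] K | ⟪w, T (t k)⟫_ℂ = ⟪star t w, T k⟫_ℂ} :=
        isClosed_eq (ContinuousLinearMapWOT.continuous_inner_apply continuous_id _ _)
          (ContinuousLinearMapWOT.continuous_inner_apply continuous_id _ _)
      have : ContinuousLinearMapWOT.ofCLM (x : K →L[ℂ] K) ∈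
          {T : K →WOT[ℂ] K | ⟪w, T (t k)⟫_ℂ = ⟪star t w, T k⟫_ℂ} := by
        refine closure_minimal ?_ hcl (δ.dense x)
        rintro _ ⟨a, ha, rfl⟩
        change ⟪w, (a : K →L[ℂ] K) (t k)⟫_ℂ = ⟪star t w, (a : K →L[ℂ] K) k⟫_ℂ
        rw [ContinuousLinearMap.star_eq_adjoint, ContinuousLinearMap.adjoint_inner_left]
        exact congrArg _ (DFunLike.congr_fun (ht a ha) k)
      have h2 : ⟪w, (x : K →L[ℂ] K) (t k)⟫_ℂ = ⟪star t w, (x : K →L[ℂ] K) k⟫_ℂ := this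
      rwa [ContinuousLinearMap.star_eq_adjoint, ContinuousLinearMap.adjoint_inner_left] at h2
    obtain ⟨a, ha, h⟩ := exists_norm_hat_sub_le τ δ.dom.toNonUnitalSubalgebra.toSubmodule
      (fun a ha b hb => δ.dom.mul_mem ha hb)
      (fun a (ha : a ∈ δ.dom) => star_mem (S := NonUnitalStarSubalgebra ℂ N.toStarSubalgebra) ha)
      hnd hc (half_pos hκ)
    refine ⟨hat τ a, ⟨a, ha, rfl⟩, ?_⟩
    rw [dist_comm, dist_eq_norm, ← map_sub]
    linarith
  refine dense_closure.1 ((denseRange_hat τ).mono ?_)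
  rintro _ ⟨x, rfl⟩
  exact key x

end Density

section BoundedApproximation

lemma norm_le_of_spectrum_subset_Icc {A : Type*} [CStarAlgebra A] {y : A} (hy : IsSelfAdjoint y)
    {r : ℝ} (hr : 0 ≤ r) (h : spectrum ℝ y ⊆ Set.Icc (-r) r) : ‖y‖ ≤ r := by
  rw [← cfc_id' ℝ y hy]
  exact norm_cfc_le hr fun t ht => abs_le.2 (h ht)

lemma norm_hat_star {K : Type u} [NormedAddCommGroup K] [InnerProductSpace ℂ K] [CompleteSpace K]
    {N : VonNeumannAlgebra K} (τ : FaithfulNormalTrace N) (a : N.toStarSubalgebra) :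
    ‖hat τ (star a)‖ = ‖hat τ a‖ := by
  refine (sq_eq_sq₀ (norm_nonneg _) (norm_nonneg _)).1 ?_
  have h1 := norm_gnsHat_sq τ.toLinearMap τ.nonneg (star a)
  have h2 := norm_gnsHat_sq τ.toLinearMap τ.nonneg a
  rw [star_star, τ.map_mul_comm, ← h2] at h1
  exact_mod_cast h1

variable {K : Type u} [NormedAddCommGroup K] [InnerProductSpace ℂ K] [CompleteSpace K]
variable {N : VonNeumannAlgebra K} (τ : FaithfulNormalTrace N)

/-- The zero derivation on a `*`-subalgebra. -/
def zeroDerivationGraph (D : Submodule ℂ N.toStarSubalgebra)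
    (hmul : ∀ a ∈ D, ∀ b ∈ D, a * b ∈ D) (hstar : ∀ a ∈ D, star a ∈ D) :
    DerivationGraph N.toStarSubalgebra (L2 τ) (L2 τ) where
  std := stdBimodule τ
  hat := hat τ
  left_hat := stdBimodule_left_hat τ
  right_hat := stdBimodule_right_hat τ
  norm_hat_star := norm_hat_star τ
  bim := stdBimodule τ
  graph := D.prod ⊥
  leibniz := by
    rintro a b ξ η ⟨ha, hξ⟩ ⟨hb, hη⟩
    rw [SetLike.mem_coe, Submodule.mem_bot] at hξ hη
    dsimp only at hξ hη
    subst hξ hη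
    exact ⟨hmul a ha b hb, by simp⟩
  star_mem := by
    rintro a ξ ⟨ha, hξ⟩
    exact ⟨ξ, ⟨hstar a ha, hξ⟩, le_rfl⟩

/-- A weak form of Kaplansky's density theorem. -/
lemma exists_bounded_approx_selfAdjoint (D : Submodule ℂ N.toStarSubalgebra)
    (hmul : ∀ a ∈ D, ∀ b ∈ D, a * b ∈ D) (hstar : ∀ a ∈ D, star a ∈ D)
    {x : N.toStarSubalgebra} (hx : IsSelfAdjoint x) (hx1 : ‖x‖ ≤ 1)
    (hcl : ∀ κ > 0, ∃ a ∈ D, ‖hat τ (a - x)‖ ≤ κ) {κ : ℝ} (hκ : 0 < κ) :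
    ∃ a ∈ D, IsSelfAdjoint a ∧ ‖a‖ ≤ 2 ∧ ‖hat τ (a - x)‖ ≤ κ := by
  obtain ⟨a, ha, h⟩ := hcl (κ / 2) (half_pos hκ)
  obtain ⟨e, he, he1, heκ⟩ : ∃ e : ℝ, 0 < e ∧ e ≤ 1 ∧ e ≤ κ / 2 :=
    ⟨min 1 (κ / 2), lt_min one_pos (half_pos hκ), min_le_left _ _, min_le_right _ _⟩
  obtain ⟨y, ξ, hy, hsa, hspec, hnear, -⟩ := (zeroDerivationGraph τ D hmul hstar).exists_truncation
    hx (c := -1) (d := 1) (by norm_num) (by norm_num)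
    (spectrum_subset_Icc_norm.trans (Set.Icc_subset_Icc (by linarith) hx1))
    (y := a) (ξ := 0) ⟨ha, Submodule.zero_mem _⟩ he
  refine ⟨y, hy.1, hsa, norm_le_of_spectrum_subset_Icc hsa (by norm_num)
    (hspec.trans (Set.Icc_subset_Icc (by linarith) (by linarith))), ?_⟩
  change ‖hat τ (x - y)‖ ≤ ‖hat τ (x - a)‖ + e at hnear
  rw [map_sub, norm_sub_rev, ← map_sub, map_sub _ x a, norm_sub_rev, ← map_sub] at hnear
  linarith

lemma exists_bounded_approx (D : Submodule ℂ N.toStarSubalgebra)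
    (hmul : ∀ a ∈ D, ∀ b ∈ D, a * b ∈ D) (hstar : ∀ a ∈ D, star a ∈ D)
    {x : N.toStarSubalgebra} (hx1 : ‖x‖ ≤ 1)
    (hcl : ∀ κ > 0, ∃ a ∈ D, ‖hat τ (a - x)‖ ≤ κ) {κ : ℝ} (hκ : 0 < κ) :
    ∃ a ∈ D, ‖a‖ ≤ 4 ∧ ‖hat τ (a - x)‖ ≤ κ := by
  have half : ∀ c : ℂ, ‖c‖ ≤ 1 → ∀ κ > 0, ∃ a ∈ D, IsSelfAdjoint a ∧ ‖a‖ ≤ 2 ∧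
      ‖hat τ (a - (1 / 2 : ℂ) • (c • x + star (c • x)))‖ ≤ κ := by
    intro c hc κ hκ
    have hcx : ‖c • x‖ ≤ 1 := by
      rw [norm_smul]
      exact mul_le_one₀ hc (norm_nonneg _) hx1
    refine exists_bounded_approx_selfAdjoint τ D hmul hstar ?_ ?_ (fun κ hκ => ?_) hκ
    · rw [IsSelfAdjoint, star_smul, star_add, star_star, add_comm]
      norm_num
    · rw [norm_smul]
      have := norm_add_le (c • x) (star (c • x))
      rw [norm_star] at this
      rw [show ‖(1 / 2 : ℂ)‖ = 1 / 2 by norm_num]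
      linarith
    · obtain ⟨a, ha, h⟩ := hcl κ hκ
      refine ⟨(1 / 2 : ℂ) • (c • a + star (c • a)),
        D.smul_mem _ (D.add_mem (D.smul_mem _ ha) (hstar _ (D.smul_mem _ ha))), ?_⟩
      have e : (1 / 2 : ℂ) • (c • a + star (c • a)) - (1 / 2 : ℂ) • (c • x + star (c • x)) =
          (1 / 2 : ℂ) • (c • (a - x) + star (c • (a - x))) := by
        rw [smul_sub, star_sub, ← smul_sub]; congr 1; abel
      rw [e, map_smul, map_add, norm_smul]
      have h1 := norm_add_le (hat τ (c • (a - x))) (hat τ (star (c • (a - x))))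
      rw [norm_hat_star, map_smul, norm_smul] at h1
      have h2 : ‖c‖ * ‖hat τ (a - x)‖ ≤ κ :=
        (mul_le_of_le_one_left (norm_nonneg _) hc).trans h
      rw [map_smul]
      rw [show ‖(1 / 2 : ℂ)‖ = 1 / 2 by norm_num]
      linarith
  obtain ⟨a, ha, -, ha2, hax⟩ := half 1 (by simp) (κ / 2) (half_pos hκ)
  obtain ⟨b, hb, -, hb2, hbx⟩ := half (-Complex.I) (by simp) (κ / 2) (half_pos hκ)
  refine ⟨a + Complex.I • b, D.add_mem ha (D.smul_mem _ hb), ?_, ?_⟩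
  · refine (norm_add_le _ _).trans ?_
    rw [norm_smul, Complex.norm_I]
    linarith
  · have e : a + Complex.I • b - x = (a - (1 / 2 : ℂ) • ((1 : ℂ) • x + star ((1 : ℂ) • x))) +
        Complex.I • (b - (1 / 2 : ℂ) • (-Complex.I • x + star (-Complex.I • x))) := by
      simp only [smul_sub, smul_add, star_smul, smul_smul, star_neg, RCLike.star_def,
        Complex.conj_I, neg_neg, one_smul]
      ring_nf
      simp only [Complex.I_sq]
      have : x = (1 / 2 : ℂ) • x + (1 / 2 : ℂ) • x := by rw [← add_smul]; norm_num
      rw [this]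
      module
    rw [e, map_add, map_smul]
    refine (norm_add_le _ _).trans ?_
    rw [norm_smul, Complex.norm_I]
    linarith

end BoundedApproximation

section Mixing

lemma StarBimodule.norm_left_apply_le {A H : Type*} [CStarAlgebra A] [NormedAddCommGroup H]
    [InnerProductSpace ℂ H] [CompleteSpace H] (B : StarBimodule A H) (a : A) (ξ : H) :
    ‖B.left a ξ‖ ≤ ‖a‖ * ‖ξ‖ :=
  (ContinuousLinearMap.le_opNorm _ _).trans
    (mul_le_mul_of_nonneg_right (NonUnitalStarAlgHom.norm_apply_le _ _) (norm_nonneg _))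

lemma StarBimodule.norm_right_apply_le {A H : Type*} [CStarAlgebra A] [NormedAddCommGroup H]
    [InnerProductSpace ℂ H] [CompleteSpace H] (B : StarBimodule A H) (a : A) (ξ : H) :
    ‖B.right a ξ‖ ≤ ‖a‖ * ‖ξ‖ := by
  have hpos : ∀ c : A, (⟪ξ, B.right (star c * c) ξ⟫_ℂ).re = ‖B.right (star c) ξ‖ ^ 2 := by
    intro c
    rw [B.right_mul, mul_apply_eq_comp, ← star_star c, B.right_star (star c), star_star,
      ContinuousLinearMap.star_eq_adjoint, ContinuousLinearMap.adjoint_inner_right]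
    exact inner_self_eq_norm_sq (𝕜 := ℂ) _
  obtain ⟨c, hc⟩ := exists_star_mul_self_eq_norm_sq_sub (star a)
  have h1 := hpos (star a)
  have h2 := hpos c
  rw [hc, map_sub, sub_apply, inner_sub_right, Complex.sub_re, h1, map_smul,
    smul_apply, inner_smul_right, Complex.re_ofReal_mul, B.right_one, one_apply_eq_self, norm_star,
    star_star] at h2
  have h3 : (⟪ξ, ξ⟫_ℂ).re = ‖ξ‖ ^ 2 := inner_self_eq_norm_sq (𝕜 := ℂ) _
  refine le_of_sq_le_sq ?_ (by positivity)
  rw [mul_pow, ← h3]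
  nlinarith [sq_nonneg ‖B.right (star c) ξ‖]

lemma isClosed_setOf_tendsto_zero {ι E G : Type*} [SeminormedAddCommGroup E]
    [SeminormedAddCommGroup G] {l : Filter ι} {f : ι → E → G} {C : ℝ} (h : ∀ i x y, ‖f i x - f i y‖ ≤ C * ‖x - y‖) :
    IsClosed {x | Tendsto (fun i => f i x) l (𝓝 0)} := by
  refine isClosed_of_closure_subset fun x hx => ?_
  rw [Set.mem_ofPred_eq, Metric.tendsto_nhds]
  intro ε hε
  obtain ⟨y, hy, hxy⟩ := Metric.mem_closure_iff.1 hx (ε / (2 * (|C| + 1))) (by positivity)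
  filter_upwards [Metric.tendsto_nhds.1 hy (ε / 2) (half_pos hε)] with i hi
  rw [dist_zero_right] at hi ⊢
  rw [dist_eq_norm, lt_div_iff₀ (by positivity)] at hxy
  have h1 := h i x y
  have h2 := norm_add_le (f i x - f i y) (f i y)
  rw [sub_add_cancel] at h2
  have h3 : C * ‖x - y‖ ≤ (|C| + 1) * ‖x - y‖ := by
    gcongr
    exact (le_abs_self C).trans (by linarith)
  nlinarith

lemma StarBimodule.norm_left_right_le {A H : Type*} [CStarAlgebra A] [NormedAddCommGroup H]
    [InnerProductSpace ℂ H] [CompleteSpace H] (B : StarBimodule A H) {C : ℝ} {a b : A}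
    (ha : ‖a‖ ≤ C) (hb : ‖b‖ ≤ C) (ξ : H) : ‖B.left a (B.right b ξ)‖ ≤ C * (C * ‖ξ‖) :=
  (B.norm_left_apply_le _ _).trans <|
    mul_le_mul ha ((B.norm_right_apply_le _ _).trans (by gcongr)) (norm_nonneg _)
      ((norm_nonneg _).trans ha)

lemma StarBimodule.inner_left {A H : Type*} [CStarAlgebra A] [NormedAddCommGroup H]
    [InnerProductSpace ℂ H] [CompleteSpace H] (B : StarBimodule A H) (a : A) (ξ ζ : H) :
    ⟪ξ, B.left a ζ⟫_ℂ = ⟪B.left (star a) ξ, ζ⟫_ℂ := by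
  rw [map_star, ContinuousLinearMap.star_eq_adjoint, ContinuousLinearMap.adjoint_inner_left]

lemma StarBimodule.inner_right {A H : Type*} [CStarAlgebra A] [NormedAddCommGroup H]
    [InnerProductSpace ℂ H] [CompleteSpace H] (B : StarBimodule A H) (a : A) (ξ ζ : H) :
    ⟪ξ, B.right a ζ⟫_ℂ = ⟪B.right (star a) ξ, ζ⟫_ℂ := by
  rw [B.right_star, ContinuousLinearMap.star_eq_adjoint, ContinuousLinearMap.adjoint_inner_left]

variable {ι : Type*} {l : Filter ι}

/-- Mixing passes to countable direct sums of a bimodule. -/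
lemma StarBimodule.tendsto_inner_ampliate {A H : Type*} [CStarAlgebra A] [NormedAddCommGroup H]
    [InnerProductSpace ℂ H] [CompleteSpace H] (B : StarBimodule A H) {a b : ι → A} {C : ℝ}
    (ha : ∀ i, ‖a i‖ ≤ C) (hb : ∀ i, ‖b i‖ ≤ C)
    (h : ∀ ψ₁ ψ₂, Tendsto (fun i => ⟪ψ₁, B.left (a i) (B.right (b i) ψ₂)⟫_ℂ) l (𝓝 0))
    (ψ₁ ψ₂ : lp (fun _ : ℕ => H) 2) :
    Tendsto (fun i => ⟪ψ₁, B.ampliate.left (a i) (B.ampliate.right (b i) ψ₂)⟫_ℂ) l (𝓝 0) := by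
  refine lp_dense_induction (P := fun ψ₁ => Tendsto (fun i =>
    ⟪ψ₁, B.ampliate.left (a i) (B.ampliate.right (b i) ψ₂)⟫_ℂ) l (𝓝 0))
    (isClosed_setOf_tendsto_zero (C := C * (C * ‖ψ₂‖)) fun i x y => ?_)
    (by simp only [inner_zero_left]; exact tendsto_const_nhds)
    (fun x y hx hy => by simpa only [inner_add_left, add_zero] using hx.add hy) (fun m ψ₁ => ?_) ψ₁
  · rw [← inner_sub_left, mul_comm]
    exact (norm_inner_le_norm _ _).trans
      (mul_le_mul_of_nonneg_left (B.ampliate.norm_left_right_le (ha i) (hb i) ψ₂) (norm_nonneg _))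
  refine (h ψ₁ (ψ₂ m)).congr fun i => ?_
  rw [lp.inner_single_left]
  rfl

/-- Mixing of the tensor square of a bimodule. -/
lemma StarBimodule.tendsto_inner_tensor {A H : Type*} [CStarAlgebra A] [NormedAddCommGroup H]
    [InnerProductSpace ℂ H] [CompleteSpace H] (B : StarBimodule A H) {a b : ι → A} {C : ℝ}
    (ha : ∀ i, ‖a i‖ ≤ C) (hb : ∀ i, ‖b i‖ ≤ C)
    (h : ∀ s t x y, Tendsto (fun i => ⟪s, B.left (a i) x⟫_ℂ * ⟪t, B.right (b i) y⟫_ℂ) l (𝓝 0))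
    (ψ₁ ψ₂ : HilbertTensor H H) :
    Tendsto (fun i => ⟪ψ₁, B.tensor.left (a i) (B.tensor.right (b i) ψ₂)⟫_ℂ) l (𝓝 0) := by
  refine htmul_dense_induction (P := fun ψ₂ => Tendsto (fun i =>
    ⟪ψ₁, B.tensor.left (a i) (B.tensor.right (b i) ψ₂)⟫_ℂ) l (𝓝 0))
    (isClosed_setOf_tendsto_zero (C := ‖ψ₁‖ * (C * C)) fun i x y => ?_)
    (by simp only [map_zero, inner_zero_right]; exact tendsto_const_nhds)
    (fun x y hx hy => by simpa only [map_add, inner_add_right, add_zero] using hx.add hy)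
    (fun x y => ?_) ψ₂
  · rw [← inner_sub_right, ← map_sub, ← map_sub, mul_assoc, mul_assoc]
    exact (norm_inner_le_norm _ _).trans
      (mul_le_mul_of_nonneg_left (B.tensor.norm_left_right_le (ha i) (hb i) _) (norm_nonneg _))
  refine htmul_dense_induction (P := fun ψ₁ => Tendsto (fun i =>
    ⟪ψ₁, B.tensor.left (a i) (B.tensor.right (b i) (htmul x y))⟫_ℂ) l (𝓝 0))
    (isClosed_setOf_tendsto_zero (C := C * (C * ‖htmul x y‖)) fun i s t => ?_)
    (by simp only [inner_zero_left]; exact tendsto_const_nhds)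
    (fun x y hx hy => by simpa only [inner_add_left, add_zero] using hx.add hy)
    (fun s t => ?_) ψ₁
  · rw [← inner_sub_left, mul_comm]
    exact (norm_inner_le_norm _ _).trans
      (mul_le_mul_of_nonneg_left (B.tensor.norm_left_right_le (ha i) (hb i) _) (norm_nonneg _))
  refine (h s t x y).congr fun i => ?_
  rw [← inner_htmul]
  change _ = ⟪htmul s t, tensorLeft (B.left (a i)) (tensorRight (B.right (b i)) (htmul x y))⟫_ℂ
  rw [tensorRight_htmul, tensorLeft_htmul]

variable {K : Type u} [NormedAddCommGroup K] [InnerProductSpace ℂ K] [CompleteSpace K]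
variable {N : VonNeumannAlgebra K} (τ : FaithfulNormalTrace N)

lemma tendsto_inner_std {a b : ι → N.toStarSubalgebra} {C : ℝ}
    (ha : ∀ i, ‖a i‖ ≤ C) (hb : ∀ i, ‖b i‖ ≤ C)
    (hab : ∀ s t, Tendsto (fun i => ⟪s, hat τ (a i)⟫_ℂ * ⟪t, hat τ (b i)⟫_ℂ) l (𝓝 0))
    (s t x y : L2 τ) : Tendsto (fun i => ⟪s, (stdBimodule τ).left (a i) x⟫_ℂ *
      ⟪t, (stdBimodule τ).right (b i) y⟫_ℂ) l (𝓝 0) := by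
  rcases isEmpty_or_nonempty ι with hι | ⟨⟨i₀⟩⟩
  · rw [filter_eq_bot_of_isEmpty l]
    exact tendsto_bot
  have hC : 0 ≤ C := (norm_nonneg _).trans (ha i₀)
  have hx : ∀ i x, ‖⟪s, (stdBimodule τ).left (a i) x⟫_ℂ‖ ≤ ‖s‖ * (C * ‖x‖) := fun i x =>
    (norm_inner_le_norm _ _).trans (by
      gcongr
      exact ((stdBimodule τ).norm_left_apply_le _ _).trans (by gcongr; exact ha i))
  have hy : ∀ i y, ‖⟪t, (stdBimodule τ).right (b i) y⟫_ℂ‖ ≤ ‖t‖ * (C * ‖y‖) := fun i y =>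
    (norm_inner_le_norm _ _).trans (by
      gcongr
      exact ((stdBimodule τ).norm_right_apply_le _ _).trans (by gcongr; exact hb i))
  refine (denseRange_hat τ).induction_on (p := fun x => Tendsto (fun i =>
    ⟪s, (stdBimodule τ).left (a i) x⟫_ℂ * ⟪t, (stdBimodule τ).right (b i) y⟫_ℂ) l (𝓝 0)) x
    (isClosed_setOf_tendsto_zero (C := ‖s‖ * C * (‖t‖ * (C * ‖y‖))) fun i x x' => ?_) fun x => ?_
  · rw [← sub_mul, ← inner_sub_right, ← map_sub, norm_mul]
    refine (mul_le_mul (hx i _) (hy i y) (norm_nonneg _) (by positivity)).trans_eq ?_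
    ring
  refine (denseRange_hat τ).induction_on (p := fun y => Tendsto (fun i =>
    ⟪s, (stdBimodule τ).left (a i) (hat τ x)⟫_ℂ * ⟪t, (stdBimodule τ).right (b i) y⟫_ℂ) l (𝓝 0)) y
    (isClosed_setOf_tendsto_zero (C := ‖s‖ * (C * ‖hat τ x‖) * (‖t‖ * C)) fun i y y' => ?_)
    fun y => ?_
  · rw [← mul_sub, ← inner_sub_right, ← map_sub, norm_mul]
    refine (mul_le_mul (hx i _) (hy i _) (norm_nonneg _) (by positivity)).trans_eq ?_
    ring
  refine (hab ((stdBimodule τ).right (star x) s) ((stdBimodule τ).left (star y) t)).congr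
    fun i => ?_
  rw [← StarBimodule.inner_right, ← StarBimodule.inner_left,
    stdBimodule_left_hat, stdBimodule_right_hat, stdBimodule_left_hat, stdBimodule_right_hat]

/-- Matrix coefficients of the coarse bimodule vanish along bounded nets `a i`, `b i` one of which
tends weakly to zero in `L²`. -/
lemma tendsto_inner_coarse {a b : ι → N.toStarSubalgebra} {C : ℝ}
    (ha : ∀ i, ‖a i‖ ≤ C) (hb : ∀ i, ‖b i‖ ≤ C)
    (hab : ∀ s t, Tendsto (fun i => ⟪s, hat τ (a i)⟫_ℂ * ⟪t, hat τ (b i)⟫_ℂ) l (𝓝 0))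
    (ψ₁ ψ₂ : Coarse τ) :
    Tendsto (fun i => ⟪ψ₁, (coarseBimodule τ).left (a i) ((coarseBimodule τ).right (b i) ψ₂)⟫_ℂ)
      l (𝓝 0) :=
  (stdBimodule τ).tensor.tendsto_inner_ampliate ha hb
    ((stdBimodule τ).tendsto_inner_tensor ha hb (tendsto_inner_std τ ha hb hab)) ψ₁ ψ₂

end Mixing

section Reality

variable {K : Type u} [NormedAddCommGroup K] [InnerProductSpace ℂ K] [CompleteSpace K]
variable {N : VonNeumannAlgebra K} {τ : FaithfulNormalTrace N}

lemma norm_one_le_one {A : Type*} [CStarAlgebra A] : ‖(1 : A)‖ ≤ 1 := by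
  simpa using norm_unitary_le_one (1 : unitary A)

lemma CoarseDerivation.exists_norm_hat_sub_le (δ : CoarseDerivation τ) (x : N.toStarSubalgebra)
    {κ : ℝ} (hκ : 0 < κ) : ∃ a ∈ δ.dom, ‖hat τ (a - x)‖ ≤ κ := by
  obtain ⟨_, ⟨a, ha, rfl⟩, h⟩ := Metric.mem_closure_iff.1 (δ.dense_domain (hat τ x)) κ hκ
  refine ⟨a, ha, ?_⟩
  rw [map_sub, ← dist_eq_norm, dist_comm]
  exact h.le

lemma CoarseDerivation.exists_bounded_approx_one (δ : CoarseDerivation τ) :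
    ∃ y : ℕ → δ.dom, (∀ n, ‖(y n : N.toStarSubalgebra)‖ ≤ 2) ∧
      (∀ n, IsSelfAdjoint (y n : N.toStarSubalgebra)) ∧
      Tendsto (fun n => hat τ (y n - 1)) atTop (𝓝 0) := by
  have h : ∀ n : ℕ, ∃ a ∈ δ.dom.toNonUnitalSubalgebra.toSubmodule, IsSelfAdjoint a ∧ ‖a‖ ≤ 2 ∧
      ‖hat τ (a - 1)‖ ≤ 1 / ((n : ℝ) + 1) := fun n =>
    exists_bounded_approx_selfAdjoint τ δ.dom.toNonUnitalSubalgebra.toSubmodule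
      (fun a ha b hb => δ.dom.mul_mem ha hb)
      (fun a (ha : a ∈ δ.dom) => star_mem (S := NonUnitalStarSubalgebra ℂ N.toStarSubalgebra) ha)
      (IsSelfAdjoint.one _) norm_one_le_one
      (fun κ hκ => δ.exists_norm_hat_sub_le 1 hκ) (by positivity)
  choose y hy hsa hn hlim using h
  exact ⟨fun n => ⟨y n, hy n⟩, hn, hsa,
    squeeze_zero_norm hlim tendsto_one_div_add_atTop_nhds_zero_nat⟩

lemma StarBimodule.inner_left_sub_one {A H : Type*} [CStarAlgebra A] [NormedAddCommGroup H]
    [InnerProductSpace ℂ H] [CompleteSpace H] (B : StarBimodule A H) (a : A) (ξ ζ : H) :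
    ⟪ξ, B.left (a - 1) (B.right 1 ζ)⟫_ℂ = ⟪ξ, B.left a ζ⟫_ℂ - ⟪ξ, ζ⟫_ℂ := by
  rw [B.right_one, one_apply_eq_self, map_sub, map_one, sub_apply,
    one_apply_eq_self, inner_sub_right]

lemma StarBimodule.inner_right_sub_one {A H : Type*} [CStarAlgebra A] [NormedAddCommGroup H]
    [InnerProductSpace ℂ H] [CompleteSpace H] (B : StarBimodule A H) (a : A) (ξ ζ : H) :
    ⟪ξ, B.left 1 (B.right (a - 1) ζ)⟫_ℂ = ⟪ξ, B.right a ζ⟫_ℂ - ⟪ξ, ζ⟫_ℂ := by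
  rw [map_one, one_apply_eq_self, map_sub, B.right_one, sub_apply,
    one_apply_eq_self, inner_sub_right]

variable {y : ℕ → N.toStarSubalgebra}

lemma tendsto_inner_coarse_of_tendsto_one (hy2 : ∀ n, ‖y n‖ ≤ 2)
    (hy : Tendsto (fun n => hat τ (y n - 1)) atTop (𝓝 0)) (ψ₁ ψ₂ : Coarse τ) :
    Tendsto (fun n => ⟪ψ₁, (coarseBimodule τ).left (y n) ψ₂⟫_ℂ) atTop (𝓝 ⟪ψ₁, ψ₂⟫_ℂ) ∧
    Tendsto (fun n => ⟪ψ₁, (coarseBimodule τ).right (y n) ψ₂⟫_ℂ) atTop (𝓝 ⟪ψ₁, ψ₂⟫_ℂ) := by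
  have hone : ‖(1 : N.toStarSubalgebra)‖ ≤ 3 := norm_one_le_one.trans (by norm_num)
  have hbd : ∀ n, ‖y n - 1‖ ≤ 3 := fun n => by
    have h1 := norm_sub_le (y n) 1
    have h2 := norm_one_le_one (A := N.toStarSubalgebra)
    linarith [hy2 n]
  have hw : ∀ s : L2 τ, Tendsto (fun n => ⟪s, hat τ (y n - 1)⟫_ℂ) atTop (𝓝 0) := fun s => by
    simpa only [inner_zero_right] using (tendsto_const_nhds (x := s)).inner hy (𝕜 := ℂ)
  constructor
  · have := tendsto_inner_coarse τ (a := fun n => y n - 1) (b := fun _ => 1) hbd (fun _ => hone)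
      (fun s t => by simpa only [zero_mul] using (hw s).mul_const ⟪t, hat τ 1⟫_ℂ) ψ₁ ψ₂
    exact tendsto_sub_nhds_zero_iff.1
      (this.congr fun n => (coarseBimodule τ).inner_left_sub_one (y n) ψ₁ ψ₂)
  · have := tendsto_inner_coarse τ (b := fun n => y n - 1) (a := fun _ => 1) (fun _ => hone) hbd
      (fun s t => by simpa only [mul_zero] using (hw t).const_mul ⟪s, hat τ 1⟫_ℂ) ψ₁ ψ₂
    exact tendsto_sub_nhds_zero_iff.1
      (this.congr fun n => (coarseBimodule τ).inner_right_sub_one (y n) ψ₁ ψ₂)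

lemma RealClosableDerivation.norm_star (δ : RealClosableDerivation τ) (x : δ.dom) :
    ‖δ.toFun (star x)‖ = ‖δ.toFun x‖ := by
  obtain ⟨y, hy2, hysa, hy⟩ := δ.exists_bounded_approx_one
  have h1 := (tendsto_inner_coarse_of_tendsto_one hy2 hy (δ.toFun x) (δ.toFun x)).1
  have h2 := (tendsto_inner_coarse_of_tendsto_one hy2 hy (δ.toFun (star x)) (δ.toFun (star x))).2
  have h3 : ∀ n, ⟪δ.toFun (star x), (coarseBimodule τ).right (y n) (δ.toFun (star x))⟫_ℂ =
      ⟪δ.toFun x, (coarseBimodule τ).left (y n) (δ.toFun x)⟫_ℂ := by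
    intro n
    have e1 := δ.real x (y n) x
    have e2 := (coarseBimodule τ).inner_left (y n : N.toStarSubalgebra) (δ.toFun x) (δ.toFun x)
    rw [(hysa n).star_eq] at e1 e2
    exact e1.symm.trans e2.symm
  have h4 := tendsto_nhds_unique (h2.congr h3) h1
  rw [inner_self_eq_norm_sq_to_K, inner_self_eq_norm_sq_to_K] at h4
  have h5 : ‖δ.toFun (star x)‖ ^ 2 = ‖δ.toFun x‖ ^ 2 := by exact_mod_cast h4
  exact (sq_eq_sq₀ (norm_nonneg _) (norm_nonneg _)).1 h5

/-- A real closable derivation as a `DerivationGraph`. -/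
def RealClosableDerivation.derivationGraph (δ : RealClosableDerivation τ) :
    DerivationGraph N.toStarSubalgebra (L2 τ) (Coarse τ) where
  std := stdBimodule τ
  hat := hat τ
  left_hat := stdBimodule_left_hat τ
  right_hat := stdBimodule_right_hat τ
  norm_hat_star := norm_hat_star τ
  bim := coarseBimodule τ
  graph :=
    { carrier := {p | ∃ x : δ.dom, (x : N.toStarSubalgebra) = p.1 ∧ δ.toFun x = p.2}
      add_mem' := by
        rintro _ _ ⟨x, h1, h2⟩ ⟨y, h3, h4⟩
        exact ⟨x + y, congrArg₂ (· + ·) h1 h3, by rw [map_add, h2, h4]; rfl⟩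
      zero_mem' := ⟨0, rfl, map_zero _⟩
      smul_mem' := by
        rintro c _ ⟨x, h1, h2⟩
        exact ⟨_, congrArg (c • ·) h1, (map_smul δ.toFun c x).trans (congrArg (c • ·) h2)⟩ }
  leibniz := by
    rintro _ _ _ _ ⟨x, rfl, rfl⟩ ⟨y, rfl, rfl⟩
    exact ⟨x * y, rfl, δ.leibniz x y⟩
  star_mem := by
    rintro _ _ ⟨x, rfl, rfl⟩
    exact ⟨δ.toFun (star x), ⟨star x, rfl, rfl⟩, (δ.norm_star x).le⟩

lemma RealClosableDerivation.toPMap_hat (δ : RealClosableDerivation τ) (x : δ.dom) :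
    (hat τ x, δ.toFun x) ∈ δ.toPMap.graph := by
  rw [LinearPMap.mem_graph_iff]
  refine ⟨⟨hat τ x, ⟨x, x.2, rfl⟩⟩, rfl, ?_⟩
  change δ.toFun _ = _
  congr 1
  exact (LinearEquiv.symm_apply_eq _).2 (Subtype.ext rfl)

lemma RealClosableDerivation.isCore (δ : RealClosableDerivation τ) :
    δ.derivationGraph.IsCore δ.toPMap.closure.graph where
  mem := by
    rintro _ _ ⟨x, rfl, rfl⟩
    exact LinearPMap.le_graph_of_le δ.toPMap.le_closure (δ.toPMap_hat x)
  approx := by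
    intro a b hab κ hκ
    rw [← δ.closable.graph_closure_eq_closure_graph] at hab
    obtain ⟨⟨a', b'⟩, h', hd⟩ := Metric.mem_closure_iff.1 hab κ hκ
    obtain ⟨⟨_, ⟨x, hx, rfl⟩⟩, rfl, rfl⟩ := (LinearPMap.mem_graph_iff _).1 h'
    have e := LinearPMap.mem_graph_snd_inj' _ (δ.toPMap_hat ⟨x, hx⟩)
      (δ.toPMap.mem_graph ⟨hat τ x, ⟨x, hx, rfl⟩⟩) rfl
    rw [Prod.dist_eq, max_lt_iff, dist_comm, dist_eq_norm, dist_comm, dist_eq_norm] at hd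
    exact ⟨x, _, ⟨⟨x, hx⟩, rfl, e⟩, hd.1.le, hd.2.le⟩

end Reality

section AlmostFixing

variable {A E F : Type*} [CStarAlgebra A] [NormedAddCommGroup E]
    [InnerProductSpace ℂ E] [CompleteSpace E] [NormedAddCommGroup F]
    [InnerProductSpace ℂ F] [CompleteSpace F]

lemma DerivationGraph.norm_hat_mul_le_left (S : DerivationGraph A E F) (x y : A) :
    ‖S.hat (x * y)‖ ≤ ‖x‖ * ‖S.hat y‖ := by
  rw [← S.left_hat]
  exact S.std.norm_left_apply_le x _

lemma DerivationGraph.norm_hat_mul_le_right (S : DerivationGraph A E F) (x y : A) :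
    ‖S.hat (x * y)‖ ≤ ‖S.hat x‖ * ‖y‖ := by
  rw [← S.right_hat, mul_comm]
  exact S.std.norm_right_apply_le y _

/-- The estimate behind `re_inner_sub_resolvent_le_of_supply`, for one choice of the elements
`a`, `b`, `z` of the domain. -/
lemma DerivationGraph.re_inner_sub_resolvent_le_of_approx {S : DerivationGraph A E F}
    {Γ : Submodule ℂ (E × F)} (hS : S.IsCore Γ) {α : ℝ} (hα : 0 < α) (ρ : ResolventOp Γ α)
    (h1 : ‖S.hat 1‖ ≤ 1) {u w v : A} {ε κ κ' : ℝ} (hε : 0 ≤ ε) (hκ : 0 ≤ κ)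
    (hu1 : ‖u‖ ≤ 1) (hw1 : ‖w‖ ≤ 1) (hv1 : ‖v‖ ≤ 1)
    (hu : ‖S.hat u - ρ.φ (S.hat u)‖ ≤ ε) (hw : ‖S.hat w - ρ.φ (S.hat w)‖ ≤ ε)
    {a b z : A} {ξa ξb ξz : F} (ha : (a, ξa) ∈ S.graph) (hb : (b, ξb) ∈ S.graph)
    (hz : (z, ξz) ∈ S.graph) (ha2 : ‖a‖ ≤ 2) (hb2 : ‖b‖ ≤ 2) (hz4 : ‖z‖ ≤ 4)
    (hau : ‖S.hat a - ρ.φ (S.hat u)‖ ≤ κ) (hbw : ‖S.hat b - ρ.φ (S.hat w)‖ ≤ κ)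
    (hξa : ‖ξa - ρ.ψ (S.hat u)‖ ≤ κ) (hξb : ‖ξb - ρ.ψ (S.hat w)‖ ≤ κ)
    (hzv : ‖S.hat (z - v)‖ ≤ κ') :
    (⟪S.hat v - ρ.φ (S.hat v), S.hat v⟫_ℂ).re ≤
      α⁻¹ * (16 * (√α * (√(α * ε) + κ)) +
        ‖⟪ρ.ψ (S.hat v), S.bim.left a (S.bim.right b ξz)⟫_ℂ‖) +
      (12 * (ε + κ) + κ' + ‖S.hat (u * v * w - v)‖) := by
  have hhat : ∀ x : A, ‖x‖ ≤ 1 → ‖S.hat x‖ ≤ 1 := fun x hx =>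
    (S.norm_hat_le x).trans (mul_le_one₀ hx (norm_nonneg _) h1)
  have hen : ∀ x : A, ‖x‖ ≤ 1 → ‖S.hat x - ρ.φ (S.hat x)‖ ≤ ε → ‖ρ.ψ (S.hat x)‖ ≤ √(α * ε) := by
    intro x hx hxε
    refine Real.le_sqrt_of_sq_le ((ρ.energy_le hα _).trans ?_)
    gcongr
    exact (mul_le_of_le_one_right (norm_nonneg _) (hhat x hx)).trans hxε
  have henv : ‖ρ.ψ (S.hat v)‖ ≤ √α := by
    refine Real.le_sqrt_of_sq_le ((ρ.energy_le hα _).trans ?_)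
    refine mul_le_of_le_one_right hα.le (mul_le_one₀ ?_ (norm_nonneg _) (hhat v hv1))
    exact (ρ.norm_sub_le hα _).trans (hhat v hv1)
  have hξa' : ‖ξa‖ ≤ √(α * ε) + κ := by
    have := norm_add_le (ξa - ρ.ψ (S.hat u)) (ρ.ψ (S.hat u))
    rw [sub_add_cancel] at this
    linarith [hen u hu1 hu]
  have hξb' : ‖ξb‖ ≤ √(α * ε) + κ := by
    have := norm_add_le (ξb - ρ.ψ (S.hat w)) (ρ.ψ (S.hat w))
    rw [sub_add_cancel] at this
    linarith [hen w hw1 hw]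
  have hmem := S.leibniz (S.leibniz ha hz) hb
  have hinner := ρ.inner_eq (S.hat v) (hS.mem hmem)
  have e1 : ‖S.bim.left (a * z) ξb‖ ≤ 8 * (√(α * ε) + κ) := by
    refine (S.bim.norm_left_apply_le _ _).trans ?_
    have : ‖a * z‖ ≤ 8 := (norm_mul_le _ _).trans (by nlinarith [norm_nonneg a, norm_nonneg z])
    gcongr
  have e2 : ‖S.bim.right b (S.bim.right z ξa)‖ ≤ 8 * (√(α * ε) + κ) := by
    refine (S.bim.norm_right_apply_le _ _).trans ?_
    have h := S.bim.norm_right_apply_le z ξa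
    calc ‖b‖ * ‖S.bim.right z ξa‖ ≤ 2 * (4 * (√(α * ε) + κ)) := by
          gcongr
          exact h.trans (by gcongr)
      _ = _ := by ring
  have hcomm : S.bim.right b (S.bim.left a ξz) = S.bim.left a (S.bim.right b ξz) :=
    (DFunLike.congr_fun (S.bim.comm a b) ξz).symm
  rw [map_add, hcomm, inner_add_right, inner_add_right] at hinner
  have f1 : ‖⟪ρ.ψ (S.hat v), S.bim.left (a * z) ξb⟫_ℂ‖ ≤ √α * (8 * (√(α * ε) + κ)) :=
    (norm_inner_le_norm _ _).trans (by gcongr)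
  have f2 : ‖⟪ρ.ψ (S.hat v), S.bim.right b (S.bim.right z ξa)⟫_ℂ‖ ≤ √α * (8 * (√(α * ε) + κ)) :=
    (norm_inner_le_norm _ _).trans (by gcongr)
  have f3 : α * ‖⟪S.hat v - ρ.φ (S.hat v), S.hat (a * z * b)⟫_ℂ‖ ≤
      16 * (√α * (√(α * ε) + κ)) +
        ‖⟪ρ.ψ (S.hat v), S.bim.left a (S.bim.right b ξz)⟫_ℂ‖ := by
    have := congrArg norm hinner
    rw [norm_mul, Complex.norm_real, Real.norm_eq_abs, abs_of_pos hα] at this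
    rw [this]
    refine (norm_add_le _ _).trans ?_
    have := norm_add_le ⟪ρ.ψ (S.hat v), S.bim.left a (S.bim.right b ξz)⟫_ℂ
      ⟪ρ.ψ (S.hat v), S.bim.right b (S.bim.right z ξa)⟫_ℂ
    linarith
  have f4 : ‖⟪S.hat v - ρ.φ (S.hat v), S.hat (a * z * b)⟫_ℂ‖ ≤ α⁻¹ *
      (16 * (√α * (√(α * ε) + κ)) +
        ‖⟪ρ.ψ (S.hat v), S.bim.left a (S.bim.right b ξz)⟫_ℂ‖) := by
    rw [← div_eq_inv_mul, le_div_iff₀ hα, mul_comm]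
    exact f3
  have dist_le : ∀ x y : A, ‖S.hat y - ρ.φ (S.hat y)‖ ≤ ε → ‖S.hat x - ρ.φ (S.hat y)‖ ≤ κ →
      ‖S.hat (x - y)‖ ≤ ε + κ := by
    intro x y h h'
    rw [map_sub, show S.hat x - S.hat y = (S.hat x - ρ.φ (S.hat y)) -
      (S.hat y - ρ.φ (S.hat y)) by abel]
    refine (_root_.norm_sub_le _ _).trans ?_
    linarith
  have g : ‖S.hat (v - a * z * b)‖ ≤ 12 * (ε + κ) + κ' + ‖S.hat (u * v * w - v)‖ := by
    have split : v - a * z * b = -((a - u) * (z * b) + (u * z) * (b - w) + u * ((z - v) * w) +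
        (u * v * w - v)) := by noncomm_ring
    rw [split, map_neg, norm_neg, map_add, map_add, map_add]
    refine (norm_add₄_le).trans ?_
    have g1 : ‖S.hat ((a - u) * (z * b))‖ ≤ (ε + κ) * 8 := by
      refine (S.norm_hat_mul_le_right _ _).trans ?_
      have : ‖z * b‖ ≤ 8 := (norm_mul_le _ _).trans (by nlinarith [norm_nonneg b, norm_nonneg z])
      gcongr
      exact dist_le a u hu hau
    have g2 : ‖S.hat ((u * z) * (b - w))‖ ≤ 4 * (ε + κ) := by
      refine (S.norm_hat_mul_le_left _ _).trans ?_
      have : ‖u * z‖ ≤ 4 := (norm_mul_le _ _).trans (by nlinarith [norm_nonneg u, norm_nonneg z])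
      gcongr
      exact dist_le b w hw hbw
    have g3 : ‖S.hat (u * ((z - v) * w))‖ ≤ κ' := by
      refine (S.norm_hat_mul_le_left _ _).trans ?_
      refine (mul_le_of_le_one_left (norm_nonneg _) hu1).trans ?_
      refine (S.norm_hat_mul_le_right _ _).trans ?_
      exact (mul_le_of_le_one_right (norm_nonneg _) hw1).trans hzv
    linarith
  have split : S.hat v = S.hat (a * z * b) + S.hat (v - a * z * b) := by
    rw [← map_add]; congr 1; abel
  have hq : (⟪S.hat v - ρ.φ (S.hat v), S.hat v⟫_ℂ).re =
      (⟪S.hat v - ρ.φ (S.hat v), S.hat (a * z * b)⟫_ℂ).re +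
      (⟪S.hat v - ρ.φ (S.hat v), S.hat (v - a * z * b)⟫_ℂ).re := by
    rw [← Complex.add_re, ← inner_add_right, ← split]
  rw [hq]
  refine add_le_add ((Complex.re_le_norm _).trans f4) ((re_inner_le_norm_mul_norm _ _).trans ?_)
  refine (mul_le_of_le_one_left (norm_nonneg _) ?_).trans g
  exact (ρ.norm_sub_le hα _).trans (hhat v hv1)

/-- If `v` is asymptotically fixed by `v ↦ u v w`, with `u` tending weakly to zero and `u`, `w`
almost fixed by the resolvent, then `v` is almost fixed by the resolvent. -/
lemma DerivationGraph.re_inner_sub_resolvent_le_of_supply {S : DerivationGraph A E F}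
    {Γ : Submodule ℂ (E × F)} (hS : S.IsCore Γ) {α : ℝ} (hα : 0 < α) (ρ : ResolventOp Γ α)
    (h1 : ‖S.hat 1‖ ≤ 1) {ι : Type*} {l : Filter ι} [l.NeBot]
    (hmix : ∀ a b : ι × ℕ → A, (∀ i, ‖a i‖ ≤ 2) → (∀ i, ‖b i‖ ≤ 2) →
      (∀ s, Tendsto (fun i => ⟪s, S.hat (a i)⟫_ℂ) (l ×ˢ atTop) (𝓝 0)) → ∀ ψ₁ ψ₂,
      Tendsto (fun i => ⟪ψ₁, S.bim.left (a i) (S.bim.right (b i) ψ₂)⟫_ℂ) (l ×ˢ atTop) (𝓝 0))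
    {v : A} (hv1 : ‖v‖ ≤ 1)
    (hv : ∀ κ > 0, ∃ z ξ, (z, ξ) ∈ S.graph ∧ ‖z‖ ≤ 4 ∧ ‖S.hat (z - v)‖ ≤ κ)
    {u w : ι → A} (husa : ∀ i, IsSelfAdjoint (u i)) (hwsa : ∀ i, IsSelfAdjoint (w i))
    (hu1 : ∀ i, ‖u i‖ ≤ 1) (hw1 : ∀ i, ‖w i‖ ≤ 1) {ε : ℝ} (hε : 0 ≤ ε)
    (hu : ∀ i, ‖S.hat (u i) - ρ.φ (S.hat (u i))‖ ≤ ε)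
    (hw : ∀ i, ‖S.hat (w i) - ρ.φ (S.hat (w i))‖ ≤ ε)
    (huvw : Tendsto (fun i => ‖S.hat (u i * v * w i - v)‖) l (𝓝 0))
    (hweak : ∀ s, Tendsto (fun i => ⟪s, S.hat (u i)⟫_ℂ) l (𝓝 0)) :
    (⟪S.hat v - ρ.φ (S.hat v), S.hat v⟫_ℂ).re ≤ 16 * √ε + 12 * ε := by
  have near : ∀ (x : A), IsSelfAdjoint x → ‖x‖ ≤ 1 → ∀ n : ℕ, ∃ y ξ, (y, ξ) ∈ S.graph ∧ ‖y‖ ≤ 2 ∧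
      ‖S.hat y - ρ.φ (S.hat x)‖ ≤ 1 / ((n : ℝ) + 1) ∧ ‖ξ - ρ.ψ (S.hat x)‖ ≤ 1 / ((n : ℝ) + 1) := by
    intro x hx hx1 n
    obtain ⟨y, ξ, hy, hsa, hspec, h3, h4⟩ := hS.exists_near_resolvent hα ρ hx (c := -1) (d := 1)
      (by norm_num) (by norm_num)
      (spectrum_subset_Icc_norm.trans (Set.Icc_subset_Icc (by linarith) hx1))
      (κ := 1 / ((n : ℝ) + 1)) (by positivity)
    have hn : 1 / ((n : ℝ) + 1) ≤ 1 := by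
      rw [div_le_one (by positivity)]
      linarith [n.cast_nonneg (α := ℝ)]
    exact ⟨y, ξ, hy, norm_le_of_spectrum_subset_Icc hsa (by norm_num)
      (hspec.trans (Set.Icc_subset_Icc (by linarith) (by linarith))), h3, h4⟩
  choose a ξa ha ha2 hau hξa using fun i : ι × ℕ => near (u i.1) (husa i.1) (hu1 i.1) i.2
  choose b ξb hb hb2 hbw hξb using fun i : ι × ℕ => near (w i.1) (hwsa i.1) (hw1 i.1) i.2
  have hlim : Tendsto (fun i : ι × ℕ => 1 / ((i.2 : ℝ) + 1)) (l ×ˢ atTop) (𝓝 0) :=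
    tendsto_one_div_add_atTop_nhds_zero_nat.comp tendsto_snd
  have haweak : ∀ s, Tendsto (fun i => ⟪s, S.hat (a i)⟫_ℂ) (l ×ˢ atTop) (𝓝 0) := by
    intro s
    have t1 : Tendsto (fun i : ι × ℕ => ⟪s, ρ.φ (S.hat (u i.1))⟫_ℂ) (l ×ˢ atTop) (𝓝 0) := by
      refine ((hweak (ρ.φ s)).comp tendsto_fst).congr fun i => ?_
      exact ρ.inner_symm hα _ _
    have t2 : Tendsto (fun i : ι × ℕ => ⟪s, S.hat (a i) - ρ.φ (S.hat (u i.1))⟫_ℂ) (l ×ˢ atTop)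
        (𝓝 0) := by
      refine squeeze_zero_norm (a := fun i : ι × ℕ => ‖s‖ * (1 / ((i.2 : ℝ) + 1))) (fun i => ?_) ?_
      · exact (norm_inner_le_norm _ _).trans (by gcongr; exact hau i)
      · simpa using hlim.const_mul ‖s‖
    have t3 := t2.add t1
    rw [add_zero] at t3
    refine t3.congr fun i => ?_
    rw [← inner_add_right, sub_add_cancel]
  refine le_of_forall_pos_le_add fun κ' hκ' => ?_
  obtain ⟨z, ξz, hz, hz4, hzv⟩ := hv κ' hκ'
  have hmid := (hmix a b ha2 hb2 haweak (ρ.ψ (S.hat v)) ξz).norm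
  have huvw' : Tendsto (fun i : ι × ℕ => ‖S.hat (u i.1 * v * w i.1 - v)‖) (l ×ˢ atTop) (𝓝 0) :=
    huvw.comp tendsto_fst
  have htot := (((((hlim.const_add (√(α * ε))).const_mul √α).const_mul 16).add hmid).const_mul
    α⁻¹).add ((((hlim.const_add ε).const_mul 12).add_const κ').add huvw')
  have hbound := ge_of_tendsto' htot fun i =>
    DerivationGraph.re_inner_sub_resolvent_le_of_approx hS hα ρ h1 hε
      (show 0 ≤ 1 / ((i.2 : ℝ) + 1) by positivity) (hu1 i.1) (hw1 i.1) hv1 (hu i.1) (hw i.1)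
      (ha i) (hb i) hz (ha2 i) (hb2 i) hz4 (hau i) (hbw i) (hξa i) (hξb i) hzv
  refine hbound.trans_eq ?_
  rw [Real.sqrt_mul hα.le, norm_zero, add_zero, add_zero, add_zero, add_zero]
  have : √α * (√α * √ε) = α * √ε := by rw [← mul_assoc, Real.mul_self_sqrt hα.le]
  rw [this]
  field_simp
  ring

end AlmostFixing

section Diffuse

variable {K : Type*} [NormedAddCommGroup K] [InnerProductSpace ℂ K] [CompleteSpace K]
  {B : VonNeumannAlgebra K} {J : Type*} [Fintype J] {Ω : lp (fun _ : ℕ => K) 2}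
  {s : J → lp (fun _ : ℕ => K) 2} {κ : ℝ} {e e' : K →L[ℂ] K}

/-- There is a symmetry `u` of `e B e` such that the numbers `⟪s j, u Ω⟫` are small. -/
def HasSmallSymmetry (B : VonNeumannAlgebra K) (Ω : lp (fun _ : ℕ => K) 2)
    (s : J → lp (fun _ : ℕ => K) 2) (κ : ℝ) (e : K →L[ℂ] K) : Prop :=
  ∃ u ∈ B, IsSelfAdjoint u ∧ u * u = e ∧ e * u = u ∧
    ∑ j, ‖⟪s j, ampliation K u Ω⟫_ℂ‖ ^ 2 ≤ κ * ∑ j, ‖ampliation K e (s j)‖ ^ 2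

lemma inner_ampliation_projection (he : IsStarProjection e) (x y : lp (fun _ : ℕ => K) 2) :
    ⟪x, ampliation K e y⟫_ℂ = ⟪ampliation K e x, ampliation K e y⟫_ℂ := by
  have h1 : ampliation K e y = ampliation K e (ampliation K e y) := by
    conv_lhs => rw [← he.isIdempotentElem.eq, map_mul]
    rfl
  have h2 : star (ampliation K e) = ampliation K e := by rw [← map_star, he.isSelfAdjoint.star_eq]
  rw [← ContinuousLinearMap.adjoint_inner_right, ← ContinuousLinearMap.star_eq_adjoint, h2, ← h1]

lemma HasSmallSymmetry.of_norm_le (heB : e ∈ B) (he : IsStarProjection e)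
    (h : ‖ampliation K e Ω‖ ^ 2 ≤ κ) : HasSmallSymmetry B Ω s κ e := by
  refine ⟨e, heB, he.isSelfAdjoint, he.isIdempotentElem, he.isIdempotentElem, ?_⟩
  rw [Finset.mul_sum]
  refine Finset.sum_le_sum fun j _ => ?_
  rw [inner_ampliation_projection he]
  calc _ ≤ (‖ampliation K e (s j)‖ * ‖ampliation K e Ω‖) ^ 2 := by
        gcongr; exact norm_inner_le_norm _ _
    _ = ‖ampliation K e Ω‖ ^ 2 * ‖ampliation K e (s j)‖ ^ 2 := by ring
    _ ≤ _ := by gcongr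

lemma norm_ampliation_add_sq (he : IsStarProjection e)
    (hee : e * e' = 0) (x : lp (fun _ : ℕ => K) 2) :
    ‖ampliation K (e + e') x‖ ^ 2 = ‖ampliation K e x‖ ^ 2 + ‖ampliation K e' x‖ ^ 2 := by
  have h0 : ⟪ampliation K e x, ampliation K e' x⟫_ℂ = 0 := by
    have h2 : star (ampliation K e) = ampliation K e := by
      rw [← map_star, he.isSelfAdjoint.star_eq]
    have h3 : ampliation K e (ampliation K e' x) = 0 := by
      change (ampliation K e * ampliation K e') x = 0
      rw [← map_mul, hee, map_zero]
      rfl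
    rw [← ContinuousLinearMap.adjoint_inner_right, ← ContinuousLinearMap.star_eq_adjoint, h2, h3,
      inner_zero_right]
  rw [map_add, add_apply, @norm_add_sq ℂ, h0]
  simp

lemma HasSmallSymmetry.add (he : IsStarProjection e) (he' : IsStarProjection e')
    (hee : e * e' = 0) (h : HasSmallSymmetry B Ω s κ e) (h' : HasSmallSymmetry B Ω s κ e') :
    HasSmallSymmetry B Ω s κ (e + e') := by
  obtain ⟨u, huB, hu, huu, heu, hsum⟩ := h
  obtain ⟨v, hvB, hv, hvv, hev, hsum'⟩ := h'
  have hue : u * e = u := by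
    have := congrArg star heu
    rwa [star_mul, hu.star_eq, he.isSelfAdjoint.star_eq] at this
  have hve : v * e' = v := by
    have := congrArg star hev
    rwa [star_mul, hv.star_eq, he'.isSelfAdjoint.star_eq] at this
  have hee' : e' * e = 0 := by
    have := congrArg star hee
    rwa [star_mul, he.isSelfAdjoint.star_eq, he'.isSelfAdjoint.star_eq, star_zero] at this
  have huv : u * v = 0 := by
    rw [← hue, ← hev, mul_assoc, ← mul_assoc e, hee, zero_mul, mul_zero]
  have hvu : v * u = 0 := by
    rw [← hve, ← heu, mul_assoc, ← mul_assoc e', hee', zero_mul, mul_zero]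
  have hev' : e * v = 0 := by rw [← hev, ← mul_assoc, hee, zero_mul]
  have heu' : e' * u = 0 := by rw [← heu, ← mul_assoc, hee', zero_mul]
  have par : ∑ j, ‖⟪s j, ampliation K (u + v) Ω⟫_ℂ‖ ^ 2 + ∑ j, ‖⟪s j, ampliation K (u - v) Ω⟫_ℂ‖ ^ 2 =
      2 * (∑ j, ‖⟪s j, ampliation K u Ω⟫_ℂ‖ ^ 2 + ∑ j, ‖⟪s j, ampliation K v Ω⟫_ℂ‖ ^ 2) := by
    rw [← Finset.sum_add_distrib, ← Finset.sum_add_distrib, Finset.mul_sum]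
    refine Finset.sum_congr rfl fun j _ => ?_
    have := parallelogram_law_with_norm ℂ ⟪s j, ampliation K u Ω⟫_ℂ ⟪s j, ampliation K v Ω⟫_ℂ
    rw [map_add, map_sub, add_apply, sub_apply, inner_add_right,
      inner_sub_right]
    linarith
  have hadd : ∑ j, ‖ampliation K (e + e') (s j)‖ ^ 2 =
      ∑ j, ‖ampliation K e (s j)‖ ^ 2 + ∑ j, ‖ampliation K e' (s j)‖ ^ 2 := by
    rw [← Finset.sum_add_distrib]
    exact Finset.sum_congr rfl fun j _ => norm_ampliation_add_sq he hee _
  rcases le_total (∑ j, ‖⟪s j, ampliation K (u + v) Ω⟫_ℂ‖ ^ 2)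
    (∑ j, ‖⟪s j, ampliation K (u - v) Ω⟫_ℂ‖ ^ 2) with hle | hle
  · refine ⟨u + v, add_mem huB hvB, hu.add hv, ?_, ?_, ?_⟩
    · simp only [add_mul, mul_add, huv, hvu, huu, hvv]; abel
    · simp only [add_mul, mul_add, heu, hev, hev', heu']; abel
    · rw [hadd, mul_add]; linarith
  · refine ⟨u - v, sub_mem huB hvB, hu.sub hv, ?_, ?_, ?_⟩
    · simp only [sub_mul, mul_sub, huv, hvu, huu, hvv]; abel
    · simp only [add_mul, mul_sub, heu, hev, hev', heu']; abel
    · rw [hadd, mul_add]; linarith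

lemma IsStarProjection.norm_apply_le (he : IsStarProjection e) (x : K) : ‖e x‖ ≤ ‖x‖ := by
  obtain ⟨V, hV, rfl⟩ := isStarProjection_iff_eq_starProjection.1 he
  exact V.norm_starProjection_apply_le x

lemma starProjection_eq_one_sub {W : Submodule ℂ K} [W.HasOrthogonalProjection]
    (he : IsStarProjection e) (hW : e.ker = W) : W.starProjection = 1 - e := by
  subst hW
  ext x
  refine Submodule.eq_starProjection_of_mem_of_inner_eq_zero ?_ fun w hw => ?_
  · change e ((1 - e) x) = 0
    have := DFunLike.congr_fun he.isIdempotentElem.eq x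
    rw [sub_apply, one_apply_eq_self, map_sub, sub_eq_zero]
    exact this.symm
  · rw [sub_apply, one_apply_eq_self, sub_sub_cancel,
      ← ContinuousLinearMap.adjoint_inner_right, ← ContinuousLinearMap.star_eq_adjoint,
      he.isSelfAdjoint.star_eq, show e w = 0 from hw, inner_zero_right]

/-- A decreasing family of projections of a von Neumann algebra converges strongly to a projection
of the algebra. The family is given by the increasing family of kernels. -/
lemma exists_tendsto_projection {c : Set (Submodule ℂ K)} (hc : IsChain (· ≤ ·) c)
    (hne : c.Nonempty) {q : c → K →L[ℂ] K} (hqB : ∀ i, q i ∈ B) (hq : ∀ i, IsStarProjection (q i))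
    (hker : ∀ i, (q i).ker = i) :
    ∃ p ∈ B, IsStarProjection p ∧ (∀ i, q i * p = p) ∧ (∀ i : c, (i : Submodule ℂ K) ≤ p.ker) ∧
      (atTop : Filter c).NeBot ∧ ∀ x, Tendsto (fun i => q i x) atTop (𝓝 (p x)) := by
  have : ∀ i : c, (i : Submodule ℂ K).HasOrthogonalProjection := fun i => by
    rw [← hker i]
    have : CompleteSpace (q i).ker := (q i).isClosed_ker.completeSpace_coe
    infer_instance
  have : Nonempty c := hne.to_subtype
  have : IsDirectedOrder c := ⟨fun a b => by
    rcases hc.total a.2 b.2 with h | h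
    · exact ⟨b, h, le_rfl⟩
    · exact ⟨a, le_rfl, h⟩⟩
  let U : c → Submodule ℂ K := fun i => i
  let V : Submodule ℂ K := (⨆ i, U i).topologicalClosure
  have : CompleteSpace V := (⨆ i, U i).isClosed_topologicalClosure.completeSpace_coe
  have hlim := fun x => Submodule.starProjection_tendsto_closure_iSup U (fun i j h => h) x
  have hq' : ∀ i x, q i x = x - (U i).starProjection x := fun i x => by
    rw [starProjection_eq_one_sub (hq i) (hker i), sub_apply,
      one_apply_eq_self, sub_sub_cancel]
  have hlim' : ∀ x, Tendsto (fun i => q i x) atTop (𝓝 ((1 - V.starProjection) x)) := fun x => by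
    simp only [hq']
    exact (hlim x).const_sub x
  have hUV : ∀ i, U i ≤ V := fun i => (le_iSup U i).trans (Submodule.le_topologicalClosure _)
  refine ⟨1 - V.starProjection, ?_, isStarProjection_starProjection.one_sub, fun i => ?_,
    fun i x hx => ?_, inferInstance, hlim'⟩
  · rw [← B.commutant_commutant, VonNeumannAlgebra.mem_commutant_iff]
    intro t ht
    ext x
    have h1 := (t.continuous.tendsto _).comp (hlim' x)
    have h2 := hlim' (t x)
    refine tendsto_nhds_unique h1 (h2.congr fun i => ?_)
    exact DFunLike.congr_fun (VonNeumannAlgebra.mem_commutant_iff.1 ht (q i) (hqB i)) x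
  · ext x
    change q i ((1 - V.starProjection) x) = (1 - V.starProjection) x
    rw [hq', sub_eq_self, sub_apply, one_apply_eq_self]
    refine (Submodule.starProjection_apply_eq_zero_iff _).2 ?_
    exact Submodule.orthogonal_le (hUV i) (V.sub_starProjection_mem_orthogonal x)
  · change (1 - V.starProjection) x = 0
    rw [sub_apply, one_apply_eq_self, sub_eq_zero]
    exact (Submodule.starProjection_eq_self_iff.2 (hUV i hx)).symm

lemma tendsto_ampliation {ι : Type*} {l : Filter ι} {T : ι → K →L[ℂ] K} {C : ℝ}
    (hT : ∀ i, ‖T i‖ ≤ C) (h : ∀ x, Tendsto (fun i => T i x) l (𝓝 0))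
    (ξ : lp (fun _ : ℕ => K) 2) : Tendsto (fun i => ampliation K (T i) ξ) l (𝓝 0) := by
  refine lp_dense_induction (P := fun ξ => Tendsto (fun i => ampliation K (T i) ξ) l (𝓝 0))
    (isClosed_setOf_tendsto_zero (C := C) fun i x y => ?_)
    (by simp only [map_zero]; exact tendsto_const_nhds)
    (fun x y hx hy => by simpa only [map_add, add_zero] using hx.add hy) (fun n x => ?_) ξ
  · have hn : ‖ampliation K (T i)‖ ≤ C :=
      (NonUnitalStarAlgHom.norm_apply_le (ampliation K) (T i)).trans (hT i)
    rw [← map_sub]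
    exact (ContinuousLinearMap.le_opNorm _ _).trans
      (mul_le_mul_of_nonneg_right hn (norm_nonneg _))
  · simp only [ampliation_single]
    have hn : ∀ i, ‖(lp.single 2 n (T i x) : lp (fun _ : ℕ => K) 2)‖ = ‖T i x‖ := fun i =>
      lp.norm_single (E := fun _ : ℕ => K) (p := 2) (by norm_num) n (T i x)
    exact tendsto_zero_iff_norm_tendsto_zero.2
      ((tendsto_zero_iff_norm_tendsto_zero.1 (h x)).congr fun i => (hn i).symm)

/-- A diffuse von Neumann algebra contains symmetries which are almost orthogonal to given
vectors. -/
theorem exists_symmetry_of_isDiffuse (hB : IsDiffuse B) (Ω : lp (fun _ : ℕ => K) 2)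
    (s : J → lp (fun _ : ℕ => K) 2) {κ : ℝ} (hκ : 0 < κ) :
    ∃ u ∈ B, IsSelfAdjoint u ∧ u * u = 1 ∧ ∀ j, ‖⟪s j, ampliation K u Ω⟫_ℂ‖ ≤ κ := by
  have main : ∀ κ : ℝ, 0 < κ → HasSmallSymmetry B Ω s κ 1 := by
    intro κ hκ
    by_contra hbad
    let bad : Set (Submodule ℂ K) :=
      {W | ∃ q ∈ B, IsStarProjection q ∧ q.ker = W ∧ ¬ HasSmallSymmetry B Ω s κ q}
    have hchain : ∀ c ⊆ bad, IsChain (· ≤ ·) c → ∀ y ∈ c, ∃ ub ∈ bad, ∀ z ∈ c, z ≤ ub := by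
      intro c hcbad hc y hy
      choose q hqB hq hker hqbad using fun i : c => hcbad i.2
      obtain ⟨p, hpB, hp, hqp, hle, hbot, hlim⟩ :=
        exists_tendsto_projection hc ⟨y, hy⟩ hqB hq hker
      refine ⟨p.ker, ⟨p, hpB, hp, rfl, fun hgood => ?_⟩, fun z hz => hle ⟨z, hz⟩⟩
      have hpq : ∀ i, p * q i = p := fun i => by
        have := congrArg star (hqp i)
        rwa [star_mul, (hq i).isSelfAdjoint.star_eq, hp.isSelfAdjoint.star_eq] at this
      have hr : ∀ i, IsStarProjection (q i - p) := fun i => ⟨by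
        rw [IsIdempotentElem, mul_sub, sub_mul, sub_mul, hp.isIdempotentElem.eq,
          (hq i).isIdempotentElem.eq, hpq, hqp]; abel, (hq i).isSelfAdjoint.sub hp.isSelfAdjoint⟩
      have ht := tendsto_ampliation (l := atTop) (T := fun i => q i - p) (C := 1) (fun i =>
        ContinuousLinearMap.opNorm_le_bound _ zero_le_one fun x => by
          rw [one_mul]
          exact IsStarProjection.norm_apply_le (hr i) x)
        (fun x => by simpa using (hlim x).sub_const (p x)) Ω
      have ht2 := (ht.norm.pow 2).eventually_le_const (u := κ) (by simpa using hκ)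
      obtain ⟨i, hi⟩ := ht2.exists
      refine hqbad i ?_
      have := hgood.add hp (hr i) (by rw [mul_sub, hpq, hp.isIdempotentElem.eq, sub_self])
        (.of_norm_le (sub_mem (hqB i) hpB) (hr i) hi)
      rwa [add_sub_cancel] at this
    obtain ⟨W, -, ⟨p, hpB, hp, rfl, hpbad⟩, hmax⟩ := zorn_le_nonempty₀ bad hchain ⊥
      ⟨1, one_mem _, .one _, by ext; simp, hbad⟩
    have hp0 : p ≠ 0 := by
      rintro rfl
      exact hpbad (.of_norm_le (zero_mem B) (.zero _) (by simpa using hκ.le))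
    obtain ⟨q, hqB, hq, hpq, hq0, hqp⟩ := hB p hpB hp hp0
    have hqp' : q * p = q := by
      have := congrArg star hpq
      rwa [star_mul, hq.isSelfAdjoint.star_eq, hp.isSelfAdjoint.star_eq] at this
    have hr : IsStarProjection (p - q) := ⟨by
      rw [IsIdempotentElem, mul_sub, sub_mul, sub_mul, hp.isIdempotentElem.eq,
        hq.isIdempotentElem.eq, hpq, hqp']; abel, hp.isSelfAdjoint.sub hq.isSelfAdjoint⟩
    have step : ∀ r ∈ B, IsStarProjection r → r * p = r → r ≠ p → HasSmallSymmetry B Ω s κ r := by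
      intro r hrB hr hrp hne
      by_contra hrbad
      have hle : r.ker ≤ p.ker := hmax ⟨r, hrB, hr, rfl, hrbad⟩ fun x (hx : p x = 0) => by
        change r x = 0
        rw [← hrp]
        change r (p x) = 0
        rw [hx, map_zero]
      apply hne
      have hprp : p * r = r := by
        have := congrArg star hrp
        rwa [star_mul, hr.isSelfAdjoint.star_eq, hp.isSelfAdjoint.star_eq] at this
      rw [← hprp, eq_comm]
      ext x
      have : p ((1 - r) x) = 0 := hle (show r ((1 - r) x) = 0 from by
        rw [sub_apply, one_apply_eq_self, map_sub, sub_eq_zero]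
        exact (DFunLike.congr_fun hr.isIdempotentElem.eq x).symm)
      rw [sub_apply, one_apply_eq_self, map_sub, sub_eq_zero] at this
      exact this
    refine hpbad ?_
    have := HasSmallSymmetry.add hq hr (by rw [mul_sub, hqp', hq.isIdempotentElem.eq, sub_self])
      (step q hqB hq hqp' hqp)
      (step (p - q) (sub_mem hpB hqB) hr (by rw [sub_mul, hqp', hp.isIdempotentElem.eq])
        fun h => hq0 (by simpa using h))
    rwa [add_sub_cancel] at this
  obtain ⟨t, ht⟩ : ∃ t, t = ∑ j, ‖ampliation K 1 (s j)‖ ^ 2 := ⟨_, rfl⟩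
  have ht0 : 0 ≤ t := ht ▸ Finset.sum_nonneg fun j _ => by positivity
  obtain ⟨u, huB, hu, huu, -, hsum⟩ := main (κ ^ 2 / (t + 1)) (by positivity)
  refine ⟨u, huB, hu, huu, fun j => ?_⟩
  refine le_of_sq_le_sq ?_ hκ.le
  refine (Finset.single_le_sum (f := fun j => ‖⟪s j, ampliation K u Ω⟫_ℂ‖ ^ 2)
    (fun j _ => by positivity) (Finset.mem_univ j)).trans (hsum.trans ?_)
  rw [← ht, div_mul_eq_mul_div, div_le_iff₀ (by positivity)]
  nlinarith [sq_nonneg κ]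

end Diffuse

lemma ResolventOp.norm_sub_le_add {E F : Type*} [NormedAddCommGroup E] [InnerProductSpace ℂ E]
    [NormedAddCommGroup F] [InnerProductSpace ℂ F] {Γ : Submodule ℂ (E × F)} {α : ℝ}
    (ρ : ResolventOp Γ α) (hα : 0 < α) (ξ ζ : E) :
    ‖ξ - ρ.φ ξ‖ ≤ ‖ζ - ρ.φ ζ‖ + ‖ζ - ξ‖ := by
  have e : ξ - ρ.φ ξ = (ζ - ρ.φ ζ) - ((ζ - ξ) - ρ.φ (ζ - ξ)) := by rw [map_sub]; abel
  rw [e]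
  exact (_root_.norm_sub_le _ _).trans (by gcongr; exact ρ.norm_sub_le hα _)

lemma norm_hat_one {K : Type u} [NormedAddCommGroup K] [InnerProductSpace ℂ K]
    [CompleteSpace K] {N : VonNeumannAlgebra K} (τ : FaithfulNormalTrace N) : ‖hat τ 1‖ = 1 := by
  have h := norm_gnsHat_sq τ.toLinearMap τ.nonneg 1
  rw [star_one, mul_one, τ.map_one] at h
  have h2 : ‖hat τ 1‖ ^ 2 = 1 := by exact_mod_cast h
  exact (sq_eq_sq₀ (norm_nonneg _) zero_le_one).1 (by rw [h2, one_pow])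

namespace L2Deformation

variable {K : Type u} [NormedAddCommGroup K] [InnerProductSpace ℂ K] [CompleteSpace K]
  {N : VonNeumannAlgebra K} {τ : FaithfulNormalTrace N} (d : L2Deformation N τ)

/-- The resolvent `η_α` on `L²(M)`. -/
def resolvent {α : ℝ} (hα : 0 < α) : ResolventOp d.δ.toPMap.closure.graph α :=
  resolventOp d.δ.toPMap d.δ.dense_domain d.δ.closable hα

lemma inner_hat_incl (x y : N.toStarSubalgebra) :
    ⟪hat d.tr (d.incl x), hat d.tr (d.incl y)⟫_ℂ = ⟪hat τ x, hat τ y⟫_ℂ := by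
  rw [inner_hat, inner_hat, ← map_star, ← map_mul, d.tr_incl]

lemma norm_hat_incl (x : N.toStarSubalgebra) : ‖hat d.tr (d.incl x)‖ = ‖hat τ x‖ := by
  refine (sq_eq_sq₀ (norm_nonneg _) (norm_nonneg _)).1 ?_
  have h := d.inner_hat_incl x x
  rw [inner_self_eq_norm_sq_to_K, inner_self_eq_norm_sq_to_K] at h
  exact_mod_cast h

lemma norm_incl_le (x : N.toStarSubalgebra) : ‖d.incl x‖ ≤ ‖x‖ :=
  NonUnitalStarAlgHom.norm_apply_le d.incl x

lemma displacement_add_le {α : ℝ} (hα : 0 < α) (x y : N.toStarSubalgebra) :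
    d.displacement α x ≤ d.displacement α y + ‖hat τ (y - x)‖ := by
  rw [← d.norm_hat_incl, map_sub, map_sub]
  exact (d.resolvent hα).norm_sub_le_add hα _ _

/-- There are self-adjoint contractions `u`, `w`, almost fixed by `η_α`, with `u v w` close to `v`
and `u` almost orthogonal to any given finite set. -/
def HasSupply (α ε : ℝ) (v : N.toStarSubalgebra) : Prop :=
  ∀ (T : Finset N.toStarSubalgebra) (κ : ℝ), 0 < κ → ∃ u w : N.toStarSubalgebra,
    IsSelfAdjoint u ∧ IsSelfAdjoint w ∧ ‖u‖ ≤ 1 ∧ ‖w‖ ≤ 1 ∧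
    d.displacement α u ≤ ε ∧ d.displacement α w ≤ ε ∧ ‖hat τ (u * v * w - v)‖ ≤ κ ∧
    ∀ x ∈ T, ‖⟪hat τ x, hat τ u⟫_ℂ‖ ≤ κ

lemma tendsto_inner_hat_incl {ι : Type*} {l : Filter ι} {u : ι → N.toStarSubalgebra}
    (hu1 : ∀ i, ‖u i‖ ≤ 1) (h : ∀ x, Tendsto (fun i => ⟪hat τ x, hat τ (u i)⟫_ℂ) l (𝓝 0))
    (s : L2 d.tr) : Tendsto (fun i => ⟪s, hat d.tr (d.incl (u i))⟫_ℂ) l (𝓝 0) := by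
  let V : Submodule ℂ (L2 d.tr) :=
    (LinearMap.range (hat d.tr ∘ₗ d.incl.toAlgHom.toLinearMap)).topologicalClosure
  have : CompleteSpace V := (Submodule.isClosed_topologicalClosure _).completeSpace_coe
  have hcl : IsClosed {s : L2 d.tr | Tendsto (fun i => ⟪s, hat d.tr (d.incl (u i))⟫_ℂ) l (𝓝 0)} := by
    refine isClosed_setOf_tendsto_zero (C := 1) fun i x y => ?_
    rw [← inner_sub_left, mul_comm]
    refine (norm_inner_le_norm _ _).trans ?_
    gcongr
    exact ((d.δ.derivationGraph.norm_hat_le _).trans (by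
      rw [show d.δ.derivationGraph.hat 1 = hat d.tr 1 from rfl, norm_hat_one, mul_one]
      exact (d.norm_incl_le _).trans (hu1 i)))
  have hV : V.starProjection s ∈
      {s : L2 d.tr | Tendsto (fun i => ⟪s, hat d.tr (d.incl (u i))⟫_ℂ) l (𝓝 0)} := by
    refine closure_minimal ?_ hcl (V.starProjection_apply_mem s)
    rintro _ ⟨x, rfl⟩
    exact (h x).congr fun i => (d.inner_hat_incl x (u i)).symm
  refine Tendsto.congr (fun i => ?_) hV
  have hmem : hat d.tr (d.incl (u i)) ∈ V := subset_closure ⟨u i, rfl⟩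
  have := V.starProjection_inner_eq_zero s _ hmem
  rw [inner_sub_left, sub_eq_zero] at this
  exact this.symm

lemma HasSupply.displacement_sq_le {d : L2Deformation N τ} {α ε : ℝ} (hα : 0 < α) (hε : 0 ≤ ε)
    {v : N.toStarSubalgebra} (hv1 : ‖v‖ ≤ 1) (h : d.HasSupply α ε v) :
    d.displacement α v ^ 2 ≤ 16 * √ε + 12 * ε := by
  classical
  choose u w husa hwsa hu1 hw1 hu hw huvw horth using
    fun i : Finset N.toStarSubalgebra × ℕ => h i.1 (1 / ((i.2 : ℝ) + 1)) (by positivity)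
  have hlim : Tendsto (fun i : Finset N.toStarSubalgebra × ℕ => 1 / ((i.2 : ℝ) + 1)) atTop (𝓝 0) := by
    rw [← prod_atTop_atTop_eq]
    exact tendsto_one_div_add_atTop_nhds_zero_nat.comp tendsto_snd
  have hweak := d.tendsto_inner_hat_incl (l := atTop) hu1 fun x => by
    refine squeeze_zero_norm' ?_ hlim
    filter_upwards [eventually_ge_atTop (({x}, 0) : Finset N.toStarSubalgebra × ℕ)] with i hi
    exact horth i x (hi.1 (Finset.mem_singleton_self x))
  refine ((d.resolvent hα).norm_sub_sq_le hα _).trans ?_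
  refine DerivationGraph.re_inner_sub_resolvent_le_of_supply d.δ.isCore hα (d.resolvent hα)
    (norm_hat_one d.tr).le (l := (atTop : Filter (Finset N.toStarSubalgebra × ℕ))) ?_ ((d.norm_incl_le v).trans hv1) ?_
    (u := fun i => d.incl (u i)) (w := fun i => d.incl (w i))
    (fun i => (husa i).map d.incl) (fun i => (hwsa i).map d.incl)
    (fun i => (d.norm_incl_le _).trans (hu1 i)) (fun i => (d.norm_incl_le _).trans (hw1 i)) hε
    hu hw ?_ hweak
  · intro a b ha hb hat0 ψ₁ ψ₂
    refine tendsto_inner_coarse d.tr ha hb (fun s t => ?_) ψ₁ ψ₂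
    have hbd : ∀ i, ‖⟪t, hat d.tr (b i)⟫_ℂ‖ ≤ ‖t‖ * 2 := fun i => by
      refine (norm_inner_le_norm _ _).trans ?_
      gcongr
      refine (d.δ.derivationGraph.norm_hat_le _).trans ?_
      rw [show d.δ.derivationGraph.hat 1 = hat d.tr 1 from rfl, norm_hat_one, mul_one]
      exact hb i
    refine squeeze_zero_norm (a := fun i => ‖⟪s, hat d.tr (a i)⟫_ℂ‖ * (‖t‖ * 2)) (fun i => ?_) ?_
    · rw [norm_mul]
      gcongr
      exact hbd i
    · have := (hat0 s).norm.mul_const (‖t‖ * 2)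
      rwa [norm_zero, zero_mul] at this
  · intro κ hκ
    obtain ⟨z, hz, hz4, hzv⟩ := exists_bounded_approx d.tr d.δ.dom.toNonUnitalSubalgebra.toSubmodule
      (fun a ha b hb => d.δ.dom.mul_mem ha hb)
      (fun a (ha : a ∈ d.δ.dom) =>
        star_mem (S := NonUnitalStarSubalgebra ℂ d.M.toStarSubalgebra) ha)
      ((d.norm_incl_le v).trans hv1) (fun κ hκ => d.δ.exists_norm_hat_sub_le _ hκ) hκ
    exact ⟨z, d.δ.toFun ⟨z, hz⟩, ⟨⟨z, hz⟩, rfl, rfl⟩, hz4, hzv⟩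
  · refine squeeze_zero (fun i => norm_nonneg _) (fun i => ?_) hlim
    refine le_trans (le_of_eq ?_) (huvw i)
    rw [← d.norm_hat_incl, map_sub d.incl, map_mul, map_mul]
    rfl

/-- Uniform convergence passes from a group of unitaries to the von Neumann algebra which it
generates. -/
lemma displacement_sq_le_of_mem_generatedVN {α ε : ℝ} (hα : 0 < α)
    (G : Subgroup (unitary N.toStarSubalgebra)) (hG : ∀ v ∈ G, d.displacement α v ≤ ε)
    {x : N.toStarSubalgebra} (hx1 : ‖x‖ ≤ 1)
    (hx : (x : K →L[ℂ] K) ∈ generatedVN ((fun v : unitary N.toStarSubalgebra =>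
      ((v : N.toStarSubalgebra) : K →L[ℂ] K)) '' (G : Set (unitary N.toStarSubalgebra)))) :
    d.displacement α x ≤ √(80 * ε) := by
  let D : Submodule ℂ N.toStarSubalgebra := Submodule.span ℂ
    ((fun v : unitary N.toStarSubalgebra => (v : N.toStarSubalgebra)) '' (G : Set _))
  have hGD : ∀ v ∈ G, (v : N.toStarSubalgebra) ∈ D := fun v hv => Submodule.subset_span ⟨v, hv, rfl⟩
  have hmul : ∀ a ∈ D, ∀ b ∈ D, a * b ∈ D := by
    intro a ha b hb
    induction ha using Submodule.span_induction with
    | zero => rw [zero_mul]; exact D.zero_mem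
    | add y z _ _ hy hz => rw [add_mul]; exact D.add_mem hy hz
    | smul c y _ hy => rw [smul_mul_assoc]; exact D.smul_mem c hy
    | mem y hy =>
      obtain ⟨v, hv, rfl⟩ := hy
      induction hb using Submodule.span_induction with
      | zero => rw [mul_zero]; exact D.zero_mem
      | add y z _ _ hy hz => rw [mul_add]; exact D.add_mem hy hz
      | smul c y _ hy => rw [mul_smul_comm]; exact D.smul_mem c hy
      | mem y hy =>
        obtain ⟨w, hw, rfl⟩ := hy
        exact hGD (v * w) (G.mul_mem hv hw)
  have hstar : ∀ a ∈ D, star a ∈ D := by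
    intro a ha
    induction ha using Submodule.span_induction with
    | zero => rw [star_zero]; exact D.zero_mem
    | add y z _ _ hy hz => rw [star_add]; exact D.add_mem hy hz
    | smul c y _ hy => rw [star_smul]; exact D.smul_mem _ hy
    | mem y hy =>
      obtain ⟨v, hv, rfl⟩ := hy
      exact hGD v⁻¹ (G.inv_mem hv)
  have hnd : ∀ ζ : K, (∀ a ∈ D, (a : K →L[ℂ] K) ζ = 0) → ζ = 0 := fun ζ h =>
    h 1 (hGD 1 G.one_mem)
  have hcomm : ∀ t : K →L[ℂ] K, (∀ a ∈ D, (a : K →L[ℂ] K) * t = t * a) →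
      (x : K →L[ℂ] K) * t = t * x := by
    intro t ht
    have h1 := (StarSubalgebra.mem_centralizer_iff ℂ).1 hx
    refine ((h1 t ?_).1).symm
    refine (StarSubalgebra.mem_centralizer_iff ℂ).2 ?_
    rintro _ ⟨v, hv, rfl⟩
    exact ⟨ht _ (hGD v hv), ht _ (hstar _ (hGD v hv))⟩
  have key : ∀ y ∈ D, ‖y‖ ≤ 4 → d.displacement α y ≤ √(80 * ε) := by
    intro y hy hy4
    refine Real.le_sqrt_of_sq_le ?_
    refine ((d.resolvent hα).norm_sub_sq_le hα _).trans ?_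
    have hε : 0 ≤ ε := (norm_nonneg _).trans (hG 1 G.one_mem)
    let G' : Subgroup (unitary d.M.toStarSubalgebra) :=
      G.map (Unitary.map (StarMonoidHom.ofClass d.incl)).toMonoidHom
    have hmem : d.incl y ∈ Submodule.span ℂ ((fun v : unitary d.M.toStarSubalgebra =>
        (v : d.M.toStarSubalgebra)) '' (G' : Set (unitary d.M.toStarSubalgebra))) := by
      have hle : D ≤ Submodule.comap d.incl.toAlgHom.toLinearMap (Submodule.span ℂ
          ((fun v : unitary d.M.toStarSubalgebra => (v : d.M.toStarSubalgebra)) ''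
            (G' : Set (unitary d.M.toStarSubalgebra)))) := by
        refine Submodule.span_le.2 ?_
        rintro _ ⟨v, hv, rfl⟩
        exact Submodule.subset_span ⟨_, ⟨v, hv, rfl⟩, rfl⟩
      exact hle hy
    have := d.δ.isCore.re_inner_sub_resolvent_le hα (d.resolvent hα) (norm_hat_one d.tr).le
      G' (ε := ε) (by
        rintro _ ⟨v, hv, rfl⟩
        exact hG v hv) hmem
    refine this.trans ?_
    have h4 : ‖d.incl y‖ ≤ 4 := (d.norm_incl_le y).trans hy4
    have : ‖d.incl y‖ ^ 2 ≤ 4 ^ 2 := by gcongr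
    nlinarith
  refine le_of_forall_pos_le_add fun κ hκ => ?_
  obtain ⟨y, hy, hy4, hyx⟩ := exists_bounded_approx τ D hmul hstar hx1
    (fun κ hκ => exists_norm_hat_sub_le τ D hmul hstar hnd hcomm hκ) hκ
  exact (d.displacement_add_le hα x y).trans (add_le_add (key y hy hy4) hyx)

end L2Deformation

/-- The unitaries `v` such that conjugation by `c v` maps `X` onto itself. -/
def conjStabilizer {A C : Type*} [CStarAlgebra A] [Ring C] [StarRing C] (c : A →⋆* C) (X : Set C) :
    Subgroup (unitary A) where
  carrier := {v | (fun x => c v * x * star (c v)) '' X = X}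
  one_mem' := by simp
  mul_mem' := by
    intro v w hv hw
    have e : (fun x => c (v * w : unitary A) * x * star (c (v * w : unitary A))) =
        (fun x => c v * x * star (c v)) ∘ fun x => c w * x * star (c w) := by
      funext x
      simp only [Submonoid.coe_mul, map_mul, star_mul, Function.comp_apply, mul_assoc]
    rw [Set.mem_ofPred_eq, e, Set.image_comp]
    exact (congrArg _ hw).trans hv
  inv_mem' := by
    intro v hv
    have e : (fun x => c (v⁻¹ : unitary A) * x * star (c (v⁻¹ : unitary A))) ∘
        (fun x => c v * x * star (c v)) = id := by
      funext x
      have h : star (c v) * c v = 1 := by rw [← map_star, ← map_mul, Unitary.coe_star_mul_self, map_one]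
      change c (star (v : A)) * (c v * x * star (c v)) * star (c (star (v : A))) = x
      rw [map_star, star_star]
      calc _ = (star (c v) * c v) * x * (star (c v) * c v) := by simp only [mul_assoc]
        _ = x := by rw [h, one_mul, mul_one]
    rw [Set.mem_ofPred_eq]
    conv_lhs => rw [← show (fun x => c v * x * star (c v)) '' X = X from hv]
    rw [← Set.image_comp, e, Set.image_id]

lemma star_mul_mul_mem_of_mem_conjStabilizer {A C : Type*} [CStarAlgebra A] [Ring C] [StarRing C]
    {c : A →⋆* C} {X : Set C} {v : unitary A} (hv : v ∈ conjStabilizer c X) {x : C} (hx : x ∈ X) :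
    star (c v) * x * c v ∈ X := by
  have h : (fun x => c (v⁻¹ : unitary A) * x * star (c (v⁻¹ : unitary A))) '' X = X :=
    (conjStabilizer c X).inv_mem hv
  rw [← h]
  refine ⟨x, hx, ?_⟩
  change c (star (v : A)) * x * star (c (star (v : A))) = _
  rw [map_star, star_star]

section

variable {K : Type u} [NormedAddCommGroup K] [InnerProductSpace ℂ K] [CompleteSpace K]
  {N : VonNeumannAlgebra K} {τ : FaithfulNormalTrace N}

lemma L2Deformation.convergesUniformlyOnBall_of_supply (d : L2Deformation N τ)
    (G : Subgroup (unitary N.toStarSubalgebra))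
    (h : ∀ ε > 0, ∃ α₀ : ℝ, 0 < α₀ ∧ ∀ α > α₀, ∀ v ∈ G, d.HasSupply α ε (v : N.toStarSubalgebra)) :
    d.ConvergesUniformlyOnBall (generatedVN ((fun v : unitary N.toStarSubalgebra =>
      ((v : N.toStarSubalgebra) : K →L[ℂ] K)) '' (G : Set (unitary N.toStarSubalgebra)))) := by
  intro ε hε
  obtain ⟨e, he, hlt⟩ : ∃ e : ℝ, 0 < e ∧ √(80 * √(16 * √e + 12 * e)) < ε := by
    have hc : Continuous fun e : ℝ => √(80 * √(16 * √e + 12 * e)) := by fun_prop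
    have h0 : ∀ᶠ e in 𝓝[>] (0 : ℝ), √(80 * √(16 * √e + 12 * e)) < ε :=
      (hc.tendsto 0).mono_left nhdsWithin_le_nhds |>.eventually_lt_const (by simpa using hε)
    obtain ⟨e, he, he0⟩ := (h0.and self_mem_nhdsWithin).exists
    exact ⟨e, he0, he⟩
  obtain ⟨α₀, hα₀, hs⟩ := h e he
  refine ⟨α₀, hα₀, fun α hα x hx hx1 => ?_⟩
  have hαpos : 0 < α := hα₀.trans hα
  refine (d.displacement_sq_le_of_mem_generatedVN hαpos G (fun v hv => ?_) hx1 hx).trans_lt hlt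
  exact Real.le_sqrt_of_sq_le
    ((hs α hα v hv).displacement_sq_le hαpos he.le (norm_unitary_le_one v))

lemma mul_mul_star_mul_mul {A : Type*} [Monoid A] [StarMul A] (u : A) {v : A}
    (hv : v * star v = 1) (hu : u * u = 1) : u * v * (star v * u * v) = v := by
  calc u * v * (star v * u * v) = u * (v * star v) * u * v := by simp only [mul_assoc]
    _ = v := by rw [hv, mul_one, hu, one_mul]

lemma norm_symmetry_le_one {A : Type*} [CStarAlgebra A] {u : A} (hu : IsSelfAdjoint u)
    (huu : u * u = 1) : ‖u‖ ≤ 1 := by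
  have h : u ∈ unitary A := by
    rw [Unitary.mem_iff, hu.star_eq]
    exact ⟨huu, huu⟩
  exact norm_unitary_le_one ⟨u, h⟩

lemma norm_star_mul_mul_le_one {A : Type*} [CStarAlgebra A] {u : A} (hu : ‖u‖ ≤ 1)
    (v : unitary A) : ‖star (v : A) * u * v‖ ≤ 1 := by
  have hv := norm_unitary_le_one v
  refine (norm_mul_le _ _).trans (mul_le_one₀ ((norm_mul_le _ _).trans
    (mul_le_one₀ ?_ (norm_nonneg _) hu)) (norm_nonneg _) hv)
  rwa [norm_star]

/-- The inclusion of a von Neumann algebra in the algebra of all operators. -/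
def coeHom (N : VonNeumannAlgebra K) : N.toStarSubalgebra →⋆* (K →L[ℂ] K) :=
  StarMonoidHom.ofClass N.toStarSubalgebra.subtype

lemma normalizer_eq (B : VonNeumannAlgebra K) :
    normalizer N B = (fun v : unitary N.toStarSubalgebra => ((v : N.toStarSubalgebra) : K →L[ℂ] K)) ''
      (conjStabilizer (coeHom N) (B : Set (K →L[ℂ] K)) : Set (unitary N.toStarSubalgebra)) := by
  ext v
  constructor
  · rintro ⟨hN, hu, h⟩
    exact ⟨⟨⟨v, hN⟩, Unitary.mem_iff.2 ⟨Subtype.ext (Unitary.mem_iff.1 hu).1,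
      Subtype.ext (Unitary.mem_iff.1 hu).2⟩⟩, h, rfl⟩
  · rintro ⟨v, hv, rfl⟩
    exact ⟨v.1.2, Unitary.mem_iff.2 ⟨congrArg Subtype.val (Unitary.mem_iff.1 v.2).1,
      congrArg Subtype.val (Unitary.mem_iff.1 v.2).2⟩, hv⟩

lemma L2Deformation.hasSupply_of_mem_normalizer (d : L2Deformation N τ) {B : VonNeumannAlgebra K}
    (hBN : B ≤ N) (hB : IsDiffuse B) {α ε : ℝ}
    (hconv : ∀ x : N.toStarSubalgebra, (x : K →L[ℂ] K) ∈ B → ‖x‖ ≤ 1 → d.displacement α x < ε)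
    {v : unitary N.toStarSubalgebra}
    (hv : v ∈ conjStabilizer (coeHom N) (B : Set (K →L[ℂ] K))) :
    d.HasSupply α ε (v : N.toStarSubalgebra) := by
  intro T κ hκ
  obtain ⟨ξ, hξ⟩ := exists_vector_inner_hat τ
  obtain ⟨u₀, huB, husa, huu, horth⟩ := exists_symmetry_of_isDiffuse hB ξ
    (fun x : T => ampliation K ((x : N.toStarSubalgebra) : K →L[ℂ] K) ξ) hκ
  obtain ⟨u, rfl⟩ : ∃ u : N.toStarSubalgebra, (u : K →L[ℂ] K) = u₀ := ⟨⟨u₀, hBN huB⟩, rfl⟩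
  have husa' : IsSelfAdjoint u := Subtype.ext husa
  have huu' : u * u = 1 := Subtype.ext huu
  have hu1 : ‖u‖ ≤ 1 := norm_symmetry_le_one husa' huu'
  have hw1 := norm_star_mul_mul_le_one hu1 v
  refine ⟨u, star (v : N.toStarSubalgebra) * u * v, husa', husa'.conjugate' _, hu1, hw1,
    (hconv u huB hu1).le,
    (hconv _ (star_mul_mul_mem_of_mem_conjStabilizer hv huB) hw1).le, ?_, fun x hx => ?_⟩
  · rw [mul_mul_star_mul_mul u (Unitary.coe_mul_star_self v) huu', sub_self, map_zero, norm_zero]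
    exact hκ.le
  · rw [hξ]
    exact horth ⟨x, hx⟩

end

lemma exists_selfAdjoint_contraction_lift {A C : Type*} [NonUnitalCStarAlgebra A] [CStarAlgebra C]
    (φ : A →⋆ₙₐ[ℂ] C) {a : A} (hsa : IsSelfAdjoint (φ a)) (h1 : ‖φ a‖ ≤ 1) :
    ∃ b : A, IsSelfAdjoint b ∧ ‖b‖ ≤ 1 ∧ φ b = φ a := by
  obtain ⟨r, hr⟩ : ∃ r : A, r = (1 / 2 : ℂ) • (a + star a) := ⟨_, rfl⟩
  have hrsa : IsSelfAdjoint r := by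
    rw [hr, IsSelfAdjoint, star_smul, star_add, star_star, add_comm]
    norm_num
  have hφr : φ r = φ a := by
    rw [hr, map_smul, map_add, map_star, hsa.star_eq, ← two_smul ℂ (φ a), smul_smul]
    norm_num
  let f : ℝ → ℝ := fun t => max (-1) (min 1 t)
  have hf : Continuous f := by fun_prop
  have hf0 : f 0 = 0 := by simp [f]
  have hφsa : IsSelfAdjoint (φ r) := hφr ▸ hsa
  refine ⟨cfcₙ f r, cfcₙ_predicate f r, norm_cfcₙ_le fun t _ => ?_, ?_⟩
  · rw [Real.norm_eq_abs, abs_le]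
    exact ⟨le_max_left _ _, max_le (by norm_num) (min_le_left _ _)⟩
  · have hφc : Continuous φ := by
      refine AddMonoidHomClass.continuous_of_bound φ 1 fun x => ?_
      rw [one_mul]
      exact NonUnitalStarAlgHom.norm_apply_le φ x
    rw [φ.map_cfcₙ f r hf.continuousOn hf0 hφc hrsa hφsa]
    have hEq : Set.EqOn f id (quasispectrum ℝ (φ r)) := by
      intro t ht
      rw [quasispectrum_eq_spectrum_union_zero] at ht
      have ht1 : -1 ≤ t ∧ t ≤ 1 := by
        rcases ht with ht | ht
        · have := spectrum_subset_Icc_norm ht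
          rw [hφr] at this
          exact ⟨by linarith [this.1], by linarith [this.2]⟩
        · rw [Set.mem_singleton_iff.1 ht]
          norm_num
      change max (-1) (min 1 t) = t
      rw [min_eq_right ht1.2, max_eq_right ht1.1]
    rw [cfcₙ_congr hEq, cfcₙ_id ℝ (φ r), hφr]

section Ultrapower

variable {K : Type u} [NormedAddCommGroup K] [InnerProductSpace ℂ K] [CompleteSpace K]
  {N : VonNeumannAlgebra K} {τ : FaithfulNormalTrace N} {ω : Ultrafilter ℕ}

lemma BoundedSeq.norm_apply_le {A : Type*} [CStarAlgebra A] (a : BoundedSeq A) (n : ℕ) :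
    ‖a n‖ ≤ ‖a‖ :=
  lp.norm_apply_le_norm (E := fun _ : ℕ => A) (by simp) a n

lemma BoundedSeq.const_one_mul {A : Type*} [CStarAlgebra A] (a : BoundedSeq A) :
    BoundedSeq.const 1 * a = a :=
  lp.ext (E := fun _ : ℕ => A) (funext fun n => one_mul (a n))

lemma BoundedSeq.mul_const_one {A : Type*} [CStarAlgebra A] (a : BoundedSeq A) :
    a * BoundedSeq.const 1 = a :=
  lp.ext (E := fun _ : ℕ => A) (funext fun n => mul_one (a n))

variable (τ ω) in
/-- The canonical map from bounded sequences to `L²(N^ω)`. -/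
def ultraHat : BoundedSeq N.toStarSubalgebra →ₗ[ℂ] UltraL2 τ ω :=
  gnsHat (ultraFunctional τ.toLinearMap τ.nonneg ω)
    (ultraFunctional_nonneg τ.toLinearMap τ.nonneg ω)

lemma toUltra_ultraHat (a b : BoundedSeq N.toStarSubalgebra) :
    toUltra τ ω a (ultraHat τ ω b) = ultraHat τ ω (a * b) := gnsLeft_gnsHat _ _ _ _

lemma tendsto_inner_ultraHat (a b : BoundedSeq N.toStarSubalgebra) :
    Tendsto (fun n => ⟪hat τ (a n), hat τ (b n)⟫_ℂ) ω (𝓝 ⟪ultraHat τ ω a, ultraHat τ ω b⟫_ℂ) := by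
  have h := tendsto_ultraFunctional τ.toLinearMap τ.nonneg ω (star a * b)
  have e : ⟪ultraHat τ ω a, ultraHat τ ω b⟫_ℂ =
      ultraFunctional τ.toLinearMap τ.nonneg ω (star a * b) := inner_gnsHat _ _ _ _
  rw [e]
  exact h.congr fun n => (inner_hat τ (a n) (b n)).symm

lemma tendsto_norm_hat_of_toUltra_eq_zero {a : BoundedSeq N.toStarSubalgebra}
    (ha : toUltra τ ω a = 0) : Tendsto (fun n => ‖hat τ (a n)‖) ω (𝓝 0) := by
  have h0 : ultraHat τ ω a = 0 := by
    rw [← BoundedSeq.mul_const_one a, ← toUltra_ultraHat, ha]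
    rfl
  have h := (tendsto_inner_ultraHat (τ := τ) (ω := ω) a a).norm
  rw [h0, inner_zero_left, norm_zero] at h
  have h2 := h.sqrt
  rw [Real.sqrt_zero] at h2
  refine h2.congr fun n => ?_
  rw [inner_self_eq_norm_sq_to_K, norm_pow, RCLike.norm_ofReal, abs_norm,
    Real.sqrt_sq (norm_nonneg _)]

variable (τ ω) in
/-- The inclusion of `N` in `N^ω`. -/
def ultraConstHom : N.toStarSubalgebra →⋆* (UltraL2 τ ω →L[ℂ] UltraL2 τ ω) where
  toFun := ultraConst τ ω
  map_one' := by
    refine DFunLike.coe_injective ((denseRange_gnsHat _ _).equalizer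
      (ultraConst τ ω 1).continuous (1 : UltraL2 τ ω →L[ℂ] UltraL2 τ ω).continuous
      (funext fun a => ?_))
    change toUltra τ ω (BoundedSeq.const 1) (ultraHat τ ω a) = ultraHat τ ω a
    rw [toUltra_ultraHat, BoundedSeq.const_one_mul]
  map_mul' x y := map_mul (toUltra τ ω) (BoundedSeq.const x) (BoundedSeq.const y)
  map_star' x := map_star (toUltra τ ω) (BoundedSeq.const x)

lemma ultraNormalizer_eq (B : VonNeumannAlgebra (UltraL2 τ ω)) :
    ultraNormalizer τ ω B = (fun v : unitary N.toStarSubalgebra =>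
      ((v : N.toStarSubalgebra) : K →L[ℂ] K)) '' (conjStabilizer (ultraConstHom τ ω)
        (B : Set (UltraL2 τ ω →L[ℂ] UltraL2 τ ω)) : Set (unitary N.toStarSubalgebra)) := by
  ext v
  constructor
  · rintro ⟨hN, hu, h⟩
    exact ⟨⟨⟨v, hN⟩, Unitary.mem_iff.2 ⟨Subtype.ext (Unitary.mem_iff.1 hu).1,
      Subtype.ext (Unitary.mem_iff.1 hu).2⟩⟩, h, rfl⟩
  · rintro ⟨v, hv, rfl⟩
    exact ⟨v.1.2, Unitary.mem_iff.2 ⟨congrArg Subtype.val (Unitary.mem_iff.1 v.2).1,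
      congrArg Subtype.val (Unitary.mem_iff.1 v.2).2⟩, hv⟩

lemma L2Deformation.tendsto_displacement (d : L2Deformation N τ) {α : ℝ} (hα : 0 < α)
    (a : BoundedSeq N.toStarSubalgebra) :
    Tendsto (fun n => d.displacement α (a n)) ω
      (𝓝 (limUnder (ω : Filter ℕ) fun n => d.displacement α (a n))) := by
  apply tendsto_nhds_limUnder
  have hb : ∀ n, d.displacement α (a n) ∈ Set.Icc 0 ‖a‖ := fun n => by
    refine ⟨norm_nonneg _, ((d.resolvent hα).norm_sub_le hα _).trans ?_⟩
    refine (d.δ.derivationGraph.norm_hat_le _).trans ?_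
    rw [show d.δ.derivationGraph.hat 1 = hat d.tr 1 from rfl, norm_hat_one, mul_one]
    exact (d.norm_incl_le _).trans (a.norm_apply_le n)
  obtain ⟨x, -, hx⟩ := (isCompact_Icc (a := (0 : ℝ)) (b := ‖a‖)).ultrafilter_le_nhds
    (ω.map fun n => d.displacement α (a n)) (by
      rw [le_principal_iff, Ultrafilter.mem_coe, Ultrafilter.mem_map]
      exact Filter.univ_mem' hb)
  exact ⟨x, hx⟩

lemma map_mul_mul_star_mul_mul_sub_eq_zero {A C : Type*} [NonUnitalRing A] [StarRing A] [Module ℂ A]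
    [Ring C] [StarRing C] [Module ℂ C] (φ : A →⋆ₙₐ[ℂ] C) {a w : A}
    (hw : φ w * star (φ w) = 1) (ha : φ a * φ a = 1) :
    φ (a * w * (star w * a * w) - w) = 0 := by
  rw [map_sub, map_mul, map_mul, map_mul, map_mul, map_star, mul_mul_star_mul_mul _ hw ha, sub_self]

lemma L2Deformation.hasSupply_of_mem_ultraNormalizer (d : L2Deformation N τ)
    {B : VonNeumannAlgebra (UltraL2 τ ω)} (hBN : ∀ x ∈ B, x ∈ ultrapower τ ω) (hB : IsDiffuse B)
    {α ε : ℝ} (hα : 0 < α)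
    (hconv : ∀ a : BoundedSeq N.toStarSubalgebra, toUltra τ ω a ∈ B → ‖toUltra τ ω a‖ ≤ 1 →
      limUnder (ω : Filter ℕ) (fun n => d.displacement α (a n)) < ε)
    {v : unitary N.toStarSubalgebra}
    (hv : v ∈ conjStabilizer (ultraConstHom τ ω) (B : Set (UltraL2 τ ω →L[ℂ] UltraL2 τ ω))) :
    d.HasSupply α ε (v : N.toStarSubalgebra) := by
  intro T κ hκ
  obtain ⟨u, huB, husa, huu, horth⟩ := exists_symmetry_of_isDiffuse hB
    (lp.single 2 0 (ultraHat τ ω (BoundedSeq.const 1)))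
    (fun x : T => lp.single 2 0 (ultraHat τ ω (BoundedSeq.const (x : N.toStarSubalgebra))))
    (half_pos hκ)
  obtain ⟨a₀, rfl⟩ := hBN u huB
  have hu1 := norm_symmetry_le_one husa huu
  obtain ⟨a, hasa, ha1, haeq⟩ := exists_selfAdjoint_contraction_lift (toUltra τ ω) husa hu1
  rw [← haeq] at huB husa huu horth hu1
  let V : BoundedSeq N.toStarSubalgebra := BoundedSeq.const (v : N.toStarSubalgebra)
  let b : BoundedSeq N.toStarSubalgebra := star V * a * V
  have hbB : toUltra τ ω b ∈ B := by
    have := star_mul_mul_mem_of_mem_conjStabilizer hv huB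
    have e : toUltra τ ω b = star (ultraConstHom τ ω v) * toUltra τ ω a * ultraConstHom τ ω v := by
      change toUltra τ ω (star V * a * V) = star (toUltra τ ω V) * toUltra τ ω a * toUltra τ ω V
      rw [map_mul, map_mul, map_star]
    rw [e]
    exact this
  have hbn : ∀ n, b n = star (v : N.toStarSubalgebra) * a n * v := fun n => rfl
  have han1 : ∀ n, ‖a n‖ ≤ 1 := fun n => (a.norm_apply_le n).trans ha1
  have hansa : ∀ n, IsSelfAdjoint (a n) := fun n =>
    congrArg (fun c : BoundedSeq N.toStarSubalgebra => c n) hasa.star_eq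
  have hbn1 : ∀ n, ‖b n‖ ≤ 1 := fun n => norm_star_mul_mul_le_one (han1 n) v
  have hb1 : ‖toUltra τ ω b‖ ≤ 1 := by
    refine (NonUnitalStarAlgHom.norm_apply_le _ _).trans ?_
    exact lp.norm_le_of_forall_le (E := fun _ : ℕ => N.toStarSubalgebra) zero_le_one hbn1
  have hzero : toUltra τ ω (a * V * b - V) = 0 := by
    refine map_mul_mul_star_mul_mul_sub_eq_zero (toUltra τ ω) ?_ huu
    have hvv : (v : N.toStarSubalgebra) * star (v : N.toStarSubalgebra) = 1 :=
      Unitary.coe_mul_star_self v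
    change ultraConstHom τ ω v * star (ultraConstHom τ ω v) = 1
    rw [← map_star, ← map_mul, hvv, map_one]
  have ev1 := (d.tendsto_displacement hα a).eventually_lt_const (hconv a huB hu1)
  have ev2 := (d.tendsto_displacement hα b).eventually_lt_const (hconv b hbB hb1)
  have ev3 := (tendsto_norm_hat_of_toUltra_eq_zero hzero).eventually_lt_const hκ
  have ev4 : ∀ᶠ n in (ω : Filter ℕ), ∀ x ∈ T, ‖⟪hat τ x, hat τ (a n)⟫_ℂ‖ < κ := by
    rw [Filter.eventually_all_finset]
    intro x hx
    have h := (tendsto_inner_ultraHat (τ := τ) (ω := ω) (BoundedSeq.const x) a).norm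
    refine h.eventually_lt_const (lt_of_le_of_lt ?_ (half_lt_self hκ))
    have := horth ⟨x, hx⟩
    rw [ampliation_single, toUltra_ultraHat, BoundedSeq.mul_const_one, lp.inner_single_left,
      lp.single_apply_self] at this
    exact this
  obtain ⟨n, h1, h2, h3, h4⟩ := (ev1.and (ev2.and (ev3.and ev4))).exists
  exact ⟨a n, b n, hansa n, (hansa n).conjugate' _, han1 n, hbn1 n, h1.le, h2.le, h3.le,
    fun x hx => (h4 x hx).le⟩

end Ultrapower

end L2Rigidity

end

theorem theorem3p5 {K : Type u} [NormedAddCommGroup K] [InnerProductSpace ℂ K] [CompleteSpace K]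
    (N : VonNeumannAlgebra K) (τ : FaithfulNormalTrace N) :
    (∀ ω : Ultrafilter ℕ, (ω : Filter ℕ) ≤ Filter.cofinite →
      ∀ (η : L2Deformation N τ) (B : VonNeumannAlgebra (UltraL2 τ ω)),
        (∀ x ∈ B, x ∈ ultrapower τ ω) → IsDiffuse B →
        η.ConvergesUniformlyOnUltraBall ω B →
        η.ConvergesUniformlyOnBall (generatedVN (ultraNormalizer τ ω B))) ∧
    (∀ B : VonNeumannAlgebra K, B ≤ N → IsDiffuse B →
      IsL2Rigid N τ B → IsL2Rigid N τ (generatedVN (normalizer N B))) := by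
  constructor
  · intro ω _ η B hBN hB hconv
    rw [ultraNormalizer_eq]
    refine η.convergesUniformlyOnBall_of_supply _ fun ε hε => ?_
    obtain ⟨α₀, hα₀, h⟩ := hconv ε hε
    exact ⟨α₀, hα₀, fun α hα v hv =>
      η.hasSupply_of_mem_ultraNormalizer hBN hB (hα₀.trans hα) (h α hα) hv⟩
  · intro B hBN hB hrigid η
    rw [normalizer_eq]
    refine η.convergesUniformlyOnBall_of_supply _ fun ε hε => ?_
    obtain ⟨α₀, hα₀, h⟩ := hrigid η ε hε
    exact ⟨α₀, hα₀, fun α hα v hv => η.hasSupply_of_mem_normalizer hBN hB (h α hα) hv⟩
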